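/- **The calculus.** Fix a denumerable set $\mathcal Q$ of qubit names, a denumerable set of tags $t$, and, for each type $T\in\{\mathbb N,\mathbb B,\mathcal Q\}$, denumerably many variables $x:T$ and channels $c:\widehat T$ (a channel $c:\widehat T$ carries values of type $T$; the values are $n\in\mathbb N$, $b\in\mathbb B$, $q\in\mathcal Q$). Expressions are $e::=x\mid b\mid n\mid q\mid\neg e\mid e\lor e\mid e\le e\mid e=e$, with the obvious typing ($e=e'$ compares expressions of the same type) and evaluation $e\Downarrow v$. Processes are $$P::=t{:}\tau.P\mid(t,t'){:}\tau.P\mid t{:}\mathcal E(\tilde e).P\mid t{:}\mathbb M(\tilde e\rhd y).P\mid t{:}c?x.P\mid t{:}c!e.P\mid \mathbf 0_{\tilde e}\mid \text{if }e\text{ then }P\text{ else }P\mid P+P\mid P\parallel P\mid P\setminus c,$$ where $\mathcal E$ is a trace-preserving superoperator on $n>0$ qubits, $\mathbb M=\{M_0,\dots,M_{k-1}\}$, $\sum_m M_m^\dagger M_m=\mathbb I$, is a measurement on $n$ qubits, and $\tilde e$ has length $n$ in both cases. *Typing.* For a finite set $\Gamma$ of qubit names and qubit variables, $\Gamma\vdash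 P$ is defined by: $\Gamma\vdash\mathbf 0_{\tilde e}$ if $\tilde e$ lists the elements of $\Gamma$ without repetition; $\tau$-prefixes and restriction preserve the context of $P$; $\mathcal E(\tilde e)$ and $\mathbb M(\tilde e\rhd y)$ also preserve it and require $\tilde e$ to be a tuple of distinct elements of $\Gamma$ (and $y:\mathbb N$); $\Gamma\vdash P+Q$ and $\Gamma\vdash\text{if }e\text{ then }P\text{ else }Q$ if $\Gamma\vdash P$, $\Gamma\vdash Q$ (and $e:\mathbb B$); for $c:\widehat T$ with $T\in\{\mathbb N,\mathbb B\}$, $\Gamma\vdash t{:}c?x.P$ if $x:T$, $\Gamma\vdash P$, and $\Gamma\vdash t{:}c!e.P$ if $e:T$, $\Gamma\vdash P$; for $c:\widehat{\mathcal Q}$, $\Gamma\vdash t{:}c?x.P$ if $x:\mathcal Q$, $x\notin\Gamma$, $\Gamma\cup\{x\}\vdash P$, and $\Gamma\vdash t{:}c!e.P$ if $e\in\Gamma$, $\Gamma\setminus\{e\}\vdash P$; $\Gamma_1\cup\Gamma_2\vdash P\parallel Q$ if $\Gamma_1\vdash P$, $\Gamma_2\vdash Q$, $\Gamma_1\cap\Gamma_2=\emptyset$.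 Types are unique; $\Sigma_P$ denotes the type of $P$. *Semantics.* Fix a finite $\Sigma\subseteq\mathcal Q$ and let $\mathcal H_A=(\mathbb C^2)^{\otimes A}$ for $A\subseteq\Sigma$. A configuration is a pair $\langle\rho,P\rangle$ of a trace-one density operator $\rho$ on $\mathcal H_\Sigma$ and a process. Actions $\mu$ are $\tau$, $c!v$, $c?v$; schedulers are $s::=h\mid t\mid(t,t')$. For a superoperator $\mathcal E$ (in particular $\mathcal M_m(\sigma)=M_m\sigma M_m^\dagger$), $\mathcal E^{\tilde q}$ is $\mathcal E$ acting on the qubits $\tilde q$, tensored with the identity on the others. The transitions $\langle\rho,P\rangle\xrightarrow{\mu}_s\Delta$, with $\Delta$ a finitely supported probability distribution on configurations, are the least relation such that ($\overline{\,\cdot\,}$ denotes a point distribution): - $\langle\rho,t{:}\tau.P\rangle\xrightarrow{\tau}_t\overline{\langle\rho,P\rangle}$; $\langle\rho,(t,t'){:}\tau.P\rangle\xrightarrow{\tau}_{(t,t')}\overline{\langle\rho,P\rangle}$; $\langle\rho,t{:}c!e.P\rangle\xrightarrow{c!v}_t\overline{\langle\rho,P\rangle}$ if $e\Downarrow v$;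 $\langle\rho,t{:}c?x.P\rangle\xrightarrow{c?v}_t\overline{\langle\rho,P[v/x]\rangle}$ if $v$ has the type carried by $c$ and, when $v$ is a qubit, $v\in\Sigma$ and $v\notin\Sigma_{c?x.P}$; - $\langle\rho,t{:}\mathcal E(\tilde q).P\rangle\xrightarrow{\tau}_t\overline{\langle\mathcal E^{\tilde q}(\rho),P\rangle}$; $\langle\rho,t{:}\mathbb M(\tilde q\rhd y).P\rangle\xrightarrow{\tau}_t\sum_m p_m\,\overline{\langle\mathcal M_m^{\tilde q}(\rho)/p_m,P[m/y]\rangle}$ with $p_m=\mathrm{tr}(\mathcal M_m^{\tilde q}(\rho))$; - a conditional has the transitions of the branch selected by the value of its guard, $P+Q$ those of $P$ and those of $Q$, and $P\setminus c$ those of $P$ on actions other than $c!v$, $c?v$ (with $\setminus c$ reapplied); - $P\parallel Q$ has the transitions of $P$ (in parallel with $Q$) except $c?q$ with $q\in\Sigma_Q$, symmetrically those of $Q$, and, if one component performs $c!v$ with scheduler $t$ and the other $c?v$ with scheduler $t'$, the resulting synchronization with action $\tau$ and scheduler $(t,t')$. Add a deadlock configuration $\bot$ and, for all $\mu,s$,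 transitions to $\overline\bot$ from $\bot$ and from every configuration without $\mu,s$-transition. The lifting of a relation between elements and distributions is the smallest relation between distributions containing the pairs $(\overline a,\Theta)$ with $a$ related to $\Theta$ and closed under binary convex combinations of pairs. Lifting first in the scheduler and then in the configuration gives $\Delta\xrightarrow{\mu}_\delta\Delta'$, for finitely supported probability distributions $\Delta,\Delta'$ on configurations and $\bot$, and $\delta$ on schedulers. Write $(\Sigma,\Sigma')\vdash\Delta$ if $P$ is closed and $\Sigma'\vdash P$, $\Sigma'\subseteq\Sigma$, for all $\langle\rho,P\rangle\in\mathrm{supp}(\Delta)$; $\mathrm{mass}(\Delta)=1-\Delta(\bot)$; $qs(\Delta)=\sum_{\langle\rho,P\rangle}\Delta(\langle\rho,P\rangle)\rho$. *Deterministic tagging.* $P$ is locally deterministic if, for every $\rho$, $\langle\rho,P\rangle\xrightarrow{\mu}_s\Delta'$ and $\langle\rho,P\rangle\xrightarrow{\mu}_s\Delta''$ imply $\Delta'=\Delta''$, and $\langle\rho,P\rangle\xrightarrow{c!v}_t\Delta'$ and $\langle\rho,P\rangle\xrightarrow{c'!v'}_t\Delta''$ imply $c=c'$, $v=v'$. It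 is deterministically tagged if all processes reachable from it by transitions (with arbitrary quantum states over $\Sigma$) are locally deterministic, and a distribution is so if all the processes in its support are. **Saturated bisimilarity** $\sim_s$ is the largest relation $\mathcal R$ such that $\Delta\,\mathcal R\,\Theta$ implies, for some $\Sigma'$, $(\Sigma,\Sigma')\vdash\Delta$, $(\Sigma,\Sigma')\vdash\Theta$, $\mathrm{mass}(\Delta)=\mathrm{mass}(\Theta)$ and, for every context $B[\cdot]=[\cdot]\parallel Q$ with $Q$ closed, $\Sigma''\setminus\Sigma'\vdash Q$, $\Sigma'\subseteq\Sigma''\subseteq\Sigma$, such that $B[\Delta]$ and $B[\Theta]$ are deterministically tagged, and every $\delta$: whenever $B[\Delta]\xrightarrow{\tau}_\delta\Delta'$ there is $\Theta'$ with $B[\Theta]\xrightarrow{\tau}_\delta\Theta'$ and $\Delta'\,\mathcal R\,\Theta'$, and symmetrically. Here $B[\bot]=\bot$. **Labelled bisimilarity** $\sim_l$ is the largest relation $\mathcal R$ such that $\Delta\,\mathcal R\,\Theta$ implies, for some $\Sigma'$, $(\Sigma,\Sigma')\vdash\Delta$, $(\Sigma,\Sigma')\vdash\Theta$ and - $\mathrm{tr}_{\Sigma'}(qs(\Delta))=\mathrm{tr}_{\Sigma'}(qs(\Theta))$;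 - $\dot{\mathcal E}(\Delta)\,\mathcal R\,\dot{\mathcal E}(\Theta)$ for every trace non-increasing superoperator $\mathcal E$ on $\mathcal H_{\Sigma\setminus\Sigma'}$ for which both sides are defined, where, extending $\mathcal E$ by the identity, $\dot{\mathcal E}$ keeps the weight of $\bot$ and replaces the rest $\sum_i p_i\overline{\langle\rho_i,P_i\rangle}$ by $\mathrm{mass}(\Delta)\sum_i\frac{p_i\,\mathrm{tr}\,\mathcal E(\rho_i)}{p_{\mathcal E}}\overline{\langle\mathcal E(\rho_i)/\mathrm{tr}\,\mathcal E(\rho_i),P_i\rangle}$, $p_{\mathcal E}=\sum_ip_i\,\mathrm{tr}\,\mathcal E(\rho_i)$, and is defined when $p_{\mathcal E}\neq0$; - for all $\mu,\delta$, whenever $\Delta\xrightarrow{\mu}_\delta\Delta'$ there is $\Theta'$ with $\Theta\xrightarrow{\mu}_\delta\Theta'$ and $\Delta'\,\mathcal R\,\Theta'$, and symmetrically. **Theorem.** For every finite $\Sigma\subseteq\mathcal Q$ and all deterministically tagged distributions $\Delta,\Theta$ on configurations over $\Sigma$ and $\bot$: $\Delta\sim_l\Theta$ if and only if $\Delta\sim_s\Theta$.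 -/

import Mathlib

open scoped ComplexOrder

noncomputable section

namespace LqCCS

/-! ### Finitely supported probability distributions -/

/-- Probability distributions with finite support over `A`. -/
abbrev FDist (A : Type) : Type := Convexity.StdSimplex ℝ A

/-- The point distribution on `a`. -/
abbrev point {A : Type} (a : A) : FDist A := Convexity.StdSimplex.single a

/-- The binary convex combination giving weight `p` to the first argument
and weight `1 - p` to the second one. -/
def mix {A : Type} (p : ℝ) (h0 : 0 ≤ p) (h1 : p ≤ 1) (D E : FDist A) : FDist A :=
  Convexity.convexCombPair p (1 - p) h0 (sub_nonneg.2 h1) (by ring) D E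

/-- The lifting of a relation: the smallest linear relation that relates the point
distribution on `a` to `E` whenever `R a E`. -/
inductive Lift {A B : Type} (R : A → FDist B → Prop) : FDist A → FDist B → Prop
  | base {a : A} {E : FDist B} : R a E → Lift R (point a) E
  | linear {D D' : FDist A} {E E' : FDist B} (p : ℝ) (h0 : 0 ≤ p) (h1 : p ≤ 1) :
      Lift R D E → Lift R D' E' → Lift R (mix p h0 h1 D D') (mix p h0 h1 E E')

/-! ### Quantum states, superoperators and measurements -/

/-- Linear operators on the state space of a family of qubits indexed by `ι`;
the computational basis is indexed by the bit strings `ι → Fin 2`. -/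
abbrev Op (ι : Type) : Type := Matrix (ι → Fin 2) (ι → Fin 2) ℂ

open Classical in
/-- The operator `K` applied to the qubits listed by `q`, tensored with the identity on
all the other qubits. -/
def embed {ι κ : Type} (q : ι ↪ κ) (K : Op ι) : Op κ :=
  Matrix.of fun a b =>
    if ∀ k, k ∉ Set.range q → a k = b k then K (a ∘ q) (b ∘ q) else 0

/-- The map `E` on operators applied to the qubits listed by `q`, tensored with the identity
map on all the other qubits. -/
def applyAt {ι κ : Type} (q : ι ↪ κ) (E : Op ι → Op ι) (ρ : Op κ) : Op κ :=
  Matrix.of fun a b =>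
    E (Matrix.of fun x y => ρ (Function.extend q x a) (Function.extend q y b)) (a ∘ q) (b ∘ q)

/-- The map on operators with Kraus decomposition `K`. -/
def krausMap {ι : Type} [Fintype ι] [DecidableEq ι] {r : ℕ} (K : Fin r → Op ι) (ρ : Op ι) : Op ι :=
  ∑ i, K i * ρ * (K i).conjTranspose

/-- Trace non-increasing superoperators. -/
def IsSuperop {ι : Type} [Fintype ι] [DecidableEq ι] (E : Op ι → Op ι) : Prop :=
  ∃ (r : ℕ) (K : Fin r → Op ι),
    (1 - ∑ i, (K i).conjTranspose * K i).PosSemidef ∧ E = krausMap K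

/-- Trace-preserving superoperators. -/
def IsTPSuperop {ι : Type} [Fintype ι] [DecidableEq ι] (E : Op ι → Op ι) : Prop :=
  ∃ (r : ℕ) (K : Fin r → Op ι), ∑ i, (K i).conjTranspose * K i = 1 ∧ E = krausMap K

/-- The trace-preserving superoperators on `n` qubits. -/
abbrev TPSuperop (n : ℕ) : Type := {E : Op (Fin n) → Op (Fin n) // IsTPSuperop E}

/-- The measurements on `n` qubits with `k` outcomes. -/
structure Measurement (n k : ℕ) where
  op : Fin k → Op (Fin n)
  complete : ∑ m, (op m).conjTranspose * op m = 1

/-- The density operators of trace one over the qubits indexed by `κ`. -/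
abbrev Density (κ : Type) [Fintype κ] [DecidableEq κ] : Type := {ρ : Op κ // ρ.PosSemidef ∧ ρ.trace = 1}

theorem extend_comp_self {ι κ : Type} (q : ι ↪ κ) (x : ι → Fin 2) (a : κ → Fin 2) :
    Function.extend q x a ∘ q = x := by
  funext i
  exact q.injective.extend_apply _ _ _

theorem embed_mul_apply {ι κ : Type} [Fintype ι] [Fintype κ] [DecidableEq ι] [DecidableEq κ]
    {γ : Type} (q : ι ↪ κ) (K : Op ι) (N : Matrix (κ → Fin 2) γ ℂ) (a : κ → Fin 2) (c : γ) :
    (embed q K * N) a c = ∑ x, K (a ∘ q) x * N (Function.extend q x a) c := by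
  rw [Matrix.mul_apply]
  symm
  refine Fintype.sum_of_injective (fun x : ι → Fin 2 => Function.extend q x a) ?_ _ _ ?_ ?_
  · intro x y h
    simpa only [extend_comp_self] using congrArg (fun f => f ∘ q) h
  · intro d hd
    have : ¬ ∀ k, k ∉ Set.range q → a k = d k := by
      intro h
      refine hd ⟨d ∘ q, ?_⟩
      funext k
      by_cases hk : ∃ i, q i = k
      · obtain ⟨i, rfl⟩ := hk
        exact q.injective.extend_apply _ _ _
      · have h2 := Function.extend_apply' (f := q) (d ∘ q) a k hk
        exact h2.trans (h k hk)
    simp only [embed, Matrix.of_apply, if_neg this, zero_mul]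
  · intro x
    have : ∀ k, k ∉ Set.range q → a k = Function.extend q x a k := by
      intro k hk
      exact (Function.extend_apply' (f := q) x a k hk).symm
    simp only [embed, Matrix.of_apply, if_pos this, extend_comp_self]

theorem embed_conjTranspose {ι κ : Type} (q : ι ↪ κ) (K : Op ι) :
    (embed q K).conjTranspose = embed q K.conjTranspose := by
  ext a b
  have h : (∀ k, k ∉ Set.range q → b k = a k) ↔ ∀ k, k ∉ Set.range q → a k = b k :=
    forall_congr' fun k => imp_congr_right fun _ => eq_comm
  simp only [Matrix.conjTranspose_apply, embed, Matrix.of_apply]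
  by_cases h' : ∀ k, k ∉ Set.range q → a k = b k
  · rw [if_pos h', if_pos (h.2 h')]
  · rw [if_neg h', if_neg (fun h2 => h' (h.1 h2)), star_zero]

theorem embed_mul {ι κ : Type} [Fintype ι] [Fintype κ] [DecidableEq ι] [DecidableEq κ]
    (q : ι ↪ κ) (K L : Op ι) : embed q K * embed q L = embed q (K * L) := by
  ext a b
  rw [embed_mul_apply]
  have h : ∀ x : ι → Fin 2, (∀ k, k ∉ Set.range q → Function.extend q x a k = b k) ↔
      ∀ k, k ∉ Set.range q → a k = b k := fun x => forall_congr' fun k => by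
    refine imp_congr_right fun hk => ?_
    rw [Function.extend_apply' (f := q) x a k hk]
  simp only [embed, Matrix.of_apply, h, extend_comp_self, Matrix.mul_apply]
  split_ifs <;> simp

theorem embed_one {ι κ : Type} [Fintype ι] [Fintype κ] [DecidableEq ι] [DecidableEq κ]
    (q : ι ↪ κ) : embed q (1 : Op ι) = 1 := by
  ext a b
  by_cases hab : a = b
  · subst hab
    simp [embed]
  · rw [Matrix.one_apply_ne hab]
    simp only [embed, Matrix.of_apply]
    split_ifs with h
    · refine Matrix.one_apply_ne fun h2 => hab ?_
      funext k
      by_cases hk : ∃ i, q i = k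
      · obtain ⟨i, rfl⟩ := hk
        exact congrFun h2 i
      · exact h k hk
    · rfl

theorem embed_sum {ι κ : Type} {r : ℕ} (q : ι ↪ κ) (K : Fin r → Op ι) :
    embed q (∑ i, K i) = ∑ i, embed q (K i) := by
  ext a b
  simp only [embed, Matrix.of_apply, Matrix.sum_apply]
  split_ifs <;> simp

/-- Extending a superoperator by the identity amounts to extending the operators of any
Kraus decomposition of it. -/
theorem applyAt_krausMap {ι κ : Type} [Fintype ι] [Fintype κ] [DecidableEq ι] [DecidableEq κ]
    (q : ι ↪ κ) {r : ℕ} (K : Fin r → Op ι) (ρ : Op κ) :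
    applyAt q (krausMap K) ρ = krausMap (fun i => embed q (K i)) ρ := by
  ext a b
  simp only [applyAt, krausMap, Matrix.of_apply, Matrix.sum_apply]
  refine Finset.sum_congr rfl fun i _ => ?_
  rw [Matrix.mul_assoc (embed q (K i)), embed_mul_apply, Matrix.mul_assoc, Matrix.mul_apply]
  refine Finset.sum_congr rfl fun x _ => ?_
  congr 1
  have h2 : ∀ c : κ → Fin 2, (ρ * (embed q (K i)).conjTranspose) c b =
      star ((embed q (K i) * ρ.conjTranspose) b c) := by
    intro c
    rw [← Matrix.conjTranspose_apply, Matrix.conjTranspose_mul, Matrix.conjTranspose_conjTranspose]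
  rw [h2, embed_mul_apply, Matrix.mul_apply, star_sum]
  refine Finset.sum_congr rfl fun y _ => ?_
  simp [mul_comm]

theorem krausMap_posSemidef {ι : Type} [Fintype ι] [DecidableEq ι] {r : ℕ} (K : Fin r → Op ι) {ρ : Op ι}
    (h : ρ.PosSemidef) : (krausMap K ρ).PosSemidef :=
  Matrix.posSemidef_sum _ fun i _ => h.mul_mul_conjTranspose_same (K i)

theorem krausMap_trace {ι : Type} [Fintype ι] [DecidableEq ι] {r : ℕ} (K : Fin r → Op ι)
    (ρ : Op ι) :
    (krausMap K ρ).trace = ((∑ i, (K i).conjTranspose * K i) * ρ).trace := by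
  simp only [krausMap, Matrix.trace_sum, Finset.sum_mul]
  refine Finset.sum_congr rfl fun i _ => ?_
  rw [Matrix.trace_mul_cycle]

theorem embed_complete {ι κ : Type} [Fintype ι] [Fintype κ] [DecidableEq ι] [DecidableEq κ]
    (q : ι ↪ κ) {r : ℕ} (K : Fin r → Op ι) (h : ∑ i, (K i).conjTranspose * K i = 1) :
    ∑ i, (embed q (K i)).conjTranspose * embed q (K i) = 1 := by
  simp only [embed_conjTranspose, embed_mul]
  rw [← embed_sum, h, embed_one]

/-- The action of a trace-preserving superoperator on the qubits listed by `q`. -/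
def TPSuperop.act {n : ℕ} {κ : Type} [Fintype κ] [DecidableEq κ] (E : TPSuperop n)
    (q : Fin n ↪ κ) (ρ : Density κ) : Density κ :=
  ⟨applyAt q E.1 ρ.1, by
    obtain ⟨E, r, K, hK, rfl⟩ := E
    rw [applyAt_krausMap]
    refine ⟨krausMap_posSemidef _ ρ.2.1, ?_⟩
    rw [krausMap_trace, embed_complete q K hK, one_mul, ρ.2.2]⟩

/-- The unnormalised state after outcome `m` of a measurement of the qubits listed by `q`. -/
def Measurement.branch {n k : ℕ} {κ : Type} [Fintype κ] [DecidableEq κ] (M : Measurement n k)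
    (q : Fin n ↪ κ) (ρ : Density κ) (m : Fin k) : Op κ :=
  embed q (M.op m) * ρ.1 * (embed q (M.op m)).conjTranspose

/-- The distribution of the outcomes of a measurement of the qubits listed by `q`. -/
def Measurement.outcome {n k : ℕ} {κ : Type} [Fintype κ] [DecidableEq κ] (M : Measurement n k)
    (q : Fin n ↪ κ) (ρ : Density κ) : FDist (Fin k) where
  weights := Finsupp.equivFunOnFinite.symm fun m => (M.branch q ρ m).trace.re
  nonneg := fun m =>
    (Complex.le_def.1 (ρ.2.1.mul_mul_conjTranspose_same (embed q (M.op m))).trace_nonneg).1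
  total := by
    rw [Finsupp.sum_fintype _ _ fun _ => rfl]
    simp only [Finsupp.equivFunOnFinite_symm_apply_apply]
    rw [← Complex.re_sum, ← Matrix.trace_sum]
    have h := krausMap_trace (fun m => embed q (M.op m)) ρ.1
    rw [embed_complete q M.op M.complete, one_mul, ρ.2.2] at h
    change (krausMap (fun m => embed q (M.op m)) ρ.1).trace.re = 1
    rw [h, Complex.one_re]

open Classical in
/-- The density operator `σ / tr σ`, for positive semidefinite `σ` with nonzero trace; the
fallback `ρ` is only used for branches that have probability zero. -/
def normalize {κ : Type} [Fintype κ] [DecidableEq κ] (ρ : Density κ) (σ : Op κ) : Density κ :=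
  if h : σ.PosSemidef ∧ σ.trace ≠ 0 then
    ⟨σ.trace⁻¹ • σ, h.1.smul (inv_nonneg.2 h.1.trace_nonneg), by
      rw [Matrix.trace_smul, smul_eq_mul, inv_mul_cancel₀ h.2]⟩
  else ρ

/-! ### Syntax -/

/-- The names of the qubits. -/
abbrev Qubit : Type := ℕ

/-- The tags of the actions. -/
abbrev Tag : Type := ℕ

/-- The types of variables and of the values carried by channels. -/
inductive Ty
  | nat
  | bool
  | qubit
  deriving DecidableEq

/-- Typed variables, denumerably many of each type. -/
structure Var where
  ty : Ty
  idx : ℕ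
  deriving DecidableEq

/-- Channels, denumerably many for each type of carried values. -/
structure Chan where
  ty : Ty
  idx : ℕ
  deriving DecidableEq

/-- Values. -/
inductive Val
  | nat (n : ℕ)
  | bool (b : Bool)
  | qubit (q : Qubit)
  deriving DecidableEq

/-- The type of a value. -/
def Val.ty : Val → Ty
  | .nat _ => .nat
  | .bool _ => .bool
  | .qubit _ => .qubit

/-- Expressions. -/
inductive Expr
  | var (x : Var)
  | val (v : Val)
  | not (e : Expr)
  | or (e f : Expr)
  | le (e f : Expr)
  | eq (e f : Expr)

/-- Typing of expressions. -/
inductive Expr.HasTy : Expr → Ty → Prop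
  | var (x : Var) : HasTy (.var x) x.ty
  | val (v : Val) : HasTy (.val v) v.ty
  | not {e : Expr} : HasTy e .bool → HasTy (.not e) .bool
  | or {e f : Expr} : HasTy e .bool → HasTy f .bool → HasTy (.or e f) .bool
  | le {e f : Expr} : HasTy e .nat → HasTy f .nat → HasTy (.le e f) .bool
  | eq {e f : Expr} {T : Ty} : HasTy e T → HasTy f T → HasTy (.eq e f) .bool

/-- Big-step evaluation of expressions (free variables are not evaluated). -/
inductive Expr.Eval : Expr → Val → Prop
  | val (v : Val) : Eval (.val v) v
  | not {e : Expr} {b : Bool} : Eval e (.bool b) → Eval (.not e) (.bool (!b))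
  | or {e f : Expr} {b c : Bool} :
      Eval e (.bool b) → Eval f (.bool c) → Eval (.or e f) (.bool (b || c))
  | le {e f : Expr} {m n : ℕ} :
      Eval e (.nat m) → Eval f (.nat n) → Eval (.le e f) (.bool (decide (m ≤ n)))
  | eq {e f : Expr} {v w : Val} :
      Eval e v → Eval f w → Eval (.eq e f) (.bool (decide (v = w)))

/-- Free variables of an expression. -/
def Expr.fv : Expr → Finset Var
  | .var x => {x}
  | .val _ => ∅
  | .not e => e.fv
  | .or e f => e.fv ∪ f.fv
  | .le e f => e.fv ∪ f.fv
  | .eq e f => e.fv ∪ f.fv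

/-- Substitution of a value for a variable in an expression. -/
def Expr.subst (x : Var) (v : Val) : Expr → Expr
  | .var y => if y = x then .val v else .var y
  | .val w => .val w
  | .not e => .not (e.subst x v)
  | .or e f => .or (e.subst x v) (f.subst x v)
  | .le e f => .le (e.subst x v) (f.subst x v)
  | .eq e f => .eq (e.subst x v) (f.subst x v)

/-- Tagged processes. -/
inductive Proc
  /-- `t : τ . P` -/
  | tau (t : Tag) (P : Proc)
  /-- `(t, u) : τ . P` -/
  | tauPair (t u : Tag) (P : Proc)
  /-- `t : E(e) . P` -/
  | op {n : ℕ} (t : Tag) (E : TPSuperop n) (e : Fin n → Expr) (P : Proc)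
  /-- `t : M(e ▹ y) . P` -/
  | meas {n k : ℕ} (t : Tag) (M : Measurement n k) (e : Fin n → Expr) (y : Var) (P : Proc)
  /-- `t : c?x . P` -/
  | recv (t : Tag) (c : Chan) (x : Var) (P : Proc)
  /-- The process that discards the qubits listed by `es`. -/
  | nil (es : List Expr)
  /-- `t : c!e . P` -/
  | send (t : Tag) (c : Chan) (e : Expr) (P : Proc)
  | ite (e : Expr) (P Q : Proc)
  | sum (P Q : Proc)
  | par (P Q : Proc)
  | res (P : Proc) (c : Chan)

/-- Free variables of a process. -/
def Proc.fv : Proc → Finset Var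
  | .tau _ P => P.fv
  | .tauPair _ _ P => P.fv
  | .op _ _ e P => (Finset.univ.biUnion fun i => (e i).fv) ∪ P.fv
  | .meas _ _ e y P => (Finset.univ.biUnion fun i => (e i).fv) ∪ P.fv.erase y
  | .recv _ _ x P => P.fv.erase x
  | .nil es => es.foldr (fun e s => e.fv ∪ s) ∅
  | .send _ _ e P => e.fv ∪ P.fv
  | .ite e P Q => e.fv ∪ P.fv ∪ Q.fv
  | .sum P Q => P.fv ∪ Q.fv
  | .par P Q => P.fv ∪ Q.fv
  | .res P _ => P.fv

/-- Substitution of a value for the free occurrences of a variable in a process. -/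
def Proc.subst (x : Var) (v : Val) : Proc → Proc
  | .tau t P => .tau t (P.subst x v)
  | .tauPair t u P => .tauPair t u (P.subst x v)
  | .op t E e P => .op t E (fun i => (e i).subst x v) (P.subst x v)
  | .meas t M e y P =>
      .meas t M (fun i => (e i).subst x v) y (if y = x then P else P.subst x v)
  | .recv t c y P => .recv t c y (if y = x then P else P.subst x v)
  | .nil es => .nil (es.map (Expr.subst x v))
  | .send t c e P => .send t c (e.subst x v) (P.subst x v)
  | .ite e P Q => .ite (e.subst x v) (P.subst x v) (Q.subst x v)
  | .sum P Q => .sum (P.subst x v) (Q.subst x v)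
  | .par P Q => .par (P.subst x v) (Q.subst x v)
  | .res P c => .res (P.subst x v) c

/-! ### Linear type system -/

/-- The elements of typing contexts: qubit names and variables of qubit type. -/
inductive Name
  | qubit (q : Qubit)
  | var (i : ℕ)
  deriving DecidableEq

/-- The qubit variable with index `i`. -/
def qvar (i : ℕ) : Var := ⟨.qubit, i⟩

/-- A name, seen as an expression. -/
def Name.toExpr : Name → Expr
  | .qubit q => .val (.qubit q)
  | .var i => .var (qvar i)

/-- `Typed Γ P`: the process `P` is well-typed using exactly the qubits in `Γ`. -/
inductive Typed : Finset Name → Proc → Prop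
  | nil {Γ : Finset Name} (l : List Name) :
      l.Nodup → l.toFinset = Γ → Typed Γ (.nil (l.map Name.toExpr))
  | tau {Γ : Finset Name} {t : Tag} {P : Proc} : Typed Γ P → Typed Γ (.tau t P)
  | tauPair {Γ : Finset Name} {t u : Tag} {P : Proc} : Typed Γ P → Typed Γ (.tauPair t u P)
  | res {Γ : Finset Name} {P : Proc} {c : Chan} : Typed Γ P → Typed Γ (.res P c)
  | sum {Γ : Finset Name} {P Q : Proc} : Typed Γ P → Typed Γ Q → Typed Γ (.sum P Q)
  | op {Γ : Finset Name} {n : ℕ} {t : Tag} {E : TPSuperop n} {P : Proc} (l : Fin n → Name) :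
      0 < n → Function.Injective l → (∀ i, l i ∈ Γ) → Typed Γ P →
      Typed Γ (.op t E (fun i => (l i).toExpr) P)
  | meas {Γ : Finset Name} {n k : ℕ} {t : Tag} {M : Measurement n k} {y : Var} {P : Proc}
      (l : Fin n → Name) :
      Function.Injective l → (∀ i, l i ∈ Γ) → y.ty = .nat → Typed Γ P →
      Typed Γ (.meas t M (fun i => (l i).toExpr) y P)
  | crecv {Γ : Finset Name} {t : Tag} {c : Chan} {x : Var} {P : Proc} :
      c.ty ≠ .qubit → x.ty = c.ty → Typed Γ P → Typed Γ (.recv t c x P)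
  | qrecv {Γ : Finset Name} {t : Tag} {c : Chan} {i : ℕ} {P : Proc} :
      c.ty = .qubit → Name.var i ∉ Γ → Typed (insert (Name.var i) Γ) P →
      Typed Γ (.recv t c (qvar i) P)
  | qsend {Γ : Finset Name} {t : Tag} {c : Chan} {a : Name} {P : Proc} :
      c.ty = .qubit → a ∈ Γ → Typed (Γ.erase a) P → Typed Γ (.send t c a.toExpr P)
  | csend {Γ : Finset Name} {t : Tag} {c : Chan} {e : Expr} {P : Proc} :
      c.ty ≠ .qubit → e.HasTy c.ty → Typed Γ P → Typed Γ (.send t c e P)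
  | ite {Γ : Finset Name} {e : Expr} {P Q : Proc} :
      e.HasTy .bool → Typed Γ P → Typed Γ Q → Typed Γ (.ite e P Q)
  | par {Γ Γ' : Finset Name} {P Q : Proc} :
      Disjoint Γ Γ' → Typed Γ P → Typed Γ' Q → Typed (Γ ∪ Γ') (.par P Q)

/-- `Owns S P`: `P` is a closed process, well-typed using exactly the qubits in `S`. -/
def Owns (S : Finset Qubit) (P : Proc) : Prop :=
  P.fv = ∅ ∧ Typed (S.image Name.qubit) P

/-! ### Operational semantics -/

/-- Actions. -/
inductive Act
  | tau
  | out (c : Chan) (v : Val)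
  | inp (c : Chan) (v : Val)

/-- The action does not involve the channel `c`. -/
def Act.Avoids (c : Chan) : Act → Prop
  | .tau => True
  | .out d _ => d ≠ c
  | .inp d _ => d ≠ c

/-- The action is not the reception of a qubit used by `P`. -/
def Act.Fresh (P : Proc) : Act → Prop
  | .inp _ (.qubit q) => ∀ Γ, Typed Γ P → Name.qubit q ∉ Γ
  | _ => True

/-- Syntactic schedulers. -/
inductive Sched
  /-- stop -/
  | halt
  /-- select an action -/
  | tag (t : Tag)
  /-- select a synchronization -/
  | pair (t u : Tag)

/-- Configurations whose quantum state is over the qubits in `S`. -/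
structure Conf (S : Finset Qubit) where
  state : Density S
  proc : Proc

/-- The labelled transitions of configurations.  A reception must yield a well-typed process:
the value has the type of the channel, and a received qubit belongs to the quantum state and
is not already in use. -/
inductive Step {S : Finset Qubit} :
    Density S → Proc → Act → Sched → FDist (Conf S) → Prop
  | iteT {ρ : Density S} {e : Expr} {P Q : Proc} {μ : Act} {s : Sched} {D : FDist (Conf S)} :
      Step ρ P μ s D → e.Eval (.bool true) → Step ρ (.ite e P Q) μ s D
  | iteF {ρ : Density S} {e : Expr} {P Q : Proc} {μ : Act} {s : Sched} {D : FDist (Conf S)} :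
      Step ρ Q μ s D → e.Eval (.bool false) → Step ρ (.ite e P Q) μ s D
  | tau {ρ : Density S} {t : Tag} {P : Proc} :
      Step ρ (.tau t P) .tau (.tag t) (point ⟨ρ, P⟩)
  | tauPair {ρ : Density S} {t u : Tag} {P : Proc} :
      Step ρ (.tauPair t u P) .tau (.pair t u) (point ⟨ρ, P⟩)
  | send {ρ : Density S} {t : Tag} {c : Chan} {e : Expr} {v : Val} {P : Proc} :
      e.Eval v → Step ρ (.send t c e P) (.out c v) (.tag t) (point ⟨ρ, P⟩)
  | recv {ρ : Density S} {t : Tag} {c : Chan} {x : Var} {v : Val} {P : Proc} :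
      v.ty = c.ty → (∀ q, v = .qubit q → q ∈ S) →
      (Act.inp c v).Fresh (.recv t c x P) →
      Step ρ (.recv t c x P) (.inp c v) (.tag t) (point ⟨ρ, P.subst x v⟩)
  | res {ρ : Density S} {c : Chan} {P : Proc} {μ : Act} {s : Sched} {D : FDist (Conf S)} :
      Step ρ P μ s D → μ.Avoids c →
      Step ρ (.res P c) μ s (D.map fun C => ⟨C.state, .res C.proc c⟩)
  | op {ρ : Density S} {t : Tag} {n : ℕ} {E : TPSuperop n} (q : Fin n ↪ S) {P : Proc} :
      Step ρ (.op t E (fun i => .val (.qubit (q i))) P) .tau (.tag t) (point ⟨E.act q ρ, P⟩)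
  | meas {ρ : Density S} {t : Tag} {n k : ℕ} {M : Measurement n k} (q : Fin n ↪ S) {y : Var}
      {P : Proc} :
      Step ρ (.meas t M (fun i => .val (.qubit (q i))) y P) .tau (.tag t)
        ((M.outcome q ρ).map fun m =>
          ⟨normalize ρ (M.branch q ρ m), P.subst y (.nat m)⟩)
  | parL {ρ : Density S} {P Q : Proc} {μ : Act} {s : Sched} {D : FDist (Conf S)} :
      Step ρ P μ s D → μ.Fresh Q →
      Step ρ (.par P Q) μ s (D.map fun C => ⟨C.state, .par C.proc Q⟩)
  | parR {ρ : Density S} {P Q : Proc} {μ : Act} {s : Sched} {D : FDist (Conf S)} :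
      Step ρ Q μ s D → μ.Fresh P →
      Step ρ (.par P Q) μ s (D.map fun C => ⟨C.state, .par P C.proc⟩)
  | sumL {ρ : Density S} {P Q : Proc} {μ : Act} {s : Sched} {D : FDist (Conf S)} :
      Step ρ P μ s D → Step ρ (.sum P Q) μ s D
  | sumR {ρ : Density S} {P Q : Proc} {μ : Act} {s : Sched} {D : FDist (Conf S)} :
      Step ρ Q μ s D → Step ρ (.sum P Q) μ s D
  | synchL {ρ : Density S} {P Q P' Q' : Proc} {c : Chan} {v : Val} {t u : Tag} :
      Step ρ P (.out c v) (.tag t) (point ⟨ρ, P'⟩) →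
      Step ρ Q (.inp c v) (.tag u) (point ⟨ρ, Q'⟩) →
      Step ρ (.par P Q) .tau (.pair t u) (point ⟨ρ, .par P' Q'⟩)
  | synchR {ρ : Density S} {P Q P' Q' : Proc} {c : Chan} {v : Val} {t u : Tag} :
      Step ρ Q (.out c v) (.tag t) (point ⟨ρ, Q'⟩) →
      Step ρ P (.inp c v) (.tag u) (point ⟨ρ, P'⟩) →
      Step ρ (.par P Q) .tau (.pair t u) (point ⟨ρ, .par P' Q'⟩)

/-- Distributions of configurations; `none` is the deadlock configuration `⊥`. -/
abbrev CDist (S : Finset Qubit) : Type := FDist (Option (Conf S))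

/-- The transitions completed with moves to `⊥` for the unavailable ones. -/
inductive BotStep {S : Finset Qubit} : Option (Conf S) → Act → Sched → CDist S → Prop
  | step {C : Conf S} {μ : Act} {s : Sched} {D : FDist (Conf S)} :
      Step C.state C.proc μ s D → BotStep (some C) μ s (D.map some)
  | stuck {C : Conf S} {μ : Act} {s : Sched} :
      (¬ ∃ D, Step C.state C.proc μ s D) → BotStep (some C) μ s (point none)
  | bot {μ : Act} {s : Sched} : BotStep none μ s (point none)

/-- The transition relation on distributions of configurations, labelled by an action and a
randomized scheduler. -/
def Trans {S : Finset Qubit} (D : CDist S) (μ : Act) (δ : FDist Sched) (E : CDist S) : Prop :=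
  Lift (fun C => Lift (fun s => BotStep C μ s) δ) D E

/-- All the configurations in the support of `D` use exactly the qubits in `U`. -/
def HasType {S : Finset Qubit} (U : Finset Qubit) (D : CDist S) : Prop :=
  ∀ C : Conf S, D.weights (some C) ≠ 0 → U ⊆ S ∧ Owns U C.proc

/-- The probability of not being deadlocked in `⊥`. -/
def mass {S : Finset Qubit} (D : CDist S) : ℝ := 1 - D.weights none

/-! ### Deterministic tagging -/

/-- The scheduler resolves the immediate choices of `P`, in every quantum state: a transition
is determined by its action and its scheduler, and a tag selects at most one output. -/
def LocallyDeterministic (S : Finset Qubit) (P : Proc) : Prop :=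
  ∀ ρ : Density S,
    (∀ μ s D D', Step ρ P μ s D → Step ρ P μ s D' → D = D') ∧
    (∀ s c v c' v' D D', Step ρ P (.out c v) s D → Step ρ P (.out c' v') s D' →
      c = c' ∧ v = v')

/-- `P'` occurs after some transition of `P`. -/
def Successor (S : Finset Qubit) (P P' : Proc) : Prop :=
  ∃ (ρ ρ' : Density S) (μ : Act) (s : Sched) (D : FDist (Conf S)),
    Step ρ P μ s D ∧ D.weights ⟨ρ', P'⟩ ≠ 0

/-- `P` and all the processes reachable from it are resolved by the scheduler. -/
def DeterministicallyTagged (S : Finset Qubit) (P : Proc) : Prop :=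
  ∀ P', Relation.ReflTransGen (Successor S) P P' → LocallyDeterministic S P'

/-- The processes of all the configurations in the support are deterministically tagged. -/
def Deterministic {S : Finset Qubit} (D : CDist S) : Prop :=
  ∀ C : Conf S, D.weights (some C) ≠ 0 → DeterministicallyTagged S C.proc

/-! ### Saturated bisimilarity -/

/-- `[·] ∥ Q` is a context for processes using exactly the qubits in `U`, in the presence of
the qubits in `S`. -/
def IsContext (S U : Finset Qubit) (Q : Proc) : Prop :=
  ∃ V : Finset Qubit, U ⊆ V ∧ V ⊆ S ∧ Owns (V \ U) Q

/-- The context `[·] ∥ Q` applied to a distribution. -/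
def plug {S : Finset Qubit} (Q : Proc) (D : CDist S) : CDist S :=
  D.map (Option.map fun C => ⟨C.state, .par C.proc Q⟩)

/-- Saturated bisimulations.  Only deterministically tagged distributions are considered, hence
the contexts range over those that keep both distributions deterministically tagged. -/
def IsSaturatedBisimulation {S : Finset Qubit} (R : CDist S → CDist S → Prop) : Prop :=
  ∀ D E, R D E → ∃ U, HasType U D ∧ HasType U E ∧ mass D = mass E ∧
    ∀ Q, IsContext S U Q → Deterministic (plug Q D) → Deterministic (plug Q E) →
      ∀ δ,
        (∀ D', Trans (plug Q D) .tau δ D' → ∃ E', Trans (plug Q E) .tau δ E' ∧ R D' E') ∧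
        (∀ E', Trans (plug Q E) .tau δ E' → ∃ D', Trans (plug Q D) .tau δ D' ∧ R D' E')

/-- Saturated bisimilarity, the largest saturated bisimulation. -/
def SaturatedBisimilar {S : Finset Qubit} (D E : CDist S) : Prop :=
  ∃ R, IsSaturatedBisimulation R ∧ R D E

/-! ### Labelled bisimilarity -/

/-- The (subnormalised) quantum state of a distribution. -/
def quantumState {S : Finset Qubit} (D : CDist S) : Op S :=
  D.weights.sum fun C p => C.elim 0 fun C => (p : ℂ) • C.state.1

/-- The bit string over `S` with bits `a` outside `U` and `c` on `U`. -/
def joinBits {S U : Finset Qubit} (a : ↥(S \ U) → Fin 2) (c : U → Fin 2) (i : S) : Fin 2 :=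
  if h : (i : Qubit) ∈ U then c ⟨i, h⟩ else a ⟨i, Finset.mem_sdiff.2 ⟨i.2, h⟩⟩

/-- The partial trace over the qubits in `U`. -/
def partialTrace {S : Finset Qubit} (U : Finset Qubit) (ρ : Op S) : Op ↥(S \ U) :=
  Matrix.of fun a b => ∑ c : U → Fin 2, ρ (joinBits a c) (joinBits b c)

/-- The inclusion of the qubits of the environment. -/
def envIncl (S U : Finset Qubit) : ↥(S \ U) ↪ S :=
  ⟨fun i => ⟨i.1, (Finset.mem_sdiff.1 i.2).1⟩, fun i j h => by
    have h' : i.1 = j.1 := congrArg (fun k : S => k.1) h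
    exact Subtype.ext h'⟩

/-- The result, not normalised, of applying a superoperator to the environment in `C`. -/
def envResult {S : Finset Qubit} (U : Finset Qubit) (E : Op ↥(S \ U) → Op ↥(S \ U))
    (C : Conf S) : Op S :=
  applyAt (envIncl S U) E C.state.1

/-- The total probability of the superoperator `E`, applied to the environment in `D`. -/
def superopProb {S : Finset Qubit} (U : Finset Qubit) (E : Op ↥(S \ U) → Op ↥(S \ U))
    (D : CDist S) : ℝ :=
  D.weights.sum fun C p => C.elim 0 fun C => p * (envResult U E C).trace.re

/-- The weight, in the distribution conditioned on `E`, of an element of the support of `D`. -/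
def superopWeight {S : Finset Qubit} (U : Finset Qubit) (E : Op ↥(S \ U) → Op ↥(S \ U))
    (D : CDist S) (C : Option (Conf S)) : ℝ :=
  C.elim (D.weights none) fun C =>
    mass D * (D.weights (some C) * (envResult U E C).trace.re / superopProb U E D)

/-- Application of a superoperator to the environment of a configuration, with
normalisation. -/
def superopConf {S : Finset Qubit} (U : Finset Qubit) (E : Op ↥(S \ U) → Op ↥(S \ U)) :
    Option (Conf S) → Option (Conf S) :=
  Option.map fun C => ⟨normalize C.state (envResult U E C), C.proc⟩

theorem envResult_posSemidef {S U : Finset Qubit} {E : Op ↥(S \ U) → Op ↥(S \ U)}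
    (hE : IsSuperop E) (C : Conf S) : (envResult U E C).PosSemidef := by
  obtain ⟨r, K, -, rfl⟩ := hE
  rw [envResult, applyAt_krausMap]
  exact krausMap_posSemidef _ C.state.2.1

theorem mass_nonneg {S : Finset Qubit} (D : CDist S) : 0 ≤ mass D := by
  have h := D.total
  by_cases hn : none ∈ D.weights.support
  · have := Finset.single_le_sum (f := fun C => D.weights C) (fun C _ => D.nonneg C) hn
    rw [Finsupp.sum] at h
    rw [mass]
    linarith
  · rw [mass, Finsupp.notMem_support_iff.1 hn]
    norm_num

theorem superopWeight_nonneg {S U : Finset Qubit} {E : Op ↥(S \ U) → Op ↥(S \ U)}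
    (hE : IsSuperop E) (D : CDist S) (C : Option (Conf S)) : 0 ≤ superopWeight U E D C := by
  have htr : ∀ C : Conf S, 0 ≤ (envResult U E C).trace.re := fun C =>
    (Complex.le_def.1 (envResult_posSemidef hE C).trace_nonneg).1
  cases C with
  | none => exact D.nonneg none
  | some C =>
    refine mul_nonneg (mass_nonneg D) (div_nonneg (mul_nonneg (D.nonneg _) (htr C)) ?_)
    refine Finset.sum_nonneg fun C _ => ?_
    cases C with
    | none => exact le_rfl
    | some C => exact mul_nonneg (D.nonneg _) (htr C)

theorem superopWeight_sum {S U : Finset Qubit} {E : Op ↥(S \ U) → Op ↥(S \ U)} (D : CDist S)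
    (h : superopProb U E D ≠ 0) :
    (D.weights.sum fun C _ => superopWeight U E D C) = 1 := by
  have h1 : ∀ C, superopWeight U E D C = (if C = none then D.weights C else 0) +
      mass D / superopProb U E D *
        C.elim 0 fun C' => D.weights C * (envResult U E C').trace.re := by
    intro C
    cases C with
    | none => simp [superopWeight]
    | some C => simp [superopWeight]; ring
  simp only [Finsupp.sum, h1, Finset.sum_add_distrib, ← Finset.mul_sum]
  have h2 : (∑ C ∈ D.weights.support, C.elim 0 fun C' => D.weights C *
      (envResult U E C').trace.re) = superopProb U E D := rfl
  have h3 : (∑ C ∈ D.weights.support, if C = none then D.weights C else 0) = D.weights none := by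
    classical
    have h4 := Finset.sum_ite_eq' D.weights.support none fun C => D.weights C
    by_cases hn : none ∈ D.weights.support
    · rw [if_pos hn] at h4
      convert h4
    · rw [if_neg hn] at h4
      rw [Finsupp.notMem_support_iff.1 hn]
      convert h4
  rw [h2, div_mul_cancel₀ _ h, h3, mass]
  ring

/-- Normalised application of a superoperator to the environment of a distribution, defined
when the superoperator has nonzero total probability.  The mass is preserved. -/
def superopApply {S : Finset Qubit} (U : Finset Qubit) (E : Op ↥(S \ U) → Op ↥(S \ U))
    (hE : IsSuperop E) (D : CDist S) (h : superopProb U E D ≠ 0) : CDist S where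
  weights := D.weights.sum fun C _ =>
    Finsupp.single (superopConf U E C) (superopWeight U E D C)
  nonneg := Finset.sum_nonneg fun C _ =>
    Finsupp.single_nonneg.2 (superopWeight_nonneg hE D C)
  total := by
    rw [Finsupp.sum_sum_index (fun _ => rfl) (fun _ _ _ => rfl)]
    simp only [Finsupp.sum_single_index]
    exact superopWeight_sum D h

/-- Labelled bisimulations. -/
def IsLabelledBisimulation {S : Finset Qubit} (R : CDist S → CDist S → Prop) : Prop :=
  ∀ D E, R D E → ∃ U, HasType U D ∧ HasType U E ∧
    partialTrace U (quantumState D) = partialTrace U (quantumState E) ∧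
    (∀ (F : Op ↥(S \ U) → Op ↥(S \ U)) (hF : IsSuperop F)
      (hD : superopProb U F D ≠ 0) (hE : superopProb U F E ≠ 0),
      R (superopApply U F hF D hD) (superopApply U F hF E hE)) ∧
    ∀ μ δ,
      (∀ D', Trans D μ δ D' → ∃ E', Trans E μ δ E' ∧ R D' E') ∧
      (∀ E', Trans E μ δ E' → ∃ D', Trans D μ δ D' ∧ R D' E')

/-- Labelled bisimilarity, the largest labelled bisimulation. -/
def LabelledBisimilar {S : Finset Qubit} (D E : CDist S) : Prop :=
  ∃ R, IsLabelledBisimulation R ∧ R D E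

end LqCCS

end

open scoped ComplexOrder

namespace LqCCS

/-! ### Expressions, free variables and substitution -/

/-! Both bisimilarities coincide, on deterministically tagged distributions, with a third relation
defined by linear observations, `TestEquiv`.

A distribution is encoded by its vector `vec D`: the family of subnormalised operators, indexed by
processes, obtained by summing probability times state; `⊥` contributes zero. The availability of a
transition does not depend on the quantum state, and its result depends linearly on it through local
Kraus operators (`Step.uniform`). Deterministic tagging leaves one result for each action and
scheduler, so a labelled transition acts on vectors as a linear map `transMap μ s`, with zero
standing for deadlock, and a randomised scheduler acts as the average of these maps
(`Trans.vec_eq`). Since moves to `⊥` make every transition available, there is always some answer in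
the bisimulation game, and only its linear invariants matter.

A test is the mass after a sequence of labelled transitions and of contractions applied to the
environment. Two distributions are test equivalent when they have a common type and no test detects
the difference of their vectors; such a difference is called null. Null vectors are stable under
transitions and environment contractions by construction. Equality of partial traces follows because
effects separate Hermitian operators, and superoperators are sums of contractions by Kraus
operators. Hence test equivalence is a labelled bisimulation.

It is also a saturated bisimulation because null vectors remain null under parallel composition
(`IsTest.congruent`). A transition of `P ∥ Q` is a move of `P`, a move of `Q`, or a synchronization
in one of two directions. Deterministic tagging makes these cases exclusive, and each one amounts to
operations allowed in tests, followed by composition with a residual of `Q`.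

Conversely, labelled bisimilar distributions pass the same tests, by induction on the test
(`IsLabelledBisimulation.test_eq`). For saturated bisimilarity, every test is realised by a context
with fresh tags and a word of schedulers, as the mass left after the corresponding internal
transitions (`IsTest.realizable`). An output is observed by receiving and comparing with the
expected value, an input by sending, and a contraction `L` by a measurement with operators `L` and
`N`, where `N†N = 1 - L†L`, followed by a check of the outcome. Runs in which a check fails lose
their mass. -/

theorem Expr.Eval.unique {e : Expr} {v w : Val} (h : e.Eval v) (h' : e.Eval w) : v = w := by
  induction h generalizing w with
  | val v => cases h'; rfl
  | not _ ih =>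
    cases h' with
    | not h => cases ih h; rfl
  | or _ _ ih1 ih2 =>
    cases h' with
    | or h1 h2 => cases ih1 h1; cases ih2 h2; rfl
  | le _ _ ih1 ih2 =>
    cases h' with
    | le h1 h2 => cases ih1 h1; cases ih2 h2; rfl
  | eq _ _ ih1 ih2 =>
    cases h' with
    | eq h1 h2 => cases ih1 h1; cases ih2 h2; rfl

theorem Expr.HasTy.eval_ty {e : Expr} {T : Ty} {v : Val} (h : e.HasTy T) (h' : e.Eval v) :
    v.ty = T := by
  cases h' <;> cases h <;> rfl

theorem Name.toExpr_injective : Function.Injective Name.toExpr := by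
  intro a b h
  cases a <;> cases b <;> simp_all [Name.toExpr, qvar]

theorem Name.toExpr_eq_qubit {a : Name} {q : Qubit} (h : a.toExpr = .val (.qubit q)) :
    a = .qubit q :=
  Name.toExpr_injective h

theorem Expr.fv_subst (x : Var) (v : Val) (e : Expr) : (e.subst x v).fv = e.fv.erase x := by
  induction e with
  | var y =>
    by_cases h : y = x
    · subst h; simp [Expr.subst, Expr.fv]
    · simp [Expr.subst, Expr.fv, h, Finset.erase_eq_of_notMem, Ne.symm h]
  | val => simp [Expr.subst, Expr.fv]
  | not e ih => simpa [Expr.subst, Expr.fv] using ih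
  | or e f ih1 ih2 => simp [Expr.subst, Expr.fv, ih1, ih2, Finset.erase_union_distrib]
  | le e f ih1 ih2 => simp [Expr.subst, Expr.fv, ih1, ih2, Finset.erase_union_distrib]
  | eq e f ih1 ih2 => simp [Expr.subst, Expr.fv, ih1, ih2, Finset.erase_union_distrib]

theorem Expr.subst_of_notMem {x : Var} (v : Val) {e : Expr} (h : x ∉ e.fv) : e.subst x v = e := by
  induction e with
  | var y => simp [Expr.fv] at h; simp [Expr.subst, Ne.symm h]
  | val => rfl
  | not e ih => simp [Expr.subst, ih h]
  | or e f ih1 ih2 => simp [Expr.fv] at h; simp [Expr.subst, ih1 h.1, ih2 h.2]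
  | le e f ih1 ih2 => simp [Expr.fv] at h; simp [Expr.subst, ih1 h.1, ih2 h.2]
  | eq e f ih1 ih2 => simp [Expr.fv] at h; simp [Expr.subst, ih1 h.1, ih2 h.2]

theorem Expr.HasTy.subst {e : Expr} {T : Ty} {x : Var} {v : Val} (h : e.HasTy T)
    (hv : v.ty = x.ty) : (e.subst x v).HasTy T := by
  induction h with
  | var y =>
    by_cases h : y = x
    · subst h; simp only [Expr.subst, if_true]; rw [← hv]; exact .val v
    · simp only [Expr.subst, if_neg h]; exact .var y
  | val w => exact .val w
  | not _ ih => exact .not ih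
  | or _ _ ih1 ih2 => exact .or ih1 ih2
  | le _ _ ih1 ih2 => exact .le ih1 ih2
  | eq _ _ ih1 ih2 => exact .eq ih1 ih2

theorem mem_fv_nil {x : Var} {es : List Expr} :
    x ∈ (Proc.nil es).fv ↔ ∃ e ∈ es, x ∈ e.fv := by
  simp only [Proc.fv]
  induction es with
  | nil => simp
  | cons e es ih => simp [ih]

theorem Proc.fv_subst (x : Var) (v : Val) (P : Proc) : (P.subst x v).fv = P.fv.erase x := by
  induction P with
  | tau t P ih => simpa [Proc.subst, Proc.fv] using ih
  | tauPair t u P ih => simpa [Proc.subst, Proc.fv] using ih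
  | op t E e P ih =>
    simp only [Proc.subst, Proc.fv, ih, Expr.fv_subst, Finset.erase_union_distrib,
      Finset.erase_biUnion]
  | meas t M e y P ih =>
    simp only [Proc.subst, Proc.fv, Expr.fv_subst, Finset.erase_union_distrib,
      Finset.erase_biUnion]
    split_ifs with h
    · subst h; simp
    · rw [ih, Finset.erase_right_comm]
  | recv t c y P ih =>
    simp only [Proc.subst, Proc.fv]
    split_ifs with h
    · subst h; simp
    · rw [ih, Finset.erase_right_comm]
  | nil es =>
    ext y
    rw [Proc.subst, mem_fv_nil, Finset.mem_erase, mem_fv_nil]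
    simp only [List.mem_map, exists_exists_and_eq_and, Expr.fv_subst, Finset.mem_erase]
    grind
  | send t c e P ih => simp only [Proc.subst, Proc.fv, ih, Expr.fv_subst, Finset.erase_union_distrib]
  | ite e P Q ih1 ih2 =>
    simp only [Proc.subst, Proc.fv, ih1, ih2, Expr.fv_subst, Finset.erase_union_distrib]
  | sum P Q ih1 ih2 => simp only [Proc.subst, Proc.fv, ih1, ih2, Finset.erase_union_distrib]
  | par P Q ih1 ih2 => simp only [Proc.subst, Proc.fv, ih1, ih2, Finset.erase_union_distrib]
  | res P c ih => simpa [Proc.subst, Proc.fv] using ih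

theorem Proc.subst_of_notMem {x : Var} (v : Val) {P : Proc} (h : x ∉ P.fv) : P.subst x v = P := by
  induction P with
  | tau t P ih => rw [Proc.subst, ih h]
  | tauPair t u P ih => rw [Proc.subst, ih h]
  | op t E e P ih =>
    simp only [Proc.fv, Finset.mem_union, Finset.mem_biUnion, Finset.mem_univ, true_and,
      not_or, not_exists] at h
    simp only [Proc.subst, ih h.2, Expr.subst_of_notMem v (h.1 _)]
  | meas t M e y P ih =>
    simp only [Proc.fv, Finset.mem_union, Finset.mem_biUnion, Finset.mem_univ, true_and,
      not_or, not_exists, Finset.mem_erase, not_and] at h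
    simp only [Proc.subst, Expr.subst_of_notMem v (h.1 _)]
    split_ifs with hy
    · rfl
    · rw [ih (h.2 (Ne.symm hy))]
  | recv t c y P ih =>
    simp only [Proc.fv, Finset.mem_erase, not_and] at h
    simp only [Proc.subst]
    split_ifs with hy
    · rfl
    · rw [ih (h (Ne.symm hy))]
  | nil es =>
    rw [mem_fv_nil] at h
    push Not at h
    have := List.map_congr_left (f := Expr.subst x v) (g := id)
      fun e he => Expr.subst_of_notMem v (h e he)
    rw [Proc.subst, this, List.map_id]
  | send t c e P ih =>
    simp only [Proc.fv, Finset.mem_union, not_or] at h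
    rw [Proc.subst, ih h.2, Expr.subst_of_notMem v h.1]
  | ite e P Q ih1 ih2 =>
    simp only [Proc.fv, Finset.mem_union, not_or] at h
    rw [Proc.subst, ih1 h.1.2, ih2 h.2, Expr.subst_of_notMem v h.1.1]
  | sum P Q ih1 ih2 =>
    simp only [Proc.fv, Finset.mem_union, not_or] at h
    rw [Proc.subst, ih1 h.1, ih2 h.2]
  | par P Q ih1 ih2 =>
    simp only [Proc.fv, Finset.mem_union, not_or] at h
    rw [Proc.subst, ih1 h.1, ih2 h.2]
  | res P c ih => rw [Proc.subst, ih h]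

/-! ### Inversion of the typing rules -/

/-- The premises of the typing rule for a process. -/
def TypedPremise (Γ : Finset Name) : Proc → Prop
  | .tau _ P => Typed Γ P
  | .tauPair _ _ P => Typed Γ P
  | @Proc.op n _ _ e P => ∃ l : Fin n → Name, e = (fun i => (l i).toExpr) ∧ 0 < n ∧
      Function.Injective l ∧ (∀ i, l i ∈ Γ) ∧ Typed Γ P
  | @Proc.meas n _ _ _ e y P => ∃ l : Fin n → Name, e = (fun i => (l i).toExpr) ∧
      Function.Injective l ∧ (∀ i, l i ∈ Γ) ∧ y.ty = .nat ∧ Typed Γ P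
  | .recv _ c x P => (c.ty ≠ .qubit ∧ x.ty = c.ty ∧ Typed Γ P) ∨
      ∃ i, c.ty = .qubit ∧ x = qvar i ∧ Name.var i ∉ Γ ∧ Typed (insert (Name.var i) Γ) P
  | .nil es => ∃ l : List Name, es = l.map Name.toExpr ∧ l.Nodup ∧ l.toFinset = Γ
  | .send _ c e P => (c.ty ≠ .qubit ∧ e.HasTy c.ty ∧ Typed Γ P) ∨
      ∃ a : Name, c.ty = .qubit ∧ e = a.toExpr ∧ a ∈ Γ ∧ Typed (Γ.erase a) P
  | .ite e P Q => e.HasTy .bool ∧ Typed Γ P ∧ Typed Γ Q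
  | .sum P Q => Typed Γ P ∧ Typed Γ Q
  | .par P Q => ∃ Γ1 Γ2, Γ = Γ1 ∪ Γ2 ∧ Disjoint Γ1 Γ2 ∧ Typed Γ1 P ∧ Typed Γ2 Q
  | .res P _ => Typed Γ P

theorem Typed.premise {Γ : Finset Name} {P : Proc} (h : Typed Γ P) : TypedPremise Γ P := by
  cases h with
  | nil l h1 h2 => exact ⟨l, rfl, h1, h2⟩
  | tau h => exact h
  | tauPair h => exact h
  | res h => exact h
  | sum h1 h2 => exact ⟨h1, h2⟩
  | op l h1 h2 h3 h4 => exact ⟨l, rfl, h1, h2, h3, h4⟩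
  | meas l h1 h2 h3 h4 => exact ⟨l, rfl, h1, h2, h3, h4⟩
  | crecv h1 h2 h3 => exact .inl ⟨h1, h2, h3⟩
  | qrecv h1 h2 h3 => exact .inr ⟨_, h1, rfl, h2, h3⟩
  | qsend h1 h2 h3 => exact .inr ⟨_, h1, rfl, h2, h3⟩
  | csend h1 h2 h3 => exact .inl ⟨h1, h2, h3⟩
  | ite h1 h2 h3 => exact ⟨h1, h2, h3⟩
  | par h1 h2 h3 => exact ⟨_, _, rfl, h1, h2, h3⟩

theorem qvar_injective : Function.Injective qvar := by
  intro i j h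
  simpa [qvar] using h

/-- Types are unique. -/
theorem Typed.unique {P : Proc} {Γ Γ' : Finset Name} (h : Typed Γ P) (h' : Typed Γ' P) :
    Γ = Γ' := by
  induction P generalizing Γ Γ' with
  | tau t P ih => exact ih h.premise h'.premise
  | tauPair t u P ih => exact ih h.premise h'.premise
  | op t E e P ih =>
    obtain ⟨_, _, _, _, _, h1⟩ := h.premise
    obtain ⟨_, _, _, _, _, h2⟩ := h'.premise
    exact ih h1 h2
  | meas t M e y P ih =>
    obtain ⟨_, _, _, _, _, h1⟩ := h.premise
    obtain ⟨_, _, _, _, _, h2⟩ := h'.premise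
    exact ih h1 h2
  | recv t c y P ih =>
    rcases h.premise with ⟨c1, -, h1⟩ | ⟨i, c1, y1, n1, h1⟩ <;>
    rcases h'.premise with ⟨c2, -, h2⟩ | ⟨j, c2, y2, n2, h2⟩
    · exact ih h1 h2
    · exact absurd c2 c1
    · exact absurd c1 c2
    · obtain rfl := qvar_injective (y1.symm.trans y2)
      have := ih h1 h2
      rw [← Finset.erase_insert n1, this, Finset.erase_insert n2]
  | nil es =>
    obtain ⟨l, e1, -, h1⟩ := h.premise
    obtain ⟨l', e2, -, h2⟩ := h'.premise
    rw [← h1, ← h2, List.map_injective_iff.2 Name.toExpr_injective (e1.symm.trans e2)]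
  | send t c e P ih =>
    rcases h.premise with ⟨c1, -, h1⟩ | ⟨i, c1, y1, n1, h1⟩ <;>
    rcases h'.premise with ⟨c2, -, h2⟩ | ⟨j, c2, y2, n2, h2⟩
    · exact ih h1 h2
    · exact absurd c2 c1
    · exact absurd c1 c2
    · obtain rfl := Name.toExpr_injective (y1.symm.trans y2)
      have := ih h1 h2
      rw [← Finset.insert_erase n1, this, Finset.insert_erase n2]
  | ite e P Q ih1 _ => exact ih1 h.premise.2.1 h'.premise.2.1
  | sum P Q ih1 _ => exact ih1 h.premise.1 h'.premise.1
  | par P Q ih1 ih2 =>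
    obtain ⟨Γ1, Γ2, rfl, -, h1, h2⟩ := h.premise
    obtain ⟨Γ3, Γ4, rfl, -, h3, h4⟩ := h'.premise
    rw [ih1 h1 h3, ih2 h2 h4]
  | res P c ih => exact ih h.premise h'.premise

/-- Substitution preserves typing, for a map `σ` of names that represents the substitution. -/
theorem Typed.subst {P : Proc} {Γ : Finset Name} (h : Typed Γ P) {x : Var} {v : Val}
    (hv : v.ty = x.ty) {σ : Name → Name} (hσ : ∀ a : Name, a.toExpr.subst x v = (σ a).toExpr)
    (hinj : Set.InjOn σ Γ) : Typed (Γ.image σ) (P.subst x v) := by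
  have hfix : ∀ a : Name, a.toExpr ≠ .var x → σ a = a := by
    intro a ha
    apply Name.toExpr_injective
    rw [← hσ]
    cases a with
    | qubit q => rfl
    | var i =>
      have : qvar i ≠ x := fun h => ha (by rw [Name.toExpr, h])
      simp [Name.toExpr, Expr.subst, this]
  -- A variable other than `x` can only be the image of itself; this preserves the freshness
  -- conditions of qubit binders.
  have hvar : ∀ a j, qvar j ≠ x → σ a = .var j → a = .var j := by
    intro a j hj ha
    have h1 := hσ a
    rw [ha] at h1
    cases a with
    | qubit q => simp [Name.toExpr, Expr.subst] at h1
    | var i =>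
      by_cases hi : qvar i = x
      · simp [Name.toExpr, Expr.subst, hi] at h1
      · simp only [Name.toExpr, Expr.subst, if_neg hi, Expr.var.injEq] at h1
        rw [qvar_injective h1]
  induction h with
  | nil l h1 h2 =>
    subst h2
    rw [Proc.subst, List.map_map]
    have : Expr.subst x v ∘ Name.toExpr = Name.toExpr ∘ σ := funext hσ
    rw [this, ← List.map_map]
    refine .nil _ (h1.map_on fun a ha b hb hab => hinj ?_ ?_ hab) ?_
    · simpa using ha
    · simpa using hb
    · ext; simp
  | tau _ ih => exact .tau (ih hinj)
  | tauPair _ ih => exact .tauPair (ih hinj)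
  | res _ ih => exact .res (ih hinj)
  | sum _ _ ih1 ih2 => exact .sum (ih1 hinj) (ih2 hinj)
  | op l h1 h2 h3 _ ih =>
    simp only [Proc.subst, hσ]
    exact .op (fun i => σ (l i)) h1 (fun i j hij => h2 (hinj (h3 i) (h3 j) hij))
      (fun i => Finset.mem_image_of_mem _ (h3 i)) (ih hinj)
  | @meas Γ _ _ _ _ y P l h2 h3 hy hP ih =>
    simp only [Proc.subst, hσ]
    refine .meas (fun i => σ (l i)) (fun i j hij => h2 (hinj (h3 i) (h3 j) hij))
      (fun i => Finset.mem_image_of_mem _ (h3 i)) hy ?_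
    split_ifs with hyx
    -- The binder shadows `x`, so the body is not substituted. The typing of the binder makes `x`
    -- classical, hence `σ` moves no name.
    · have : Γ.image σ = Γ := by
        rw [Finset.image_congr (g := id), Finset.image_id]
        intro a _
        refine hfix a fun h => ?_
        cases a with
        | qubit q => simp [Name.toExpr] at h
        | var i =>
          simp only [Name.toExpr, Expr.var.injEq] at h
          rw [hyx, ← h] at hy
          simp [qvar] at hy
      rwa [this]
    · exact ih hinj
  | @crecv Γ _ c y P hc hy hP ih =>
    simp only [Proc.subst]
    refine .crecv hc hy ?_
    split_ifs with hyx
    · have : Γ.image σ = Γ := by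
        rw [Finset.image_congr (g := id), Finset.image_id]
        intro a _
        refine hfix a fun h => ?_
        cases a with
        | qubit q => simp [Name.toExpr] at h
        | var i =>
          simp only [Name.toExpr, Expr.var.injEq] at h
          rw [hyx, ← h] at hy
          exact hc hy.symm
      rwa [this]
    · exact ih hinj
  | @qrecv Γ _ c i P hc hi hP ih =>
    simp only [Proc.subst]
    by_cases hyx : qvar i = x
    · have : Γ.image σ = Γ := by
        rw [Finset.image_congr (g := id), Finset.image_id]
        intro a ha
        refine hfix a fun h => ?_
        rw [← hyx] at h
        obtain rfl : a = .var i := Name.toExpr_injective h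
        exact hi ha
      rw [if_pos hyx, this]
      exact .qrecv hc hi hP
    · have hσi : σ (.var i) = .var i := hfix _ fun h => hyx (by simpa [Name.toExpr] using h)
      rw [if_neg hyx]
      refine .qrecv hc ?_ ?_
      · intro h
        obtain ⟨a, ha, hai⟩ := Finset.mem_image.1 h
        rw [hvar a i hyx hai] at ha
        exact hi ha
      · have := ih (by
          rw [Finset.coe_insert, Set.injOn_insert (by simpa using hi)]
          refine ⟨hinj, ?_⟩
          rintro ⟨a, ha, hai⟩
          rw [hσi] at hai
          rw [hvar a i hyx hai] at ha
          exact hi ha)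
        rwa [Finset.image_insert, hσi] at this
  | @qsend Γ _ c a P hc ha _ ih =>
    rw [Proc.subst, hσ]
    refine .qsend hc (Finset.mem_image_of_mem _ ha) ?_
    have h1 := ih (hinj.mono (by simp))
    have h2 : (Γ.erase a).image σ = (Γ.image σ).erase (σ a) := by
      ext b
      simp only [Finset.mem_image, Finset.mem_erase]
      constructor
      · rintro ⟨d, ⟨h1, h2⟩, rfl⟩
        exact ⟨fun h => h1 (hinj h2 ha h), d, h2, rfl⟩
      · rintro ⟨h1, d, h2, rfl⟩
        exact ⟨d, ⟨fun h => h1 (by rw [h]), h2⟩, rfl⟩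
    rwa [← h2]
  | csend hc he _ ih => exact .csend hc (he.subst hv) (ih hinj)
  | ite he _ _ ih1 ih2 => exact .ite (he.subst hv) (ih1 hinj) (ih2 hinj)
  | par hd _ _ ih1 ih2 =>
    rw [Proc.subst, Finset.image_union]
    refine .par ?_ (ih1 (hinj.mono (by simp))) (ih2 (hinj.mono (by simp)))
    rw [Finset.disjoint_left] at hd ⊢
    intro b hb hb'
    obtain ⟨a, ha, rfl⟩ := Finset.mem_image.1 hb
    obtain ⟨a', ha', h⟩ := Finset.mem_image.1 hb'
    have := hinj (by simp [ha']) (by simp [ha]) h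
    subst this
    exact hd ha ha'

/-- A classical variable is not a name of the typing context, so the renaming of names is the
identity. -/
theorem Typed.subst_classical {P : Proc} {Γ : Finset Name} (h : Typed Γ P) {x : Var} {v : Val}
    (hv : v.ty = x.ty) (hx : x.ty ≠ .qubit) : Typed Γ (P.subst x v) := by
  have := h.subst hv (σ := id) (fun a => by
    cases a with
    | qubit q => rfl
    | var i =>
      have : qvar i ≠ x := fun h => hx (by rw [← h]; rfl)
      simp [Name.toExpr, Expr.subst, this]) (Set.injOn_id _)
  simpa using this

/-- The condition that `q` is not yet in use makes the renaming injective, which linearity requires.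
-/
theorem Typed.subst_qubit {P : Proc} {Γ : Finset Name} {i : ℕ}
    (h : Typed (insert (Name.var i) Γ) P) (hi : Name.var i ∉ Γ) {q : Qubit}
    (hq : Name.qubit q ∉ Γ) :
    Typed (insert (Name.qubit q) Γ) (P.subst (qvar i) (.qubit q)) := by
  have hfix : ∀ a ∈ Γ, (if a = Name.var i then Name.qubit q else a) = a := by
    intro a ha
    rw [if_neg]
    rintro rfl
    exact hi ha
  have := h.subst (v := .qubit q) (x := qvar i) rfl
    (σ := fun a => if a = .var i then .qubit q else a) (fun a => by
      cases a with
      | qubit q => rfl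
      | var j =>
        by_cases hj : j = i
        · simp [Name.toExpr, Expr.subst, hj]
        · have : qvar j ≠ qvar i := fun h => hj (qvar_injective h)
          simp [Name.toExpr, Expr.subst, this, hj]) (by
      rw [Finset.coe_insert, Set.injOn_insert (by simpa using hi)]
      refine ⟨fun a ha b hb hab => ?_, ?_⟩
      · simp only at hab
        rwa [hfix a ha, hfix b hb] at hab
      · rintro ⟨a, ha, hai⟩
        simp only [if_true] at hai
        rw [hfix a ha] at hai
        exact hq (hai ▸ ha))
  rw [Finset.image_insert, if_pos rfl, Finset.image_congr (g := id), Finset.image_id] at this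
  · exact this
  · intro a ha
    exact hfix a ha

/-! ### Abstraction of a qubit name -/

/-- Replacement of the qubit name `q` by the variable `x` in an expression. -/
def Expr.abstract (q : Qubit) (x : Var) : Expr → Expr
  | .var y => .var y
  | .val w => if w = .qubit q then .var x else .val w
  | .not e => .not (e.abstract q x)
  | .or e f => .or (e.abstract q x) (f.abstract q x)
  | .le e f => .le (e.abstract q x) (f.abstract q x)
  | .eq e f => .eq (e.abstract q x) (f.abstract q x)

/-- Replacement of the qubit name `q` by the variable `x` in a process. -/
def Proc.abstract (q : Qubit) (x : Var) : Proc → Proc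
  | .tau t P => .tau t (P.abstract q x)
  | .tauPair t u P => .tauPair t u (P.abstract q x)
  | .op t E e P => .op t E (fun i => (e i).abstract q x) (P.abstract q x)
  | .meas t M e y P => .meas t M (fun i => (e i).abstract q x) y (P.abstract q x)
  | .recv t c y P => .recv t c y (P.abstract q x)
  | .nil es => .nil (es.map (Expr.abstract q x))
  | .send t c e P => .send t c (e.abstract q x) (P.abstract q x)
  | .ite e P Q => .ite (e.abstract q x) (P.abstract q x) (Q.abstract q x)
  | .sum P Q => .sum (P.abstract q x) (Q.abstract q x)
  | .par P Q => .par (P.abstract q x) (Q.abstract q x)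
  | .res P c => .res (P.abstract q x) c

/-- The variables occurring in a process, either free or bound. -/
def Proc.vars : Proc → Finset Var
  | .tau _ P => P.vars
  | .tauPair _ _ P => P.vars
  | .op _ _ e P => (Finset.univ.biUnion fun i => (e i).fv) ∪ P.vars
  | .meas _ _ e y P => (Finset.univ.biUnion fun i => (e i).fv) ∪ insert y P.vars
  | .recv _ _ x P => insert x P.vars
  | .nil es => es.foldr (fun e s => e.fv ∪ s) ∅
  | .send _ _ e P => e.fv ∪ P.vars
  | .ite e P Q => e.fv ∪ P.vars ∪ Q.vars
  | .sum P Q => P.vars ∪ Q.vars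
  | .par P Q => P.vars ∪ Q.vars
  | .res P _ => P.vars

theorem Expr.subst_abstract {q : Qubit} {x : Var} {e : Expr} (h : x ∉ e.fv) :
    (e.abstract q x).subst x (.qubit q) = e := by
  induction e with
  | var y => exact Expr.subst_of_notMem _ h
  | val w =>
    by_cases hw : w = .qubit q
    · simp [Expr.abstract, hw, Expr.subst]
    · simp [Expr.abstract, hw, Expr.subst]
  | not e ih => simp [Expr.abstract, Expr.subst, ih h]
  | or e f ih1 ih2 =>
    simp only [Expr.fv, Finset.mem_union, not_or] at h
    simp [Expr.abstract, Expr.subst, ih1 h.1, ih2 h.2]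
  | le e f ih1 ih2 =>
    simp only [Expr.fv, Finset.mem_union, not_or] at h
    simp [Expr.abstract, Expr.subst, ih1 h.1, ih2 h.2]
  | eq e f ih1 ih2 =>
    simp only [Expr.fv, Finset.mem_union, not_or] at h
    simp [Expr.abstract, Expr.subst, ih1 h.1, ih2 h.2]

/-- The variable must not occur even as a binder: substitution stops at a binder of `x`, and the
occurrences of `q` abstracted below it would not be restored. A context that must receive a qubit it
later mentions by name is built in this way. -/
theorem Proc.subst_abstract {q : Qubit} {x : Var} {P : Proc} (h : x ∉ P.vars) :
    (P.abstract q x).subst x (.qubit q) = P := by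
  induction P with
  | tau t P ih => simp only [Proc.abstract, Proc.subst, ih h]
  | tauPair t u P ih => simp only [Proc.abstract, Proc.subst, ih h]
  | op t E e P ih =>
    simp only [Proc.vars, Finset.mem_union, Finset.mem_biUnion, Finset.mem_univ, true_and,
      not_or, not_exists] at h
    simp only [Proc.abstract, Proc.subst, ih h.2, Expr.subst_abstract (h.1 _)]
  | meas t M e y P ih =>
    simp only [Proc.vars, Finset.mem_union, Finset.mem_biUnion, Finset.mem_univ, true_and,
      not_or, not_exists, Finset.mem_insert] at h
    simp only [Proc.abstract, Proc.subst, ih h.2.2, Expr.subst_abstract (h.1 _),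
      if_neg (Ne.symm h.2.1)]
  | recv t c y P ih =>
    simp only [Proc.vars, Finset.mem_insert, not_or] at h
    simp only [Proc.abstract, Proc.subst, ih h.2, if_neg (Ne.symm h.1)]
  | nil es =>
    change x ∉ (Proc.nil es).fv at h
    rw [mem_fv_nil] at h
    push Not at h
    have := List.map_congr_left (f := Expr.subst x (.qubit q) ∘ Expr.abstract q x) (g := id)
      fun e he => Expr.subst_abstract (h e he)
    rw [Proc.abstract, Proc.subst, List.map_map, this, List.map_id]
  | send t c e P ih =>
    simp only [Proc.vars, Finset.mem_union, not_or] at h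
    simp only [Proc.abstract, Proc.subst, ih h.2, Expr.subst_abstract h.1]
  | ite e P Q ih1 ih2 =>
    simp only [Proc.vars, Finset.mem_union, not_or] at h
    simp only [Proc.abstract, Proc.subst, ih1 h.1.2, ih2 h.2, Expr.subst_abstract h.1.1]
  | sum P Q ih1 ih2 =>
    simp only [Proc.vars, Finset.mem_union, not_or] at h
    simp only [Proc.abstract, Proc.subst, ih1 h.1, ih2 h.2]
  | par P Q ih1 ih2 =>
    simp only [Proc.vars, Finset.mem_union, not_or] at h
    simp only [Proc.abstract, Proc.subst, ih1 h.1, ih2 h.2]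
  | res P c ih => simp only [Proc.abstract, Proc.subst, ih h]

theorem Expr.fv_abstract (q : Qubit) (x : Var) (e : Expr) :
    (e.abstract q x).fv ⊆ insert x e.fv := by
  induction e with
  | var y => exact Finset.subset_insert _ _
  | val w => by_cases hw : w = .qubit q <;> simp [Expr.abstract, hw, Expr.fv]
  | not e ih => exact ih
  | or e f ih1 ih2 => simp only [Expr.abstract, Expr.fv]; grind
  | le e f ih1 ih2 => simp only [Expr.abstract, Expr.fv]; grind
  | eq e f ih1 ih2 => simp only [Expr.abstract, Expr.fv]; grind

theorem Proc.fv_abstract (q : Qubit) (x : Var) (P : Proc) :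
    (P.abstract q x).fv ⊆ insert x P.fv := by
  have tuple : ∀ {n : ℕ} (e : Fin n → Expr), (Finset.univ.biUnion fun i =>
      ((e i).abstract q x).fv) ⊆ insert x (Finset.univ.biUnion fun i => (e i).fv) := by
    intro n e y hy
    simp only [Finset.mem_biUnion, Finset.mem_univ, true_and] at hy
    obtain ⟨i, hi⟩ := hy
    have := Expr.fv_abstract q x (e i) hi
    simp only [Finset.mem_insert, Finset.mem_biUnion, Finset.mem_univ, true_and] at this ⊢
    exact this.imp_right fun h => ⟨i, h⟩
  induction P with
  | tau t P ih => exact ih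
  | tauPair t u P ih => exact ih
  | op t E e P ih =>
    have := tuple e
    simp only [Proc.abstract, Proc.fv]
    grind
  | meas t M e y P ih =>
    have := tuple e
    simp only [Proc.abstract, Proc.fv]
    grind
  | recv t c y P ih => simp only [Proc.abstract, Proc.fv]; grind
  | nil es =>
    intro y hy
    rw [Proc.abstract, mem_fv_nil] at hy
    obtain ⟨f, hf, hy⟩ := hy
    obtain ⟨e, he, rfl⟩ := List.mem_map.1 hf
    have := Expr.fv_abstract q x e hy
    rw [Finset.mem_insert] at this ⊢
    exact this.imp_right fun h => mem_fv_nil.2 ⟨e, he, h⟩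
  | send t c e P ih =>
    have := Expr.fv_abstract q x e
    simp only [Proc.abstract, Proc.fv]; grind
  | ite e P Q ih1 ih2 =>
    have := Expr.fv_abstract q x e
    simp only [Proc.abstract, Proc.fv]; grind
  | sum P Q ih1 ih2 => simp only [Proc.abstract, Proc.fv]; grind
  | par P Q ih1 ih2 => simp only [Proc.abstract, Proc.fv]; grind
  | res P c ih => exact ih

theorem Expr.HasTy.abstract {e : Expr} {T : Ty} (h : e.HasTy T) (q : Qubit) (i : ℕ) :
    (e.abstract q (qvar i)).HasTy T := by
  induction h with
  | var y => exact .var y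
  | val w =>
    by_cases hw : w = .qubit q
    · subst hw; simp only [Expr.abstract, if_true]; exact .var (qvar i)
    · simp only [Expr.abstract, if_neg hw]; exact .val w
  | not _ ih => exact .not ih
  | or _ _ ih1 ih2 => exact .or ih1 ih2
  | le _ _ ih1 ih2 => exact .le ih1 ih2
  | eq _ _ ih1 ih2 => exact .eq ih1 ih2

/-- Excluding the variable from the binders of `P` too prevents capture, and keeps it out of every
context met in the derivation, so that the renaming is injective on each of them. -/
theorem Typed.image_abstract {P : Proc} {Γ : Finset Name} (h : Typed Γ P) {q : Qubit} {i : ℕ}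
    (hP : qvar i ∉ P.vars) (hi : Name.var i ∉ Γ) :
    Typed (Γ.image fun a => if a = .qubit q then .var i else a) (P.abstract q (qvar i)) := by
  have hσ : ∀ a : Name, a.toExpr.abstract q (qvar i) =
      (if a = .qubit q then Name.var i else a).toExpr := by
    intro a
    cases a with
    | qubit r => by_cases hr : r = q <;> simp [Name.toExpr, Expr.abstract, hr]
    | var j => simp [Name.toExpr, Expr.abstract]
  have hinj : ∀ {Γ : Finset Name}, Name.var i ∉ Γ → Set.InjOn
      (fun a => if a = Name.qubit q then Name.var i else a) Γ := by
    intro Γ hi a ha b hb hab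
    simp only at hab
    split_ifs at hab with h1 h2 h2
    · rw [h1, h2]
    · exact absurd (hab ▸ hb) hi
    · exact absurd (hab ▸ ha) hi
    · exact hab
  generalize hs : (fun a => if a = Name.qubit q then Name.var i else a) = σ at *
  replace hσ : ∀ a : Name, a.toExpr.abstract q (qvar i) = (σ a).toExpr := by
    intro a; rw [hσ, ← hs]
  induction h with
  | nil l h1 h2 =>
    subst h2
    rw [Proc.abstract, List.map_map]
    have : Expr.abstract q (qvar i) ∘ Name.toExpr = Name.toExpr ∘ σ := funext hσ
    rw [this, ← List.map_map]
    refine .nil _ (h1.map_on fun a ha b hb hab => hinj hi ?_ ?_ hab) ?_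
    · simpa using ha
    · simpa using hb
    · ext; simp
  | tau _ ih => exact .tau (ih hP hi)
  | tauPair _ ih => exact .tauPair (ih hP hi)
  | res _ ih => exact .res (ih hP hi)
  | sum _ _ ih1 ih2 =>
    simp only [Proc.vars, Finset.mem_union, not_or] at hP
    exact .sum (ih1 hP.1 hi) (ih2 hP.2 hi)
  | op l h1 h2 h3 _ ih =>
    simp only [Proc.vars, Finset.mem_union, not_or] at hP
    simp only [Proc.abstract, hσ]
    exact .op (fun i => σ (l i)) h1 (fun i j hij => h2 (hinj hi (h3 i) (h3 j) hij))
      (fun i => Finset.mem_image_of_mem _ (h3 i)) (ih hP.2 hi)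
  | meas l h2 h3 hy _ ih =>
    simp only [Proc.vars, Finset.mem_union, Finset.mem_insert, not_or] at hP
    simp only [Proc.abstract, hσ]
    exact .meas (fun i => σ (l i)) (fun i j hij => h2 (hinj hi (h3 i) (h3 j) hij))
      (fun i => Finset.mem_image_of_mem _ (h3 i)) hy (ih hP.2.2 hi)
  | crecv hc hy _ ih =>
    simp only [Proc.vars, Finset.mem_insert, not_or] at hP
    exact .crecv hc hy (ih hP.2 hi)
  | @qrecv Γ _ c j P hc hj _ ih =>
    simp only [Proc.vars, Finset.mem_insert, not_or] at hP
    have hij : i ≠ j := fun h => hP.1 (by rw [h])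
    have hσj : σ (.var j) = .var j := by rw [← hs]; simp
    refine .qrecv hc ?_ ?_
    · intro h
      obtain ⟨a, ha, hai⟩ := Finset.mem_image.1 h
      rw [← hs] at hai
      simp only at hai
      split_ifs at hai
      · exact hij (Name.var.inj hai)
      · exact hj (hai ▸ ha)
    · have := ih hP.2 (by simp [hij, hi])
      rwa [Finset.image_insert, hσj] at this
  | @qsend Γ _ c a P hc ha _ ih =>
    simp only [Proc.vars, Finset.mem_union, not_or] at hP
    rw [Proc.abstract, hσ]
    refine .qsend hc (Finset.mem_image_of_mem _ ha) ?_
    have h1 := ih hP.2 (fun h => hi (Finset.mem_of_mem_erase h))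
    have h2 : (Γ.erase a).image σ = (Γ.image σ).erase (σ a) := by
      ext b
      simp only [Finset.mem_image, Finset.mem_erase]
      constructor
      · rintro ⟨d, ⟨h1, h2⟩, rfl⟩
        exact ⟨fun h => h1 (hinj hi h2 ha h), d, h2, rfl⟩
      · rintro ⟨h1, d, h2, rfl⟩
        exact ⟨d, ⟨fun h => h1 (by rw [h]), h2⟩, rfl⟩
    rwa [← h2]
  | csend hc he _ ih =>
    simp only [Proc.vars, Finset.mem_union, not_or] at hP
    exact .csend hc (he.abstract q i) (ih hP.2 hi)
  | ite he _ _ ih1 ih2 =>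
    simp only [Proc.vars, Finset.mem_union, not_or] at hP
    exact .ite (he.abstract q i) (ih1 hP.1.2 hi) (ih2 hP.2 hi)
  | par hd _ _ ih1 ih2 =>
    simp only [Proc.vars, Finset.mem_union, not_or] at hP
    have hi' := hi
    simp only [Finset.mem_union, not_or] at hi'
    rw [Proc.abstract, Finset.image_union]
    refine .par ?_ (ih1 hP.1 hi'.1) (ih2 hP.2 hi'.2)
    rw [Finset.disjoint_left] at hd ⊢
    intro b hb hb'
    obtain ⟨a, ha, rfl⟩ := Finset.mem_image.1 hb
    obtain ⟨a', ha', h⟩ := Finset.mem_image.1 hb'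
    have := hinj hi (by simp [ha']) (by simp [ha]) h
    subst this
    exact hd ha ha'

theorem Typed.abstract {P : Proc} {Γ : Finset Name} {q : Qubit} {i : ℕ}
    (h : Typed (insert (Name.qubit q) Γ) P) (hq : Name.qubit q ∉ Γ)
    (hP : qvar i ∉ P.vars) (hi : Name.var i ∉ Γ) :
    Typed (insert (Name.var i) Γ) (P.abstract q (qvar i)) := by
  have := h.image_abstract (q := q) hP (by simpa using hi)
  rw [Finset.image_insert, if_pos rfl, Finset.image_congr (g := id), Finset.image_id] at this
  · exact this
  · intro a ha
    refine if_neg ?_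
    rintro rfl
    exact hq ha

/-! ### Size and tags -/

/-- The number of constructors of a process. -/
def Proc.size : Proc → ℕ
  | .tau _ P => P.size + 1
  | .tauPair _ _ P => P.size + 1
  | .op _ _ _ P => P.size + 1
  | .meas _ _ _ _ P => P.size + 1
  | .recv _ _ _ P => P.size + 1
  | .nil _ => 1
  | .send _ _ _ P => P.size + 1
  | .ite _ P Q => P.size + Q.size + 1
  | .sum P Q => P.size + Q.size + 1
  | .par P Q => P.size + Q.size + 1
  | .res P _ => P.size + 1

/-- The tags occurring in a process. -/
def Proc.tags : Proc → Finset Tag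
  | .tau t P => insert t P.tags
  | .tauPair t u P => insert t (insert u P.tags)
  | .op t _ _ P => insert t P.tags
  | .meas t _ _ _ P => insert t P.tags
  | .recv t _ _ P => insert t P.tags
  | .nil _ => ∅
  | .send t _ _ P => insert t P.tags
  | .ite _ P Q => P.tags ∪ Q.tags
  | .sum P Q => P.tags ∪ Q.tags
  | .par P Q => P.tags ∪ Q.tags
  | .res P _ => P.tags

/-- The tags occurring in a scheduler. -/
def Sched.tags : Sched → Finset Tag
  | .halt => ∅
  | .tag t => {t}
  | .pair t u => {t, u}

theorem Proc.size_subst (x : Var) (v : Val) (P : Proc) : (P.subst x v).size = P.size := by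
  induction P <;> simp only [Proc.subst, Proc.size, *] <;> split_ifs <;> simp [*]

theorem Proc.tags_subst (x : Var) (v : Val) (P : Proc) : (P.subst x v).tags = P.tags := by
  induction P <;> simp only [Proc.subst, Proc.tags, *] <;> split_ifs <;> simp [*]

/-! ### Finitely supported distributions -/

section FDist

variable {A B : Type}

theorem point_weights_ne_zero {a b : A} : (point a).weights b ≠ 0 ↔ b = a := by
  classical
  rw [Convexity.StdSimplex.weights_single, Finsupp.single_apply]
  split_ifs with h
  · simp [h]
  · simp [Ne.symm h]

theorem map_weights_ne_zero {f : A → B} {D : FDist A} {b : B} :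
    (D.map f).weights b ≠ 0 ↔ ∃ a, D.weights a ≠ 0 ∧ f a = b := by
  classical
  rw [Convexity.StdSimplex.weights_map, ← Finsupp.mem_support_iff]
  constructor
  · intro h
    obtain ⟨a, ha, rfl⟩ := Finset.mem_image.1 (Finsupp.mapDomain_support h)
    exact ⟨a, Finsupp.mem_support_iff.1 ha, rfl⟩
  · rintro ⟨a, ha, rfl⟩
    rw [Finsupp.mem_support_iff, Finsupp.mapDomain, Finsupp.sum_apply, Finsupp.sum]
    refine (Finset.sum_pos' (fun i _ => ?_) ⟨a, Finsupp.mem_support_iff.2 ha, ?_⟩).ne'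
    · rw [Finsupp.single_apply]
      split_ifs
      · exact D.nonneg i
      · exact le_rfl
    · rw [Finsupp.single_eq_same]
      exact lt_of_le_of_ne (D.nonneg a) (Ne.symm ha)

theorem mix_weights (p : ℝ) (h0 : 0 ≤ p) (h1 : p ≤ 1) (D E : FDist A) :
    (mix p h0 h1 D E).weights = p • D.weights + (1 - p) • E.weights := by
  rw [mix, Convexity.StdSimplex.weights_convexCombPair]

/-- Weights are nonnegative, so the two contributions cannot cancel. -/
theorem mix_weights_ne_zero {p : ℝ} {h0 : 0 ≤ p} {h1 : p ≤ 1} {D E : FDist A} {a : A} :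
    (mix p h0 h1 D E).weights a ≠ 0 ↔
      (p ≠ 0 ∧ D.weights a ≠ 0) ∨ (p ≠ 1 ∧ E.weights a ≠ 0) := by
  rw [mix_weights, Finsupp.add_apply, Finsupp.smul_apply, Finsupp.smul_apply, smul_eq_mul,
    smul_eq_mul, ne_eq, add_eq_zero_iff_of_nonneg (mul_nonneg h0 (D.nonneg a))
      (mul_nonneg (sub_nonneg.2 h1) (E.nonneg a)), mul_eq_zero, mul_eq_zero, sub_eq_zero]
  grind

/-- Expectation of a vector-valued function. -/
noncomputable def expect {M : Type} [AddCommGroup M] [Module ℝ M] (f : A → M) (D : FDist A) : M :=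
  D.weights.sum fun a p => p • f a

variable {M N : Type} [AddCommGroup M] [Module ℝ M] [AddCommGroup N] [Module ℝ N]

theorem expect_point (f : A → M) (a : A) : expect f (point a) = f a := by
  rw [expect, Convexity.StdSimplex.weights_single, Finsupp.sum_single_index (zero_smul ℝ (f a)),
    one_smul]

theorem expect_mix (f : A → M) (p : ℝ) (h0 : 0 ≤ p) (h1 : p ≤ 1) (D E : FDist A) :
    expect f (mix p h0 h1 D E) = p • expect f D + (1 - p) • expect f E := by
  classical
  rw [expect, mix_weights, Finsupp.sum_add_index' (fun a => zero_smul ℝ (f a))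
    (fun _ _ _ => add_smul _ _ _), Finsupp.sum_smul_index (fun a => zero_smul ℝ (f a)),
    Finsupp.sum_smul_index (fun a => zero_smul ℝ (f a))]
  simp only [expect, Finsupp.smul_sum, smul_smul]

theorem expect_map (f : B → M) (g : A → B) (D : FDist A) :
    expect f (D.map g) = expect (fun a => f (g a)) D := by
  rw [expect, Convexity.StdSimplex.weights_map, Finsupp.sum_mapDomain_index
    (fun b => zero_smul ℝ (f b)) (fun _ _ _ => add_smul _ _ _)]
  rfl

theorem expect_congr {f g : A → M} {D : FDist A} (h : ∀ a, D.weights a ≠ 0 → f a = g a) :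
    expect f D = expect g D :=
  Finsupp.sum_congr fun a ha => by rw [h a (Finsupp.mem_support_iff.1 ha)]

theorem expect_const (m : M) (D : FDist A) : expect (fun _ => m) D = m := by
  rw [expect, Finsupp.sum, ← Finset.sum_smul]
  have := D.total
  rw [Finsupp.sum] at this
  rw [this, one_smul]

theorem map_expect (L : M →ₗ[ℝ] N) (f : A → M) (D : FDist A) :
    L (expect f D) = expect (fun a => L (f a)) D := by
  simp only [expect, map_finsuppSum, map_smul]

theorem expect_mem {f : A → M} {D : FDist A} {W : Submodule ℝ M}
    (h : ∀ a, D.weights a ≠ 0 → f a ∈ W) : expect f D ∈ W :=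
  Submodule.sum_mem _ fun a ha => W.smul_mem _ (h a (Finsupp.mem_support_iff.1 ha))

/-- Every distribution is obtained from point distributions by convex combinations. -/
theorem FDist.induction {p : FDist A → Prop} (hp : ∀ a, p (point a))
    (hm : ∀ (r : ℝ) (h0 : 0 ≤ r) (h1 : r ≤ 1) D E, p D → p E → p (mix r h0 h1 D E))
    (D : FDist A) : p D := by
  classical
  induction hn : D.weights.support.card using Nat.strong_induction_on generalizing D with
  | _ n ih =>
    obtain ⟨a, ha⟩ := D.support_weights_nonempty
    by_cases h1 : D.weights a = 1
    · have : D = point a := by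
        rw [← Convexity.StdSimplex.support_weights_eq_singleton]
        have ht := D.total
        rw [Finsupp.sum, ← Finset.add_sum_erase _ _ ha, h1] at ht
        have h0 : ∀ b ∈ D.weights.support.erase a, D.weights b = 0 :=
          (Finset.sum_eq_zero_iff_of_nonneg fun b _ => D.nonneg b).1 (by linarith)
        ext b
        rw [Finset.mem_singleton]
        constructor
        · intro hb
          by_contra hba
          exact (Finsupp.mem_support_iff.1 hb) (h0 b (Finset.mem_erase.2 ⟨hba, hb⟩))
        · rintro rfl
          exact ha
      rw [this]
      exact hp a
    · have ht := D.total
      rw [Finsupp.sum, ← Finset.add_sum_erase _ _ ha] at ht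
      have hle : D.weights a ≤ 1 := by
        have : 0 ≤ ∑ x ∈ D.weights.support.erase a, D.weights x :=
          Finset.sum_nonneg fun b _ => D.nonneg b
        linarith
      have hpos : 0 < 1 - D.weights a := sub_pos.2 (lt_of_le_of_ne hle h1)
      -- `E` is `D` conditioned on avoiding `a`; its support has lost `a`, so the induction
      -- hypothesis applies.
      let E : FDist A :=
        { weights := (1 - D.weights a)⁻¹ • D.weights.erase a
          nonneg := fun b => by
            rw [Finsupp.smul_apply, Finsupp.erase_apply]
            refine smul_nonneg (inv_nonneg.2 hpos.le) ?_
            split_ifs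
            · exact le_rfl
            · exact D.nonneg b
          total := by
            rw [Finsupp.sum_smul_index fun _ => rfl, ← Finsupp.mul_sum, Finsupp.sum,
              Finsupp.support_erase, Finset.sum_congr rfl fun b hb =>
                Finsupp.erase_ne (Finset.ne_of_mem_erase hb)]
            rw [inv_mul_eq_one₀ hpos.ne']
            linarith }
      have hE : D = mix (D.weights a) (D.nonneg a) hle (point a) E := by
        apply Convexity.StdSimplex.ext
        rw [mix_weights, smul_inv_smul₀ hpos.ne', Convexity.StdSimplex.weights_single,
          Finsupp.smul_single, smul_eq_mul, mul_one, Finsupp.single_add_erase]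
      rw [hE]
      refine hm _ _ _ _ _ (hp a) (ih _ ?_ E rfl)
      rw [← hn]
      have : E.weights.support ⊆ D.weights.support.erase a := by
        rw [← Finsupp.support_erase]
        exact Finsupp.support_smul
      exact lt_of_le_of_lt (Finset.card_le_card this) (Finset.card_erase_lt_of_mem ha)

/-! ### Liftings -/

theorem Lift.total {R : A → FDist B → Prop} (h : ∀ a, ∃ E, R a E) (D : FDist A) :
    ∃ E, Lift R D E := by
  induction D using FDist.induction with
  | hp a =>
    obtain ⟨E, hE⟩ := h a
    exact ⟨E, .base hE⟩
  | hm r h0 h1 D D' ih ih' =>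
    obtain ⟨E, hE⟩ := ih
    obtain ⟨E', hE'⟩ := ih'
    exact ⟨_, .linear r h0 h1 hE hE'⟩

theorem Lift.exists_of_weights_ne_zero {R : A → FDist B → Prop} {D : FDist A} {E : FDist B}
    (h : Lift R D E) {b : B} (hb : E.weights b ≠ 0) :
    ∃ a F, D.weights a ≠ 0 ∧ R a F ∧ F.weights b ≠ 0 := by
  induction h with
  | base h => exact ⟨_, _, point_weights_ne_zero.2 rfl, h, hb⟩
  | linear p h0 h1 _ _ ih ih' =>
    rcases mix_weights_ne_zero.1 hb with ⟨hp, h⟩ | ⟨hp, h⟩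
    · obtain ⟨a, F, ha, hF⟩ := ih h
      exact ⟨a, F, mix_weights_ne_zero.2 (.inl ⟨hp, ha⟩), hF⟩
    · obtain ⟨a, F, ha, hF⟩ := ih' h
      exact ⟨a, F, mix_weights_ne_zero.2 (.inr ⟨hp, ha⟩), hF⟩

/-- Expectations turn convex combinations into linear ones, so an identity that holds on the
generating pairs propagates to the lifting. This is how liftings of transitions become linear maps.
-/
theorem Lift.expect_eq {R : A → FDist B → Prop} {D : FDist A} {E : FDist B} (h : Lift R D E)
    {f : B → M} {g : A → M}
    (hfg : ∀ a, D.weights a ≠ 0 → ∀ F, R a F → expect f F = g a) :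
    expect f E = expect g D := by
  induction h with
  | base h => rw [expect_point, hfg _ (point_weights_ne_zero.2 rfl) _ h]
  | linear p h0 h1 _ _ ih ih' =>
    rw [expect_mix, expect_mix]
    congr 1
    -- With weight zero, the points of this component need not belong to the support of the mixture,
    -- and the hypothesis says nothing about them; the factor zero disposes of the term.
    · by_cases hp : p = 0
      · rw [hp, zero_smul, zero_smul]
      · rw [ih fun a ha => hfg a (mix_weights_ne_zero.2 (.inl ⟨hp, ha⟩))]
    · by_cases hp : p = 1
      · rw [hp, sub_self, zero_smul, zero_smul]
      · rw [ih' fun a ha => hfg a (mix_weights_ne_zero.2 (.inr ⟨hp, ha⟩))]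

end FDist

/-! ### Inversion of transitions -/

/-- The premises of the rules for the transitions of a process. -/
def StepPremise {S : Finset Qubit} (ρ : Density S) (R : Proc) (μ : Act) (s : Sched)
    (D : FDist (Conf S)) : Prop :=
  match R with
  | .tau t P => μ = .tau ∧ s = .tag t ∧ D = point ⟨ρ, P⟩
  | .tauPair t u P => μ = .tau ∧ s = .pair t u ∧ D = point ⟨ρ, P⟩
  | @Proc.op n t E e P => ∃ q : Fin n ↪ S, e = (fun i => .val (.qubit (q i))) ∧ μ = .tau ∧
      s = .tag t ∧ D = point ⟨E.act q ρ, P⟩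
  | @Proc.meas n _ t M e y P => ∃ q : Fin n ↪ S, e = (fun i => .val (.qubit (q i))) ∧
      μ = .tau ∧ s = .tag t ∧ D = (M.outcome q ρ).map fun m =>
          ⟨normalize ρ (M.branch q ρ m), P.subst y (.nat m)⟩
  | .recv t c x P => ∃ v, v.ty = c.ty ∧ (∀ q, v = .qubit q → q ∈ S) ∧
      (Act.inp c v).Fresh (.recv t c x P) ∧ μ = .inp c v ∧ s = .tag t ∧
      D = point ⟨ρ, P.subst x v⟩
  | .nil _ => False
  | .send t c e P => ∃ v, e.Eval v ∧ μ = .out c v ∧ s = .tag t ∧ D = point ⟨ρ, P⟩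
  | .ite e P Q => (e.Eval (.bool true) ∧ Step ρ P μ s D) ∨ (e.Eval (.bool false) ∧ Step ρ Q μ s D)
  | .sum P Q => Step ρ P μ s D ∨ Step ρ Q μ s D
  | .res P c => ∃ D', Step ρ P μ s D' ∧ μ.Avoids c ∧
      D = D'.map fun C => ⟨C.state, .res C.proc c⟩
  | .par P Q =>
      (∃ D', Step ρ P μ s D' ∧ μ.Fresh Q ∧ D = D'.map fun C => ⟨C.state, .par C.proc Q⟩) ∨
      (∃ D', Step ρ Q μ s D' ∧ μ.Fresh P ∧ D = D'.map fun C => ⟨C.state, .par P C.proc⟩) ∨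
      (∃ P' Q' c v t u, Step ρ P (.out c v) (.tag t) (point ⟨ρ, P'⟩) ∧
        Step ρ Q (.inp c v) (.tag u) (point ⟨ρ, Q'⟩) ∧ μ = .tau ∧ s = .pair t u ∧
        D = point ⟨ρ, .par P' Q'⟩) ∨
      (∃ P' Q' c v t u, Step ρ Q (.out c v) (.tag t) (point ⟨ρ, Q'⟩) ∧
        Step ρ P (.inp c v) (.tag u) (point ⟨ρ, P'⟩) ∧ μ = .tau ∧ s = .pair t u ∧
        D = point ⟨ρ, .par P' Q'⟩)

section Step

variable {S : Finset Qubit} {ρ : Density S} {P Q : Proc} {μ : Act} {s : Sched}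
  {D : FDist (Conf S)}

theorem Step.premise (h : Step ρ P μ s D) : StepPremise ρ P μ s D := by
  cases h with
  | iteT h1 h2 => exact .inl ⟨h2, h1⟩
  | iteF h1 h2 => exact .inr ⟨h2, h1⟩
  | tau => exact ⟨rfl, rfl, rfl⟩
  | tauPair => exact ⟨rfl, rfl, rfl⟩
  | send h => exact ⟨_, h, rfl, rfl, rfl⟩
  | recv h1 h2 h3 => exact ⟨_, h1, h2, h3, rfl, rfl, rfl⟩
  | res h1 h2 => exact ⟨_, h1, h2, rfl⟩
  | op q => exact ⟨q, rfl, rfl, rfl, rfl⟩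
  | meas q => exact ⟨q, rfl, rfl, rfl, rfl⟩
  | parL h1 h2 => exact .inl ⟨_, h1, h2, rfl⟩
  | parR h1 h2 => exact .inr (.inl ⟨_, h1, h2, rfl⟩)
  | sumL h => exact .inl h
  | sumR h => exact .inr h
  | synchL h1 h2 => exact .inr (.inr (.inl ⟨_, _, _, _, _, _, h1, h2, rfl, rfl, rfl⟩))
  | synchR h1 h2 => exact .inr (.inr (.inr ⟨_, _, _, _, _, _, h1, h2, rfl, rfl, rfl⟩))

/-- The calculus has no recursion, so a component of a parallel composition that moves is visibly
different afterwards. This separates the rules for parallel composition. -/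
theorem Step.size_lt (h : Step ρ P μ s D) {C : Conf S} (hC : D.weights C ≠ 0) :
    C.proc.size < P.size := by
  induction h generalizing C with
  | iteT _ _ ih => have := ih hC; simp only [Proc.size]; omega
  | iteF _ _ ih => have := ih hC; simp only [Proc.size]; omega
  | tau => rw [point_weights_ne_zero.1 hC]; simp [Proc.size]
  | tauPair => rw [point_weights_ne_zero.1 hC]; simp [Proc.size]
  | send => rw [point_weights_ne_zero.1 hC]; simp [Proc.size]
  | recv => rw [point_weights_ne_zero.1 hC]; simp [Proc.size, Proc.size_subst]
  | res _ _ ih =>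
    obtain ⟨C', h, rfl⟩ := map_weights_ne_zero.1 hC
    have := ih h; simp only [Proc.size]; omega
  | op q => rw [point_weights_ne_zero.1 hC]; simp [Proc.size]
  | meas q =>
    obtain ⟨C', h, rfl⟩ := map_weights_ne_zero.1 hC
    simp [Proc.size, Proc.size_subst]
  | parL _ _ ih =>
    obtain ⟨C', h, rfl⟩ := map_weights_ne_zero.1 hC
    have := ih h; simp only [Proc.size]; omega
  | parR _ _ ih =>
    obtain ⟨C', h, rfl⟩ := map_weights_ne_zero.1 hC
    have := ih h; simp only [Proc.size]; omega
  | sumL _ ih => have := ih hC; simp only [Proc.size]; omega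
  | sumR _ ih => have := ih hC; simp only [Proc.size]; omega
  | synchL _ _ ih1 ih2 =>
    have h1 := ih1 (point_weights_ne_zero.2 rfl)
    have h2 := ih2 (point_weights_ne_zero.2 rfl)
    rw [point_weights_ne_zero.1 hC]; simp only [Proc.size] at *; omega
  | synchR _ _ ih1 ih2 =>
    have h1 := ih1 (point_weights_ne_zero.2 rfl)
    have h2 := ih2 (point_weights_ne_zero.2 rfl)
    rw [point_weights_ne_zero.1 hC]; simp only [Proc.size] at *; omega

/-- A scheduler can only name tags of the process it moves; with `Step.tags_subset`, tags chosen
fresh stay fresh throughout a run. -/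
theorem Step.sched_tags (h : Step ρ P μ s D) : s.tags ⊆ P.tags := by
  induction h <;> simp only [Sched.tags, Proc.tags] at * <;> grind

theorem Step.tags_subset (h : Step ρ P μ s D) {C : Conf S} (hC : D.weights C ≠ 0) :
    C.proc.tags ⊆ P.tags := by
  induction h generalizing C with
  | iteT _ _ ih => exact (ih hC).trans Finset.subset_union_left
  | iteF _ _ ih => exact (ih hC).trans Finset.subset_union_right
  | tau => rw [point_weights_ne_zero.1 hC]; simp [Proc.tags]
  | tauPair => rw [point_weights_ne_zero.1 hC]; simp only [Proc.tags]; grind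
  | send => rw [point_weights_ne_zero.1 hC]; simp [Proc.tags]
  | recv => rw [point_weights_ne_zero.1 hC]; simp [Proc.tags, Proc.tags_subst]
  | res _ _ ih =>
    obtain ⟨C', h, rfl⟩ := map_weights_ne_zero.1 hC
    exact ih (C := C') h
  | op q => rw [point_weights_ne_zero.1 hC]; simp [Proc.tags]
  | meas q =>
    obtain ⟨C', h, rfl⟩ := map_weights_ne_zero.1 hC
    simp [Proc.tags, Proc.tags_subst]
  | parL _ _ ih =>
    obtain ⟨C', h, rfl⟩ := map_weights_ne_zero.1 hC
    exact Finset.union_subset_union_left (ih h)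
  | parR _ _ ih =>
    obtain ⟨C', h, rfl⟩ := map_weights_ne_zero.1 hC
    exact Finset.union_subset_union_right (ih h)
  | sumL _ ih => exact (ih hC).trans Finset.subset_union_left
  | sumR _ ih => exact (ih hC).trans Finset.subset_union_right
  | synchL _ _ ih1 ih2 =>
    rw [point_weights_ne_zero.1 hC]
    exact Finset.union_subset_union (ih1 (point_weights_ne_zero.2 rfl))
      (ih2 (point_weights_ne_zero.2 rfl))
  | synchR _ _ ih1 ih2 =>
    rw [point_weights_ne_zero.1 hC]
    exact Finset.union_subset_union (ih2 (point_weights_ne_zero.2 rfl))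
      (ih1 (point_weights_ne_zero.2 rfl))

/-- An action that leaves the quantum state unchanged. -/
def Act.Visible : Act → Prop
  | .tau => False
  | _ => True

/-- Visible transitions are selected by a tag and do not involve the quantum state. -/
theorem Step.visible (h : Step ρ P μ s D) (hμ : μ.Visible) :
    (∃ t, s = .tag t) ∧ ∃ P', ∀ σ : Density S, (σ = ρ → D = point ⟨ρ, P'⟩) ∧
      Step σ P μ s (point ⟨σ, P'⟩) := by
  induction h with
  | iteT _ he ih =>
    obtain ⟨hs, P', h⟩ := ih hμ
    exact ⟨hs, P', fun σ => ⟨(h σ).1, .iteT (h σ).2 he⟩⟩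
  | iteF _ he ih =>
    obtain ⟨hs, P', h⟩ := ih hμ
    exact ⟨hs, P', fun σ => ⟨(h σ).1, .iteF (h σ).2 he⟩⟩
  | tau => exact hμ.elim
  | tauPair => exact hμ.elim
  | send he => exact ⟨⟨_, rfl⟩, _, fun σ => ⟨fun _ => rfl, .send he⟩⟩
  | recv h1 h2 h3 => exact ⟨⟨_, rfl⟩, _, fun σ => ⟨fun _ => rfl, .recv h1 h2 h3⟩⟩
  | @res c _ _ _ _ _ ha ih =>
    obtain ⟨hs, P', h⟩ := ih hμ
    refine ⟨hs, .res P' c, fun σ => ⟨fun e => ?_, ?_⟩⟩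
    · rw [(h σ).1 e, Convexity.StdSimplex.map_single]
    · have := Step.res (h σ).2 ha
      rwa [Convexity.StdSimplex.map_single] at this
  | op q => exact hμ.elim
  | meas q => exact hμ.elim
  | @parL _ Q _ _ _ _ ha ih =>
    obtain ⟨hs, P', h⟩ := ih hμ
    refine ⟨hs, .par P' Q, fun σ => ⟨fun e => ?_, ?_⟩⟩
    · rw [(h σ).1 e, Convexity.StdSimplex.map_single]
    · have := Step.parL (h σ).2 ha
      rwa [Convexity.StdSimplex.map_single] at this
  | @parR P _ _ _ _ _ ha ih =>
    obtain ⟨hs, P', h⟩ := ih hμ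
    refine ⟨hs, .par P P', fun σ => ⟨fun e => ?_, ?_⟩⟩
    · rw [(h σ).1 e, Convexity.StdSimplex.map_single]
    · have := Step.parR (h σ).2 ha
      rwa [Convexity.StdSimplex.map_single] at this
  | sumL _ ih =>
    obtain ⟨hs, P', h⟩ := ih hμ
    exact ⟨hs, P', fun σ => ⟨(h σ).1, .sumL (h σ).2⟩⟩
  | sumR _ ih =>
    obtain ⟨hs, P', h⟩ := ih hμ
    exact ⟨hs, P', fun σ => ⟨(h σ).1, .sumR (h σ).2⟩⟩
  | synchL => exact hμ.elim
  | synchR => exact hμ.elim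

theorem Step.exists_point (h : Step ρ P μ s D) (hμ : μ.Visible) :
    ∃ t P', s = .tag t ∧ D = point ⟨ρ, P'⟩ := by
  obtain ⟨⟨t, ht⟩, P', h'⟩ := h.visible hμ
  exact ⟨t, P', ht, (h' ρ).1 rfl⟩

/-- Visible transitions are the same in all quantum states. -/
theorem Step.change_state {P' : Proc} (h : Step ρ P μ s (point ⟨ρ, P'⟩)) (hμ : μ.Visible)
    (σ : Density S) : Step σ P μ s (point ⟨σ, P'⟩) := by
  obtain ⟨-, P'', h'⟩ := h.visible hμ
  have h1 := (h' ρ).1 rfl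
  have h2 : (point (⟨ρ, P''⟩ : Conf S)).weights ⟨ρ, P'⟩ ≠ 0 := by
    rw [← h1]; exact point_weights_ne_zero.2 rfl
  have h3 := congrArg Conf.proc (point_weights_ne_zero.1 h2)
  simp only at h3
  rw [h3]
  exact (h' σ).2

theorem Step.not_halt : ¬ Step ρ P μ .halt D := by
  intro h
  generalize hs : Sched.halt = s at h
  induction h <;> first | (cases hs; done) | (rename_i ih; exact ih hs)

end Step

/-! ### Subject reduction -/

/-- The typing context after an action. -/
def Act.names (Γ : Finset Name) : Act → Finset Name
  | .out _ (.qubit q) => Γ.erase (.qubit q)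
  | .inp _ (.qubit q) => insert (.qubit q) Γ
  | _ => Γ

/-- The set of qubits used by a process after an action. -/
def Act.after (U : Finset Qubit) : Act → Finset Qubit
  | .out _ (.qubit q) => U.erase q
  | .inp _ (.qubit q) => insert q U
  | _ => U

/-- The actions that processes of type `Γ` can possibly perform. -/
def Act.Admissible (S : Finset Qubit) (Γ : Finset Name) : Act → Prop
  | .tau => True
  | .out c v => v.ty = c.ty ∧ ∀ q, v = .qubit q → Name.qubit q ∈ Γ
  | .inp c v => v.ty = c.ty ∧ ∀ q, v = .qubit q → q ∈ S ∧ Name.qubit q ∉ Γ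

theorem Act.names_image (U : Finset Qubit) (μ : Act) :
    μ.names (U.image Name.qubit) = (μ.after U).image Name.qubit := by
  have hinj : Function.Injective Name.qubit := fun a b h => Name.qubit.inj h
  rcases μ with _ | ⟨c, _ | _ | q⟩ | ⟨c, _ | _ | q⟩ <;>
    simp [Act.names, Act.after, Finset.image_erase hinj, Finset.image_insert]

/-- A qubit sent by one component was owned by it, hence not by the other; a qubit received is new
to the other by freshness. In both cases the contexts stay disjoint. -/
theorem Act.Admissible.par {S : Finset Qubit} {Γ Γ' : Finset Name} {μ : Act} {P Q R : Proc}
    (h : μ.Admissible S Γ) (hd : Disjoint Γ Γ') (hμ : μ.Fresh R) (hR : Typed Γ' R)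
    (hP : Typed (μ.names Γ) P) (hQ : Typed Γ' Q) :
    μ.Admissible S (Γ ∪ Γ') ∧ Typed (μ.names (Γ ∪ Γ')) (.par P Q) ∧
      Typed (μ.names (Γ ∪ Γ')) (.par Q P) := by
  have key : μ.Admissible S (Γ ∪ Γ') ∧ Disjoint (μ.names Γ) Γ' ∧
      μ.names (Γ ∪ Γ') = μ.names Γ ∪ Γ' := by
    rcases μ with _ | ⟨c, v⟩ | ⟨c, v⟩
    · exact ⟨trivial, hd, rfl⟩
    · refine ⟨⟨h.1, fun q hq => Finset.mem_union_left _ (h.2 q hq)⟩, ?_⟩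
      rcases v with _ | _ | q
      · exact ⟨hd, rfl⟩
      · exact ⟨hd, rfl⟩
      · have hq := Finset.disjoint_left.1 hd (h.2 q rfl)
        refine ⟨hd.mono_left (Finset.erase_subset _ _), ?_⟩
        simp only [Act.names, Finset.erase_union_distrib]
        rw [Finset.erase_eq_of_notMem hq]
    · rcases v with _ | _ | q
      · exact ⟨⟨h.1, fun q hq => nomatch hq⟩, hd, rfl⟩
      · exact ⟨⟨h.1, fun q hq => nomatch hq⟩, hd, rfl⟩
      · have hq : Name.qubit q ∉ Γ' := hμ Γ' hR
        refine ⟨⟨h.1, fun r hr => ?_⟩, Finset.disjoint_insert_left.2 ⟨hq, hd⟩, ?_⟩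
        · cases hr
          exact ⟨(h.2 q rfl).1, by simp [hq, (h.2 q rfl).2]⟩
        · simp only [Act.names, Finset.insert_union]
  refine ⟨key.1, ?_, ?_⟩ <;> rw [key.2.2]
  · exact .par key.2.1 hP hQ
  · rw [Finset.union_comm]
    exact .par key.2.1.symm hQ hP

/-- A transmitted qubit passes from `Γ` to `Γ'`, which leaves their union unchanged and keeps them
disjoint. -/
theorem Typed.synch {Γ Γ' : Finset Name} {P Q : Proc} {S : Finset Qubit} {c : Chan} {v : Val}
    (hd : Disjoint Γ Γ') (ho : (Act.out c v).Admissible S Γ)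
    (hP : Typed ((Act.out c v).names Γ) P)
    (hQ : Typed ((Act.inp c v).names Γ') Q) :
    Typed (Γ ∪ Γ') (.par P Q) ∧ Typed (Γ ∪ Γ') (.par Q P) := by
  have key : Disjoint ((Act.out c v).names Γ) ((Act.inp c v).names Γ') ∧
      Γ ∪ Γ' = (Act.out c v).names Γ ∪ (Act.inp c v).names Γ' := by
    rcases v with _ | _ | q
    · exact ⟨hd, rfl⟩
    · exact ⟨hd, rfl⟩
    · have hq := ho.2 q rfl
      simp only [Act.names]
      constructor
      · rw [Finset.disjoint_insert_right]
        exact ⟨Finset.notMem_erase _ _, hd.mono_left (Finset.erase_subset _ _)⟩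
      · rw [Finset.union_insert, ← Finset.insert_union, Finset.insert_erase hq]
  constructor <;> rw [key.2]
  · exact .par key.1 hP hQ
  · rw [Finset.union_comm]
    exact .par key.1.symm hQ hP

section Step

variable {S : Finset Qubit} {ρ : Density S} {P Q : Proc} {μ : Act} {s : Sched}
  {D : FDist (Conf S)}

theorem Step.typed (h : Step ρ P μ s D) {Γ : Finset Name} (hP : Typed Γ P) (hc : P.fv = ∅) :
    μ.Admissible S Γ ∧ ∀ C, D.weights C ≠ 0 → C.proc.fv = ∅ ∧ Typed (μ.names Γ) C.proc := by
  induction h generalizing Γ with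
  | iteT _ _ ih =>
    simp only [Proc.fv, Finset.union_eq_empty] at hc
    exact ih hP.premise.2.1 hc.1.2
  | iteF _ _ ih =>
    simp only [Proc.fv, Finset.union_eq_empty] at hc
    exact ih hP.premise.2.2 hc.2
  | tau =>
    refine ⟨trivial, fun C hC => ?_⟩
    rw [point_weights_ne_zero.1 hC]
    exact ⟨hc, hP.premise⟩
  | tauPair =>
    refine ⟨trivial, fun C hC => ?_⟩
    rw [point_weights_ne_zero.1 hC]
    exact ⟨hc, hP.premise⟩
  | @send t c e v P he =>
    simp only [Proc.fv, Finset.union_eq_empty] at hc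
    rcases hP.premise with ⟨h1, h2, h3⟩ | ⟨a, h1, rfl, h2, h3⟩
    · have hv := h2.eval_ty he
      have hq : ∀ q, v ≠ .qubit q := by
        rintro q rfl
        exact h1 hv.symm
      refine ⟨⟨hv, fun q hq' => absurd hq' (hq q)⟩, fun C hC => ?_⟩
      rw [point_weights_ne_zero.1 hC]
      refine ⟨hc.2, ?_⟩
      rcases v with _ | _ | q
      · exact h3
      · exact h3
      · exact absurd rfl (hq q)
    · cases a with
      | var i => cases he
      | qubit q =>
        cases he
        refine ⟨⟨h1.symm, fun r hr => ?_⟩, fun C hC => ?_⟩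
        · cases hr
          exact h2
        · rw [point_weights_ne_zero.1 hC]
          exact ⟨hc.2, h3⟩
  | @recv t c x v P hv hS hf =>
    simp only [Proc.fv] at hc
    rcases hP.premise with ⟨h1, h2, h3⟩ | ⟨i, h1, rfl, h2, h3⟩
    · have hq : ∀ q, v ≠ .qubit q := by
        rintro q rfl
        exact h1 hv.symm
      refine ⟨⟨hv, fun q hq' => absurd hq' (hq q)⟩, fun C hC => ?_⟩
      rw [point_weights_ne_zero.1 hC]
      refine ⟨by rw [Proc.fv_subst, hc], ?_⟩
      have := h3.subst_classical (x := x) (hv.trans h2.symm) (by rwa [h2])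
      rcases v with _ | _ | q
      · exact this
      · exact this
      · exact absurd rfl (hq q)
    · rcases v with _ | _ | q
      · rw [h1] at hv; cases hv
      · rw [h1] at hv; cases hv
      · have hq : Name.qubit q ∉ Γ := hf Γ hP
        refine ⟨⟨hv, fun r hr => ?_⟩, fun C hC => ?_⟩
        · cases hr
          exact ⟨hS q rfl, hq⟩
        · rw [point_weights_ne_zero.1 hC]
          exact ⟨by rw [Proc.fv_subst, hc], h3.subst_qubit h2 hq⟩
  | res _ _ ih =>
    obtain ⟨h1, h2⟩ := ih hP.premise hc
    refine ⟨h1, fun C hC => ?_⟩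
    obtain ⟨C', h, rfl⟩ := map_weights_ne_zero.1 hC
    exact ⟨(h2 C' h).1, .res (h2 C' h).2⟩
  | op q =>
    simp only [Proc.fv, Finset.union_eq_empty] at hc
    obtain ⟨_, _, _, _, _, h⟩ := hP.premise
    refine ⟨trivial, fun C hC => ?_⟩
    rw [point_weights_ne_zero.1 hC]
    exact ⟨hc.2, h⟩
  | meas q =>
    simp only [Proc.fv, Finset.union_eq_empty] at hc
    obtain ⟨_, _, _, _, hy, h⟩ := hP.premise
    refine ⟨trivial, fun C hC => ?_⟩
    obtain ⟨m, -, rfl⟩ := map_weights_ne_zero.1 hC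
    exact ⟨by rw [Proc.fv_subst, hc.2], h.subst_classical hy.symm (by simp [hy])⟩
  | parL _ hf ih =>
    simp only [Proc.fv, Finset.union_eq_empty] at hc
    obtain ⟨Γ1, Γ2, rfl, hd, h1, h2⟩ := hP.premise
    obtain ⟨ha, h⟩ := ih h1 hc.1
    constructor
    -- Admissibility for the composition is packaged with the typing of a residual, so any point of
    -- the nonempty support serves.
    · obtain ⟨C, hC⟩ := Convexity.StdSimplex.support_weights_nonempty ‹FDist (Conf S)›
      exact (ha.par hd hf h2 (h C (Finsupp.mem_support_iff.1 hC)).2 h2).1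
    · intro C hC
      obtain ⟨C', hC', rfl⟩ := map_weights_ne_zero.1 hC
      exact ⟨by simp [Proc.fv, (h C' hC').1, hc.2], (ha.par hd hf h2 (h C' hC').2 h2).2.1⟩
  | parR _ hf ih =>
    simp only [Proc.fv, Finset.union_eq_empty] at hc
    obtain ⟨Γ1, Γ2, rfl, hd, h1, h2⟩ := hP.premise
    obtain ⟨ha, h⟩ := ih h2 hc.2
    rw [Finset.union_comm]
    constructor
    · obtain ⟨C, hC⟩ := Convexity.StdSimplex.support_weights_nonempty ‹FDist (Conf S)›
      exact (ha.par hd.symm hf h1 (h C (Finsupp.mem_support_iff.1 hC)).2 h1).1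
    · intro C hC
      obtain ⟨C', hC', rfl⟩ := map_weights_ne_zero.1 hC
      exact ⟨by simp [Proc.fv, (h C' hC').1, hc.1],
        (ha.par hd.symm hf h1 (h C' hC').2 h1).2.2⟩
  | sumL _ ih =>
    simp only [Proc.fv, Finset.union_eq_empty] at hc
    exact ih hP.premise.1 hc.1
  | sumR _ ih =>
    simp only [Proc.fv, Finset.union_eq_empty] at hc
    exact ih hP.premise.2 hc.2
  | synchL _ _ ih1 ih2 =>
    simp only [Proc.fv, Finset.union_eq_empty] at hc
    obtain ⟨Γ1, Γ2, rfl, hd, h1, h2⟩ := hP.premise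
    obtain ⟨a1, b1⟩ := ih1 h1 hc.1
    obtain ⟨a2, b2⟩ := ih2 h2 hc.2
    have c1 := b1 _ (point_weights_ne_zero.2 rfl)
    have c2 := b2 _ (point_weights_ne_zero.2 rfl)
    refine ⟨trivial, fun C hC => ?_⟩
    rw [point_weights_ne_zero.1 hC]
    exact ⟨Finset.union_eq_empty.2 ⟨c1.1, c2.1⟩, (Typed.synch hd a1 c1.2 c2.2).1⟩
  | synchR _ _ ih1 ih2 =>
    simp only [Proc.fv, Finset.union_eq_empty] at hc
    obtain ⟨Γ1, Γ2, rfl, hd, h1, h2⟩ := hP.premise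
    obtain ⟨a1, b1⟩ := ih1 h2 hc.2
    obtain ⟨a2, b2⟩ := ih2 h1 hc.1
    have c1 := b1 _ (point_weights_ne_zero.2 rfl)
    have c2 := b2 _ (point_weights_ne_zero.2 rfl)
    refine ⟨trivial, fun C hC => ?_⟩
    rw [point_weights_ne_zero.1 hC]
    refine ⟨Finset.union_eq_empty.2 ⟨c2.1, c1.1⟩, ?_⟩
    rw [Finset.union_comm]
    exact (Typed.synch hd.symm a1 c1.2 c2.2).2

theorem Step.owns (h : Step ρ P μ s D) {U : Finset Qubit} (hP : Owns U P) {C : Conf S}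
    (hC : D.weights C ≠ 0) : Owns (μ.after U) C.proc := by
  obtain ⟨h1, h2⟩ := (h.typed hP.2 hP.1).2 C hC
  rw [Act.names_image] at h2
  exact ⟨h1, h2⟩

theorem Step.admissible (h : Step ρ P μ s D) {U : Finset Qubit} (hP : Owns U P) :
    μ.Admissible S (U.image Name.qubit) :=
  (h.typed hP.2 hP.1).1

end Step

theorem Owns.unique {U U' : Finset Qubit} {P : Proc} (h : Owns U P) (h' : Owns U' P) :
    U = U' :=
  Finset.image_injective (fun _ _ h => Name.qubit.inj h) (h.2.unique h'.2)

theorem Owns.par {U V : Finset Qubit} {P Q : Proc} (hP : Owns U P) (hQ : Owns (V \ U) Q)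
    (hUV : U ⊆ V) : Owns V (.par P Q) := by
  refine ⟨Finset.union_eq_empty.2 ⟨hP.1, hQ.1⟩, ?_⟩
  have := Typed.par ?_ hP.2 hQ.2
  · rwa [← Finset.image_union, Finset.union_sdiff_of_subset hUV] at this
  · rw [Finset.disjoint_image fun _ _ h => Name.qubit.inj h]
    exact Finset.disjoint_sdiff

theorem Owns.fresh_iff {U : Finset Qubit} {P : Proc} (h : Owns U P) {c : Chan} {q : Qubit} :
    (Act.inp c (.qubit q)).Fresh P ↔ q ∉ U := by
  constructor
  · intro hf hq
    exact hf _ h.2 (Finset.mem_image_of_mem _ hq)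
  · intro hq Γ hΓ
    rw [hΓ.unique h.2]
    simpa using hq

/-! ### Deterministic tagging -/

theorem DeterministicallyTagged.locally {S : Finset Qubit} {P : Proc}
    (h : DeterministicallyTagged S P) : LocallyDeterministic S P :=
  h P .refl

theorem DeterministicallyTagged.successor {S : Finset Qubit} {P P' : Proc}
    (h : DeterministicallyTagged S P) (h' : Successor S P P') : DeterministicallyTagged S P' :=
  fun P'' h'' => h P'' (.head h' h'')

theorem DeterministicallyTagged.step {S : Finset Qubit} {ρ : Density S} {P : Proc} {μ : Act}
    {s : Sched} {D : FDist (Conf S)} (hP : DeterministicallyTagged S P) (h : Step ρ P μ s D)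
    {C : Conf S} (hC : D.weights C ≠ 0) : DeterministicallyTagged S C.proc :=
  hP.successor ⟨ρ, C.state, μ, s, D, h, hC⟩

theorem DeterministicallyTagged.intro {S : Finset Qubit} {P : Proc}
    (h : LocallyDeterministic S P)
    (h' : ∀ P', Successor S P P' → DeterministicallyTagged S P') :
    DeterministicallyTagged S P := by
  intro P'' hP
  rcases hP.cases_head with rfl | ⟨P', h1, h2⟩
  · exact h
  · exact h' P' h1 P'' h2

/-- With disjoint tags the scheduler reveals which component contributes which action, hence which
rule was applied. The only scheduler without tags is `halt`, which moves nothing. -/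
theorem LocallyDeterministic.par {S : Finset Qubit} {P Q : Proc} (hP : LocallyDeterministic S P)
    (hQ : LocallyDeterministic S Q) (hd : Disjoint P.tags Q.tags) :
    LocallyDeterministic S (.par P Q) := by
  have dis : ∀ {s : Sched}, s.tags ⊆ P.tags → s.tags ⊆ Q.tags → s = .halt := by
    intro s h1 h2
    rcases s with _ | t | ⟨t, u⟩
    · rfl
    · exact absurd (h2 (Finset.mem_singleton_self t))
        (Finset.disjoint_left.1 hd (h1 (Finset.mem_singleton_self t)))
    · exact absurd (h2 (Finset.mem_insert_self t _))
        (Finset.disjoint_left.1 hd (h1 (Finset.mem_insert_self t _)))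
  have dis2 : ∀ {t : Tag}, t ∈ P.tags → t ∈ Q.tags → False := fun h1 h2 =>
    Finset.disjoint_left.1 hd h1 h2
  intro ρ
  constructor
  · intro μ s D D' h h'
    rcases h.premise with ⟨D1, h1, -, rfl⟩ | ⟨D1, h1, -, rfl⟩ |
        ⟨P1, Q1, c, v, t, u, h1, h2, rfl, rfl, rfl⟩ | ⟨P1, Q1, c, v, t, u, h1, h2, rfl, rfl, rfl⟩ <;>
    rcases h'.premise with ⟨D2, h3, -, rfl⟩ | ⟨D2, h3, -, rfl⟩ |
        ⟨P2, Q2, c', v', t', u', h3, h4, e1, e2, rfl⟩ |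
        ⟨P2, Q2, c', v', t', u', h3, h4, e1, e2, rfl⟩
    · rw [(hP ρ).1 _ _ _ _ h1 h3]
    · rw [dis h1.sched_tags h3.sched_tags] at h1
      exact absurd h1 Step.not_halt
    · subst e2
      exact (dis2 (h1.sched_tags (by simp [Sched.tags] : u' ∈ _))
        (h4.sched_tags (by simp [Sched.tags]))).elim
    · subst e2
      exact (dis2 (h1.sched_tags (by simp [Sched.tags] : t' ∈ _))
        (h3.sched_tags (by simp [Sched.tags]))).elim
    · rw [dis h3.sched_tags h1.sched_tags] at h1
      exact absurd h1 Step.not_halt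
    · rw [(hQ ρ).1 _ _ _ _ h1 h3]
    · subst e2
      exact (dis2 (h3.sched_tags (by simp [Sched.tags] : t' ∈ _))
        (h1.sched_tags (by simp [Sched.tags]))).elim
    · subst e2
      exact (dis2 (h4.sched_tags (by simp [Sched.tags] : u' ∈ _))
        (h1.sched_tags (by simp [Sched.tags]))).elim
    · exact (dis2 (h3.sched_tags (by simp [Sched.tags] : u ∈ _))
        (h2.sched_tags (by simp [Sched.tags]))).elim
    · exact (dis2 (h1.sched_tags (by simp [Sched.tags] : t ∈ _))
        (h3.sched_tags (by simp [Sched.tags]))).elim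
    · cases e2
      -- The first tag fixes the channel and the value of the output; the matching input then has a
      -- determined action, so both residuals are determined.
      obtain ⟨rfl, rfl⟩ := (hP ρ).2 _ _ _ _ _ _ _ h1 h3
      have e3 := (hP ρ).1 _ _ _ _ h1 h3
      have e4 := (hQ ρ).1 _ _ _ _ h2 h4
      have e5 := congrArg Conf.proc (point_weights_ne_zero.1 (e3 ▸ point_weights_ne_zero.2 rfl :
        (point (⟨ρ, P2⟩ : Conf S)).weights ⟨ρ, P1⟩ ≠ 0))
      have e6 := congrArg Conf.proc (point_weights_ne_zero.1 (e4 ▸ point_weights_ne_zero.2 rfl :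
        (point (⟨ρ, Q2⟩ : Conf S)).weights ⟨ρ, Q1⟩ ≠ 0))
      simp only at e5 e6
      rw [e5, e6]
    · cases e2
      exact (dis2 (h1.sched_tags (by simp [Sched.tags] : t ∈ _))
        (h3.sched_tags (by simp [Sched.tags]))).elim
    · exact (dis2 (h3.sched_tags (by simp [Sched.tags] : t ∈ _))
        (h1.sched_tags (by simp [Sched.tags]))).elim
    · exact (dis2 (h2.sched_tags (by simp [Sched.tags] : u ∈ _))
        (h3.sched_tags (by simp [Sched.tags]))).elim
    · cases e2
      exact (dis2 (h3.sched_tags (by simp [Sched.tags] : t ∈ _))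
        (h1.sched_tags (by simp [Sched.tags]))).elim
    · cases e2
      obtain ⟨rfl, rfl⟩ := (hQ ρ).2 _ _ _ _ _ _ _ h1 h3
      have e3 := (hQ ρ).1 _ _ _ _ h1 h3
      have e4 := (hP ρ).1 _ _ _ _ h2 h4
      have e5 := congrArg Conf.proc (point_weights_ne_zero.1 (e3 ▸ point_weights_ne_zero.2 rfl :
        (point (⟨ρ, Q2⟩ : Conf S)).weights ⟨ρ, Q1⟩ ≠ 0))
      have e6 := congrArg Conf.proc (point_weights_ne_zero.1 (e4 ▸ point_weights_ne_zero.2 rfl :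
        (point (⟨ρ, P2⟩ : Conf S)).weights ⟨ρ, P1⟩ ≠ 0))
      simp only at e5 e6
      rw [e5, e6]
  · intro s c v c' v' D D' h h'
    rcases h.premise with ⟨D1, h1, -, -⟩ | ⟨D1, h1, -, -⟩ |
        ⟨_, _, _, _, _, _, _, _, e, _⟩ | ⟨_, _, _, _, _, _, _, _, e, _⟩ <;>
    rcases h'.premise with ⟨D2, h3, -, -⟩ | ⟨D2, h3, -, -⟩ |
        ⟨_, _, _, _, _, _, _, _, e, _⟩ | ⟨_, _, _, _, _, _, _, _, e, _⟩ <;> try cases e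
    · exact (hP ρ).2 _ _ _ _ _ _ _ h1 h3
    · rw [dis h1.sched_tags h3.sched_tags] at h1
      exact absurd h1 Step.not_halt
    · rw [dis h3.sched_tags h1.sched_tags] at h1
      exact absurd h1 Step.not_halt
    · exact (hQ ρ).2 _ _ _ _ _ _ _ h1 h3

/-- Residuals use no new tags, so all processes reachable from the composition are compositions of
components with disjoint tags. -/
theorem DeterministicallyTagged.par {S : Finset Qubit} {P Q : Proc}
    (hP : DeterministicallyTagged S P) (hQ : DeterministicallyTagged S Q)
    (hd : Disjoint P.tags Q.tags) : DeterministicallyTagged S (.par P Q) := by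
  have key : ∀ R, Relation.ReflTransGen (Successor S) (.par P Q) R → ∃ P' Q', R = .par P' Q' ∧
      DeterministicallyTagged S P' ∧ DeterministicallyTagged S Q' ∧
      Disjoint P'.tags Q'.tags := by
    intro R hR
    induction hR with
    | refl => exact ⟨P, Q, rfl, hP, hQ, hd⟩
    | tail _ h ih =>
      obtain ⟨P', Q', rfl, hP', hQ', hd'⟩ := ih
      obtain ⟨ρ, ρ', μ, s, D, hD, hC⟩ := h
      rcases hD.premise with ⟨D1, h1, -, rfl⟩ | ⟨D1, h1, -, rfl⟩ |
        ⟨P1, Q1, c, v, t, u, h1, h2, rfl, rfl, rfl⟩ | ⟨P1, Q1, c, v, t, u, h1, h2, rfl, rfl, rfl⟩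
      · obtain ⟨C', hC', e⟩ := map_weights_ne_zero.1 hC
        cases e
        exact ⟨_, _, rfl, hP'.step h1 hC', hQ', hd'.mono_left (h1.tags_subset hC')⟩
      · obtain ⟨C', hC', e⟩ := map_weights_ne_zero.1 hC
        cases e
        exact ⟨_, _, rfl, hP', hQ'.step h1 hC', hd'.mono_right (h1.tags_subset hC')⟩
      · cases point_weights_ne_zero.1 hC
        have hp1 := point_weights_ne_zero.2 (rfl : (⟨ρ, P1⟩ : Conf S) = _)
        have hq1 := point_weights_ne_zero.2 (rfl : (⟨ρ, Q1⟩ : Conf S) = _)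
        exact ⟨_, _, rfl, hP'.step h1 hp1, hQ'.step h2 hq1,
          hd'.mono (h1.tags_subset hp1) (h2.tags_subset hq1)⟩
      · cases point_weights_ne_zero.1 hC
        have hp1 := point_weights_ne_zero.2 (rfl : (⟨ρ, P1⟩ : Conf S) = _)
        have hq1 := point_weights_ne_zero.2 (rfl : (⟨ρ, Q1⟩ : Conf S) = _)
        exact ⟨_, _, rfl, hP'.step h2 hp1, hQ'.step h1 hq1,
          hd'.mono (h2.tags_subset hp1) (h1.tags_subset hq1)⟩
  intro R hR
  obtain ⟨P', Q', rfl, hP', hQ', hd'⟩ := key R hR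
  exact hP'.locally.par hQ'.locally hd'

theorem DeterministicallyTagged.nil (S : Finset Qubit) (es : List Expr) :
    DeterministicallyTagged S (.nil es) :=
  .intro (fun _ => ⟨fun _ _ _ _ h => h.premise.elim, fun _ _ _ _ _ _ _ h => h.premise.elim⟩)
    fun _ ⟨_, _, _, _, _, h, _⟩ => h.premise.elim

theorem DeterministicallyTagged.tau {S : Finset Qubit} {t : Tag} {P : Proc}
    (hP : DeterministicallyTagged S P) : DeterministicallyTagged S (.tau t P) := by
  refine .intro (fun ρ => ⟨fun μ s D D' h h' => ?_, fun s c v c' v' D D' h h' => ?_⟩) ?_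
  · rw [h.premise.2.2, h'.premise.2.2]
  · exact nomatch h.premise.1
  · rintro P' ⟨ρ, ρ', μ, s, D, h, hC⟩
    rw [h.premise.2.2] at hC
    cases point_weights_ne_zero.1 hC
    exact hP

theorem DeterministicallyTagged.send {S : Finset Qubit} {t : Tag} {c : Chan} {e : Expr} {P : Proc}
    (hP : DeterministicallyTagged S P) : DeterministicallyTagged S (.send t c e P) := by
  refine .intro (fun ρ => ⟨fun μ s D D' h h' => ?_, fun s c v c' v' D D' h h' => ?_⟩) ?_
  · obtain ⟨v, -, -, -, rfl⟩ := h.premise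
    obtain ⟨v', -, -, -, rfl⟩ := h'.premise
    rfl
  · obtain ⟨w, h1, h2, -⟩ := h.premise
    obtain ⟨w', h3, h4, -⟩ := h'.premise
    cases h2
    cases h4
    exact ⟨rfl, h1.unique h3⟩
  · rintro P' ⟨ρ, ρ', μ, s, D, h, hC⟩
    obtain ⟨v, -, -, -, rfl⟩ := h.premise
    cases point_weights_ne_zero.1 hC
    exact hP

theorem DeterministicallyTagged.recv {S : Finset Qubit} {t : Tag} {c : Chan} {x : Var} {P : Proc}
    (hP : ∀ v, v.ty = c.ty → DeterministicallyTagged S (P.subst x v)) :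
    DeterministicallyTagged S (.recv t c x P) := by
  refine .intro (fun ρ => ⟨fun μ s D D' h h' => ?_, fun s c v c' v' D D' h h' => ?_⟩) ?_
  · obtain ⟨v, -, -, -, rfl, -, rfl⟩ := h.premise
    obtain ⟨v', -, -, -, e, -, rfl⟩ := h'.premise
    cases e
    rfl
  · obtain ⟨w, -, -, -, h2, -⟩ := h.premise
    cases h2
  · rintro P' ⟨ρ, ρ', μ, s, D, h, hC⟩
    obtain ⟨v, hv, -, -, -, -, rfl⟩ := h.premise
    cases point_weights_ne_zero.1 hC
    exact hP v hv

theorem DeterministicallyTagged.ite {S : Finset Qubit} {e : Expr} {P Q : Proc}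
    (hP : e.Eval (.bool true) → DeterministicallyTagged S P)
    (hQ : e.Eval (.bool false) → DeterministicallyTagged S Q) :
    DeterministicallyTagged S (.ite e P Q) := by
  refine .intro (fun ρ => ⟨fun μ s D D' h h' => ?_, fun s c v c' v' D D' h h' => ?_⟩) ?_
  · rcases h.premise with ⟨he, h⟩ | ⟨he, h⟩ <;> rcases h'.premise with ⟨he', h'⟩ | ⟨he', h'⟩
    · exact ((hP he).locally ρ).1 _ _ _ _ h h'
    · cases he.unique he'
    · cases he.unique he'
    · exact ((hQ he).locally ρ).1 _ _ _ _ h h'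
  · rcases h.premise with ⟨he, h⟩ | ⟨he, h⟩ <;> rcases h'.premise with ⟨he', h'⟩ | ⟨he', h'⟩
    · exact ((hP he).locally ρ).2 _ _ _ _ _ _ _ h h'
    · cases he.unique he'
    · cases he.unique he'
    · exact ((hQ he).locally ρ).2 _ _ _ _ _ _ _ h h'
  · rintro P' ⟨ρ, ρ', μ, s, D, h, hC⟩
    rcases h.premise with ⟨he, h⟩ | ⟨he, h⟩
    · exact (hP he).step h hC
    · exact (hQ he).step h hC

theorem DeterministicallyTagged.meas {S : Finset Qubit} {n k : ℕ} {t : Tag} {M : Measurement n k}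
    {e : Fin n → Expr} {y : Var} {P : Proc}
    (hP : ∀ m : Fin k, DeterministicallyTagged S (P.subst y (.nat m))) :
    DeterministicallyTagged S (.meas t M e y P) := by
  refine .intro (fun ρ => ⟨fun μ s D D' h h' => ?_, fun s c v c' v' D D' h h' => ?_⟩) ?_
  · obtain ⟨q, rfl, -, -, rfl⟩ := h.premise
    obtain ⟨q', e, -, -, rfl⟩ := h'.premise
    have : q = q' := by
      ext i
      have := congrFun e i
      simpa using this
    rw [this]
  · obtain ⟨q, rfl, h, -⟩ := h.premise
    cases h
  · rintro P' ⟨ρ, ρ', μ, s, D, h, hC⟩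
    obtain ⟨q, rfl, -, -, rfl⟩ := h.premise
    obtain ⟨m, -, e⟩ := map_weights_ne_zero.1 hC
    cases e
    exact hP m

/-! ### Local operators -/

/-- Contractions that act on qubits outside `U`. -/
def IsLocal {S : Finset Qubit} (U : Finset Qubit) (K : Op S) : Prop :=
  ∃ (n : ℕ) (q : Fin n ↪ S) (L : Op (Fin n)), (∀ i, (q i : Qubit) ∉ U) ∧
    (1 - L.conjTranspose * L).PosSemidef ∧ K = embed q L

theorem IsLocal.mono {S U V : Finset Qubit} {K : Op S} (h : IsLocal V K) (hUV : U ⊆ V) :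
    IsLocal U K := by
  obtain ⟨n, q, L, h1, h2, h3⟩ := h
  exact ⟨n, q, L, fun i hi => h1 i (hUV hi), h2, h3⟩

theorem isLocal_one {S : Finset Qubit} (U : Finset Qubit) : IsLocal U (1 : Op S) :=
  ⟨0, ⟨Fin.elim0, fun i => i.elim0⟩, 1, fun i => i.elim0, by simpa using Matrix.PosSemidef.zero,
    (embed_one _).symm⟩

theorem contraction_of_sum_eq_one {ι : Type} [Fintype ι] [DecidableEq ι] {r : ℕ}
    {K : Fin r → Op ι} (h : ∑ i, (K i).conjTranspose * K i = 1) (j : Fin r) :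
    (1 - (K j).conjTranspose * K j).PosSemidef := by
  rw [← h, ← Finset.add_sum_erase _ _ (Finset.mem_univ j), add_sub_cancel_left]
  exact Matrix.posSemidef_sum _ fun i _ => Matrix.posSemidef_conjTranspose_mul_self _

/-- This includes trace zero: a positive semidefinite operator of trace zero vanishes, so the
fallback state never matters. -/
theorem normalize_smul {κ : Type} [Fintype κ] [DecidableEq κ] (ρ : Density κ) {A : Op κ}
    (hA : A.PosSemidef) : A.trace.re • (normalize ρ A).1 = A := by
  have him : (A.trace.re : ℂ) = A.trace := by
    have := (Complex.le_def.1 hA.trace_nonneg).2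
    apply Complex.ext
    · simp
    · simpa using this
  by_cases h : A.trace = 0
  · rw [h, hA.trace_eq_zero_iff.1 h]
    simp
  · rw [normalize, dif_pos ⟨hA, h⟩, ← Complex.coe_smul, him, smul_smul, mul_inv_cancel₀ h,
      one_smul]

theorem trace_re_ne_zero {κ : Type} [Fintype κ] [DecidableEq κ] {A : Op κ}
    (hA : A.PosSemidef) (h : A ≠ 0) : A.trace.re ≠ 0 := by
  intro h0
  refine h (hA.trace_eq_zero_iff.1 ?_)
  apply Complex.ext
  · simpa using h0
  · simpa using (Complex.le_def.1 hA.trace_nonneg).2.symm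

/-! ### The vector of a distribution -/

/-- Families of operators indexed by processes. -/
abbrev OpVec (S : Finset Qubit) : Type := Proc →₀ Op S

section Vec

variable {S : Finset Qubit}

/-- The quantum state of a configuration, indexed by its process. -/
noncomputable def Conf.vec (C : Conf S) : OpVec S := Finsupp.single C.proc C.state.1

/-- The vector of a distribution of configurations. -/
noncomputable def fvec (D : FDist (Conf S)) : OpVec S := expect Conf.vec D

/-- The vector of a distribution of configurations and `⊥`. -/
noncomputable def vec (D : CDist S) : OpVec S := expect (fun C => C.elim 0 Conf.vec) D

theorem fvec_point (C : Conf S) : fvec (point C) = C.vec := expect_point _ _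

theorem fvec_map (D : FDist (Conf S)) (g : Proc → Proc) :
    fvec (D.map fun C => ⟨C.state, g C.proc⟩) =
      Finsupp.lmapDomain (Op S) ℝ g (fvec D) := by
  rw [fvec, expect_map, fvec, map_expect]
  refine expect_congr fun C _ => ?_
  rw [Finsupp.lmapDomain_apply, Conf.vec, Conf.vec, Finsupp.mapDomain_single]

theorem vec_map_some (D : FDist (Conf S)) : vec (D.map some) = fvec D := expect_map _ _ _

theorem vec_point_none : vec (point (none : Option (Conf S))) = 0 := expect_point _ _

/-- Conjugation by an operator. -/
noncomputable def conjOp (K : Op S) : Op S →ₗ[ℝ] Op S where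
  toFun ρ := K * ρ * K.conjTranspose
  map_add' ρ σ := by rw [mul_add, add_mul]
  map_smul' r ρ := by rw [mul_smul_comm, smul_mul_assoc]; rfl

theorem conjOp_apply (K ρ : Op S) : conjOp K ρ = K * ρ * K.conjTranspose := rfl

theorem conjOp_posSemidef (K : Op S) {ρ : Op S} (h : ρ.PosSemidef) : (conjOp K ρ).PosSemidef :=
  h.mul_mul_conjTranspose_same K

/-- Conjugation by an operator, applied to all the quantum states. -/
noncomputable def conjVec (K : Op S) : OpVec S →ₗ[ℝ] OpVec S :=
  Finsupp.mapRange.linearMap (conjOp K)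

theorem conjVec_single (K : Op S) (P : Proc) (A : Op S) :
    conjVec K (Finsupp.single P A) = Finsupp.single P (conjOp K A) := by
  simp [conjVec]

/-- The sum of the quantum states. -/
noncomputable def totalState : OpVec S →ₗ[ℝ] Op S := Finsupp.lsum ℝ fun _ => LinearMap.id

theorem totalState_single (P : Proc) (A : Op S) : totalState (Finsupp.single P A) = A := by
  simp [totalState]

/-- The real part of the trace. -/
noncomputable def reTrace : Op S →ₗ[ℝ] ℝ where
  toFun ρ := ρ.trace.re
  map_add' ρ σ := by rw [Matrix.trace_add, Complex.add_re]
  map_smul' r ρ := by rw [Matrix.trace_smul, Complex.smul_re]; rfl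

theorem reTrace_apply (ρ : Op S) : reTrace ρ = ρ.trace.re := rfl

/-- The total mass. -/
noncomputable def massVec : OpVec S →ₗ[ℝ] ℝ := reTrace ∘ₗ totalState

theorem massVec_single (P : Proc) (A : Op S) : massVec (Finsupp.single P A) = A.trace.re := by
  rw [massVec, LinearMap.comp_apply, totalState_single, reTrace_apply]

theorem quantumState_eq (D : CDist S) : quantumState D = totalState (vec D) := by
  rw [vec, map_expect]
  refine Finset.sum_congr rfl fun C _ => ?_
  cases C with
  | none => simp
  | some C => simp [Conf.vec, totalState_single]

/-- States have trace one and `⊥` has vector zero, so the total trace is the probability of not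
being in `⊥`. -/
theorem mass_eq (D : CDist S) : mass D = massVec (vec D) := by
  have h1 : massVec (vec D) = expect (fun C => C.elim (0 : ℝ) fun _ => 1) D := by
    rw [vec, map_expect]
    refine expect_congr fun C _ => ?_
    cases C with
    | none => simp
    | some C => simp [Conf.vec, massVec_single, C.state.2.2]
  have h2 : expect (fun C => C.elim (1 : ℝ) fun _ => 0) D = D.weights none := by
    rw [expect, Finsupp.sum, Finset.sum_eq_single none]
    · simp
    · intro C _ hC
      cases C with
      | none => exact absurd rfl hC
      | some C => simp
    · intro h
      simpa using h
  have h3 : expect (fun C => C.elim (0 : ℝ) fun _ => 1) D +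
      expect (fun C => C.elim (1 : ℝ) fun _ => 0) D = 1 := by
    refine Eq.trans ?_ (expect_const (1 : ℝ) D)
    rw [expect, expect, expect, Finsupp.sum, Finsupp.sum, Finsupp.sum,
      ← Finset.sum_add_distrib]
    refine Finset.sum_congr rfl fun C _ => ?_
    cases C <;> simp
  rw [mass, h1]
  linarith

theorem vec_eq_zero {D : CDist S} (h : ∀ C : Conf S, D.weights (some C) = 0) : vec D = 0 := by
  have : vec D = expect (fun _ => (0 : OpVec S)) D := by
    refine expect_congr fun C hC => ?_
    cases C with
    | none => rfl
    | some C => exact absurd (h C) hC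
  rw [this, expect_const]

theorem mass_ne_zero {D : CDist S} {C : Conf S} (h : D.weights (some C) ≠ 0) : mass D ≠ 0 := by
  classical
  intro h0
  have ht := D.total
  rw [mass] at h0
  have h1 : none ∈ D.weights.support := by
    rw [Finsupp.mem_support_iff]
    intro h1
    rw [h1] at h0
    norm_num at h0
  rw [Finsupp.sum, ← Finset.add_sum_erase _ _ h1] at ht
  have h2 : (∑ x ∈ D.weights.support.erase none, D.weights x) = 0 := by linarith
  exact h ((Finset.sum_eq_zero_iff_of_nonneg fun b _ => D.nonneg b).1 h2 (some C)
    (Finset.mem_erase.2 ⟨by simp, Finsupp.mem_support_iff.2 h⟩))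

/-! ### Transitions as linear maps -/

/-- Probabilities cancel the normalisation of the branches; what remains is linear in the state. -/
theorem fvec_meas {n k : ℕ} (M : Measurement n k) (q : Fin n ↪ S) (ρ : Density S)
    (R : Fin k → Proc) :
    fvec ((M.outcome q ρ).map fun m => ⟨normalize ρ (M.branch q ρ m), R m⟩) =
      ∑ m, Finsupp.single (R m) (conjOp (embed q (M.op m)) ρ.1) := by
  rw [fvec, expect_map, expect, Finsupp.sum_fintype _ _ (by simp)]
  refine Finset.sum_congr rfl fun m _ => ?_
  have h : (M.outcome q ρ).weights m = (M.branch q ρ m).trace.re := rfl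
  rw [h, Conf.vec, Finsupp.smul_single]
  exact congrArg (Finsupp.single (R m))
    (normalize_smul ρ (ρ.2.1.mul_mul_conjTranspose_same (embed q (M.op m))))

theorem TPSuperop.exists_kraus {n : ℕ} (E : TPSuperop n) : ∃ (r : ℕ) (K : Fin r → Op (Fin n)),
    ∑ i, (K i).conjTranspose * K i = 1 ∧ ∀ (q : Fin n ↪ S) (ρ : Density S),
      (E.act q ρ).1 = ∑ i, conjOp (embed q (K i)) ρ.1 := by
  obtain ⟨E, r, K, hK, rfl⟩ := E
  exact ⟨r, K, hK, fun q ρ => applyAt_krausMap q K ρ.1⟩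

theorem qubits_mem {Γ : Finset Name} {n : ℕ} {l : Fin n → Name} {q : Fin n ↪ S}
    (h : (fun i => Expr.val (.qubit (q i))) = fun i => (l i).toExpr) (hl : ∀ i, l i ∈ Γ)
    (i : Fin n) : Name.qubit (q i) ∈ Γ := by
  rw [← Name.toExpr_eq_qubit (congrFun h i).symm]
  exact hl i

/-- A transition is available in all quantum states, and its result depends linearly on the
state, by means of operators acting on the qubits of the process. -/
theorem Step.uniform {ρ : Density S} {P : Proc} {μ : Act} {s : Sched} {D : FDist (Conf S)}
    (h : Step ρ P μ s D) : ∃ (r : ℕ) (K : Fin r → Op S) (R : Fin r → Proc),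
      (∀ Γ U, Typed Γ P → (∀ u ∈ U, Name.qubit u ∉ Γ) → ∀ j, IsLocal U (K j)) ∧
      ∀ σ : Density S, ∃ D', Step σ P μ s D' ∧
        fvec D' = ∑ j, Finsupp.single (R j) (conjOp (K j) σ.1) ∧
        ∀ j, conjOp (K j) σ.1 ≠ 0 → ∃ σ', D'.weights ⟨σ', R j⟩ ≠ 0 := by
  -- Transitions that leave the state unchanged: a single Kraus operator, the identity.
  have pure : ∀ {P P' : Proc} {μ : Act} {s : Sched},
      (∀ σ : Density S, Step σ P μ s (point ⟨σ, P'⟩)) →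
      ∃ (r : ℕ) (K : Fin r → Op S) (R : Fin r → Proc),
      (∀ Γ U, Typed Γ P → (∀ u ∈ U, Name.qubit u ∉ Γ) → ∀ j, IsLocal U (K j)) ∧
      ∀ σ : Density S, ∃ D', Step σ P μ s D' ∧
        fvec D' = ∑ j, Finsupp.single (R j) (conjOp (K j) σ.1) ∧
        ∀ j, conjOp (K j) σ.1 ≠ 0 → ∃ σ', D'.weights ⟨σ', R j⟩ ≠ 0 := by
    intro P P' μ s h
    refine ⟨1, fun _ => 1, fun _ => P', fun _ U _ _ _ => isLocal_one U, fun σ =>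
      ⟨_, h σ, ?_, fun _ _ => ⟨σ, point_weights_ne_zero.2 rfl⟩⟩⟩
    rw [fvec_point, Finset.sum_const, Finset.card_univ, Fintype.card_fin, one_smul, conjOp_apply,
      one_mul, Matrix.conjTranspose_one, mul_one, Conf.vec]
  induction h with
  | iteT _ he ih =>
    obtain ⟨r, K, R, h1, h2⟩ := ih
    refine ⟨r, K, R, fun Γ U hP => h1 Γ U hP.premise.2.1, fun σ => ?_⟩
    obtain ⟨D', h3, h4⟩ := h2 σ
    exact ⟨D', .iteT h3 he, h4⟩
  | iteF _ he ih =>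
    obtain ⟨r, K, R, h1, h2⟩ := ih
    refine ⟨r, K, R, fun Γ U hP => h1 Γ U hP.premise.2.2, fun σ => ?_⟩
    obtain ⟨D', h3, h4⟩ := h2 σ
    exact ⟨D', .iteF h3 he, h4⟩
  | tau => exact pure fun σ => .tau
  | tauPair => exact pure fun σ => .tauPair
  | send he => exact pure fun σ => .send he
  | recv h1 h2 h3 => exact pure fun σ => .recv h1 h2 h3
  | @res c _ _ _ _ _ ha ih =>
    obtain ⟨r, K, R, h1, h2⟩ := ih
    refine ⟨r, K, fun j => .res (R j) c, fun Γ U hP => h1 Γ U hP.premise, fun σ => ?_⟩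
    obtain ⟨D', h3, h4, h5⟩ := h2 σ
    refine ⟨_, .res h3 ha, ?_, fun j hj => ?_⟩
    · rw [fvec_map D' fun P => .res P c, h4, map_sum]
      simp only [Finsupp.lmapDomain_apply, Finsupp.mapDomain_single]
    · obtain ⟨σ', hσ'⟩ := h5 j hj
      exact ⟨σ', map_weights_ne_zero.2 ⟨_, hσ', rfl⟩⟩
  | @op t n E q P =>
    obtain ⟨r, K, hK, hE⟩ := E.exists_kraus (S := S)
    refine ⟨r, fun j => embed q (K j), fun _ => P, fun Γ U hP hU j => ?_, fun σ =>
      ⟨_, .op q, ?_, fun j _ => ⟨_, point_weights_ne_zero.2 rfl⟩⟩⟩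
    · obtain ⟨l, hl, -, -, hm, -⟩ := hP.premise
      exact ⟨n, q, K j, fun i hi => hU _ hi (qubits_mem hl hm i),
        contraction_of_sum_eq_one hK j, rfl⟩
    · rw [fvec_point, Conf.vec, hE, Finsupp.single_finsetSum]
  | @meas t n k M q y P =>
    refine ⟨k, fun m => embed q (M.op m), fun m => P.subst y (.nat m), fun Γ U hP hU j => ?_,
      fun σ => ⟨_, .meas q, fvec_meas M q σ _, fun m hm => ⟨_, map_weights_ne_zero.2
        ⟨m, ?_, rfl⟩⟩⟩⟩
    · obtain ⟨l, hl, -, hm, -⟩ := hP.premise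
      exact ⟨n, q, M.op j, fun i hi => hU _ hi (qubits_mem hl hm i),
        contraction_of_sum_eq_one M.complete j, rfl⟩
    · exact trace_re_ne_zero (conjOp_posSemidef _ σ.2.1) hm
  | @parL P Q _ _ _ _ hf ih =>
    obtain ⟨r, K, R, h1, h2⟩ := ih
    refine ⟨r, K, fun j => .par (R j) Q, fun Γ U hP hU => ?_, fun σ => ?_⟩
    · obtain ⟨Γ1, Γ2, rfl, -, h, -⟩ := hP.premise
      exact h1 Γ1 U h fun u hu hu' => hU u hu (Finset.mem_union_left _ hu')
    obtain ⟨D', h3, h4, h5⟩ := h2 σ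
    refine ⟨_, .parL h3 hf, ?_, fun j hj => ?_⟩
    · rw [fvec_map D' fun P => .par P Q, h4, map_sum]
      simp only [Finsupp.lmapDomain_apply, Finsupp.mapDomain_single]
    · obtain ⟨σ', hσ'⟩ := h5 j hj
      exact ⟨σ', map_weights_ne_zero.2 ⟨_, hσ', rfl⟩⟩
  | @parR P Q _ _ _ _ hf ih =>
    obtain ⟨r, K, R, h1, h2⟩ := ih
    refine ⟨r, K, fun j => .par P (R j), fun Γ U hP hU => ?_, fun σ => ?_⟩
    · obtain ⟨Γ1, Γ2, rfl, -, -, h⟩ := hP.premise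
      exact h1 Γ2 U h fun u hu hu' => hU u hu (Finset.mem_union_right _ hu')
    obtain ⟨D', h3, h4, h5⟩ := h2 σ
    refine ⟨_, .parR h3 hf, ?_, fun j hj => ?_⟩
    · rw [fvec_map D' fun Q => .par P Q, h4, map_sum]
      simp only [Finsupp.lmapDomain_apply, Finsupp.mapDomain_single]
    · obtain ⟨σ', hσ'⟩ := h5 j hj
      exact ⟨σ', map_weights_ne_zero.2 ⟨_, hσ', rfl⟩⟩
  | sumL _ ih =>
    obtain ⟨r, K, R, h1, h2⟩ := ih
    refine ⟨r, K, R, fun Γ U hP => h1 Γ U hP.premise.1, fun σ => ?_⟩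
    obtain ⟨D', h3, h4⟩ := h2 σ
    exact ⟨D', .sumL h3, h4⟩
  | sumR _ ih =>
    obtain ⟨r, K, R, h1, h2⟩ := ih
    refine ⟨r, K, R, fun Γ U hP => h1 Γ U hP.premise.2, fun σ => ?_⟩
    obtain ⟨D', h3, h4⟩ := h2 σ
    exact ⟨D', .sumR h3, h4⟩
  | synchL h1 h2 =>
    exact pure fun σ => .synchL (h1.change_state trivial σ) (h2.change_state trivial σ)
  | synchR h1 h2 =>
    exact pure fun σ => .synchR (h1.change_state trivial σ) (h2.change_state trivial σ)

/-- The linear map `L` describes the transitions of `P` with the given labels. -/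
def Represents (μ : Act) (s : Sched) (P : Proc) (L : Op S →ₗ[ℝ] OpVec S) : Prop :=
  ∀ ρ : Density S, ∃ D, Step ρ P μ s D ∧ fvec D = L ρ.1

open Classical in
/-- The linear map describing the transitions of a process; it is zero if there are none. -/
noncomputable def stepMap (μ : Act) (s : Sched) (P : Proc) : Op S →ₗ[ℝ] OpVec S :=
  if h : ∃ L, Represents (S := S) μ s P L then h.choose else 0

/-- The transitions as a linear map. -/
noncomputable def transMap (μ : Act) (s : Sched) : OpVec S →ₗ[ℝ] OpVec S :=
  Finsupp.lsum ℝ (stepMap μ s)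

theorem Step.exists_represents {ρ : Density S} {P : Proc} {μ : Act} {s : Sched}
    {D : FDist (Conf S)} (h : Step ρ P μ s D) : ∃ L, Represents (S := S) μ s P L := by
  obtain ⟨r, K, R, -, h2⟩ := h.uniform
  refine ⟨∑ j, Finsupp.lsingle (R j) ∘ₗ conjOp (K j), fun σ => ?_⟩
  obtain ⟨D', h3, h4, -⟩ := h2 σ
  exact ⟨D', h3, by simpa [LinearMap.sum_apply] using h4⟩

/-- The chosen linear map takes, at each state, the value given by some transition; local
determinism identifies it with the given one. -/
theorem transMap_of_step {ρ : Density S} {P : Proc} {μ : Act} {s : Sched} {D : FDist (Conf S)}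
    (hP : LocallyDeterministic S P) (h : Step ρ P μ s D) :
    transMap μ s (Finsupp.single P ρ.1) = fvec D := by
  have hL := h.exists_represents
  rw [transMap, Finsupp.lsum_single, stepMap, dif_pos hL]
  obtain ⟨D', h1, h2⟩ := hL.choose_spec ρ
  rw [← h2, (hP ρ).1 _ _ _ _ h h1]

/-- A representing map would provide a transition in every state, in particular in this one, so
`stepMap` falls back to zero. -/
theorem transMap_of_not_step {ρ : Density S} {P : Proc} {μ : Act} {s : Sched}
    (h : ¬ ∃ D, Step ρ P μ s D) : transMap μ s (Finsupp.single P ρ.1) = 0 := by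
  rw [transMap, Finsupp.lsum_single, stepMap, dif_neg, LinearMap.zero_apply]
  rintro ⟨L, hL⟩
  obtain ⟨D, h1, -⟩ := hL ρ
  exact h ⟨D, h1⟩

/-- The default value zero of the transition map is exactly the vector of the move to `⊥`. -/
theorem BotStep.vec_eq {C : Option (Conf S)} {μ : Act} {s : Sched} {E : CDist S}
    (hC : ∀ C', C = some C' → LocallyDeterministic S C'.proc) (h : BotStep C μ s E) :
    vec E = transMap μ s (C.elim 0 Conf.vec) := by
  cases h with
  | step h => rw [vec_map_some]; exact (transMap_of_step (hC _ rfl) h).symm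
  | stuck h => rw [vec_point_none]; exact (transMap_of_not_step h).symm
  | bot => rw [vec_point_none, Option.elim_none, map_zero]

/-- The transitions of a deterministically tagged distribution are given by a linear map. -/
theorem Trans.vec_eq {D E : CDist S} {μ : Act} {δ : FDist Sched} (h : Trans D μ δ E)
    (hD : Deterministic D) : vec E = expect (transMap μ) δ (vec D) := by
  rw [vec, vec, map_expect]
  refine h.expect_eq fun C hC F hF => ?_
  rw [hF.expect_eq (g := fun s => transMap μ s (C.elim 0 Conf.vec))]
  · exact (map_expect (LinearMap.applyₗ (C.elim 0 Conf.vec : OpVec S)) (transMap μ) δ).symm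
  · intro s _ G hG
    refine hG.vec_eq ?_
    rintro C rfl
    exact (hD C hC).locally

theorem Trans.vec_eq_point {D E : CDist S} {μ : Act} {s : Sched} (h : Trans D μ (point s) E)
    (hD : Deterministic D) : vec E = transMap μ s (vec D) := by
  rw [h.vec_eq hD, expect_point]

/-- Unavailable moves lead to `⊥`, so a matching transition always exists in the bisimulation games.
-/
theorem Trans.total (D : CDist S) (μ : Act) (δ : FDist Sched) : ∃ E, Trans D μ δ E := by
  refine Lift.total (fun C => Lift.total (fun s => ?_) δ) D
  cases C with
  | none => exact ⟨_, .bot⟩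
  | some C =>
    by_cases h : ∃ E, Step C.state C.proc μ s E
    · obtain ⟨E, hE⟩ := h
      exact ⟨_, .step hE⟩
    · exact ⟨_, .stuck h⟩

theorem Trans.exists_step {D E : CDist S} {μ : Act} {δ : FDist Sched} (h : Trans D μ δ E)
    {C : Conf S} (hC : E.weights (some C) ≠ 0) : ∃ (C' : Conf S) (s : Sched) (F : FDist (Conf S)),
      D.weights (some C') ≠ 0 ∧ Step C'.state C'.proc μ s F ∧ F.weights C ≠ 0 := by
  obtain ⟨C', F, h1, h2, h3⟩ := h.exists_of_weights_ne_zero hC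
  obtain ⟨s, G, -, h4, h5⟩ := h2.exists_of_weights_ne_zero h3
  cases h4 with
  | step h =>
    obtain ⟨C'', hC'', e⟩ := map_weights_ne_zero.1 h5
    cases e
    exact ⟨_, s, _, h1, h, hC''⟩
  | stuck h => exact nomatch point_weights_ne_zero.1 h5
  | bot => exact nomatch point_weights_ne_zero.1 h5

theorem Trans.deterministic {D E : CDist S} {μ : Act} {δ : FDist Sched} (h : Trans D μ δ E)
    (hD : Deterministic D) : Deterministic E := by
  intro C hC
  obtain ⟨C', s, F, h1, h2, h3⟩ := h.exists_step hC
  exact (hD C' h1).step h2 h3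

theorem Trans.hasType {D E : CDist S} {μ : Act} {δ : FDist Sched} (h : Trans D μ δ E)
    {U : Finset Qubit} (hD : HasType U D) : HasType (μ.after U) E := by
  intro C hC
  obtain ⟨C', s, F, h1, h2, h3⟩ := h.exists_step hC
  obtain ⟨hU, hC'⟩ := hD C' h1
  refine ⟨?_, h2.owns hC' h3⟩
  have ha := h2.admissible hC'
  rcases μ with _ | ⟨c, _ | _ | q⟩ | ⟨c, _ | _ | q⟩
  · exact hU
  · exact hU
  · exact hU
  · exact (Finset.erase_subset _ _).trans hU
  · exact hU
  · exact hU
  · exact Finset.insert_subset (ha.2 q rfl).1 hU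

end Vec

/-! ### Ownership of qubits along transitions -/

section After

variable {S U V : Finset Qubit} {μ : Act} {c : Chan} {v : Val}

theorem mem_image_qubit {q : Qubit} : Name.qubit q ∈ U.image Name.qubit ↔ q ∈ U := by simp

/-- When the component owning `U` acts, the share `V \ U` of the other component is untouched;
freshness excludes the reception of a qubit from that share. -/
theorem Act.after_left (hUV : U ⊆ V) (h : μ.Admissible S (U.image .qubit))
    (hf : ∀ c q, μ = .inp c (.qubit q) → q ∉ V \ U) :
    μ.after U ⊆ μ.after V ∧ μ.after V \ μ.after U = V \ U := by
  rcases μ with _ | ⟨c, _ | _ | q⟩ | ⟨c, _ | _ | q⟩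
  iterate 3 exact ⟨hUV, rfl⟩
  · have hq : q ∈ U := mem_image_qubit.1 (h.2 q rfl)
    simp only [Act.after]
    exact ⟨Finset.erase_subset_erase _ hUV, by grind⟩
  iterate 2 exact ⟨hUV, rfl⟩
  · have hq := hf c q rfl
    have hq' : q ∉ U := fun h' => (h.2 q rfl).2 (mem_image_qubit.2 h')
    simp only [Act.after]
    exact ⟨Finset.insert_subset_insert _ hUV, by grind⟩

theorem Act.after_right (hUV : U ⊆ V) (h : μ.Admissible S ((V \ U).image .qubit))
    (hf : ∀ c q, μ = .inp c (.qubit q) → q ∉ U) :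
    U ⊆ μ.after V ∧ μ.after V \ U = μ.after (V \ U) := by
  rcases μ with _ | ⟨c, _ | _ | q⟩ | ⟨c, _ | _ | q⟩
  iterate 3 exact ⟨hUV, rfl⟩
  · have hq : q ∈ V \ U := mem_image_qubit.1 (h.2 q rfl)
    simp only [Act.after]
    constructor <;> grind
  iterate 2 exact ⟨hUV, rfl⟩
  · have hq := hf c q rfl
    simp only [Act.after]
    constructor <;> grind

theorem Act.after_synch_left (hUV : U ⊆ V) (h : (Act.out c v).Admissible S (U.image .qubit)) :
    (Act.out c v).after U ⊆ V ∧ V \ (Act.out c v).after U = (Act.inp c v).after (V \ U) := by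
  rcases v with _ | _ | q
  iterate 2 exact ⟨hUV, rfl⟩
  have hq : q ∈ U := mem_image_qubit.1 (h.2 q rfl)
  simp only [Act.after]
  constructor <;> grind

theorem Act.after_synch_right (hUV : U ⊆ V)
    (h : (Act.out c v).Admissible S ((V \ U).image .qubit)) :
    (Act.inp c v).after U ⊆ V ∧ V \ (Act.inp c v).after U = (Act.out c v).after (V \ U) := by
  rcases v with _ | _ | q
  iterate 2 exact ⟨hUV, rfl⟩
  have hq : q ∈ V \ U := mem_image_qubit.1 (h.2 q rfl)
  simp only [Act.after]
  constructor <;> grind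

theorem Act.fresh_iff {P : Proc} (hP : Owns U P) :
    μ.Fresh P ↔ ∀ c q, μ = .inp c (.qubit q) → q ∉ U := by
  rcases μ with _ | ⟨c, _⟩ | ⟨c, _ | _ | q⟩
  iterate 4 exact ⟨fun _ _ _ h => (nomatch h), fun _ => trivial⟩
  rw [hP.fresh_iff]
  constructor
  · rintro h _ _ ⟨⟩
    exact h
  · exact fun h => h c q rfl

end After

/-! ### Tests -/

section Test

variable {S : Finset Qubit}

/-- The observations of processes using the qubits in `U`: the mass, after some labelled
transitions and some operations on the other qubits. -/
inductive IsTest : Finset Qubit → (OpVec S →ₗ[ℝ] ℝ) → Prop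
  | mass (U : Finset Qubit) : IsTest U massVec
  | conj {U : Finset Qubit} {φ : OpVec S →ₗ[ℝ] ℝ} {K : Op S} :
      IsLocal U K → IsTest U φ → IsTest U (φ ∘ₗ conjVec K)
  | act {U : Finset Qubit} {φ : OpVec S →ₗ[ℝ] ℝ} (μ : Act) (s : Sched) :
      IsTest (μ.after U) φ → IsTest U (φ ∘ₗ transMap μ s)

/-- The vectors on which all tests vanish. -/
def Null (U : Finset Qubit) (Z : OpVec S) : Prop := ∀ φ, IsTest U φ → φ Z = 0

theorem Null.conj {U : Finset Qubit} {Z : OpVec S} (h : Null U Z) {K : Op S} (hK : IsLocal U K) :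
    Null U (conjVec K Z) :=
  fun _ hφ => h _ (.conj hK hφ)

theorem Null.act {U : Finset Qubit} {Z : OpVec S} (h : Null U Z) (μ : Act) (s : Sched) :
    Null (μ.after U) (transMap μ s Z) :=
  fun _ hφ => h _ (.act μ s hφ)

theorem Null.expect {A : Type} {U : Finset Qubit} {f : A → OpVec S} (D : FDist A)
    (h : ∀ a, Null U (f a)) : Null U (expect f D) := by
  intro φ hφ
  rw [map_expect]
  exact (expect_congr fun a _ => h a φ hφ).trans (expect_const 0 D)

/-- The context `[·] ∥ Q` applied to a vector. -/
noncomputable def plugVec (Q : Proc) : OpVec S →ₗ[ℝ] OpVec S :=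
  Finsupp.lmapDomain (Op S) ℝ fun P => .par P Q

theorem plugVec_single (Q P : Proc) (A : Op S) :
    plugVec Q (Finsupp.single P A) = Finsupp.single (.par P Q) A := by
  simp [plugVec]

theorem vec_plug (Q : Proc) (D : CDist S) : vec (plug Q D) = plugVec Q (vec D) := by
  rw [plug, vec, expect_map, vec, map_expect]
  refine expect_congr fun C _ => ?_
  cases C with
  | none => exact (map_zero _).symm
  | some C => exact (plugVec_single _ _ _).symm

theorem massVec_plugVec (Q : Proc) (Z : OpVec S) : massVec (plugVec Q Z) = massVec Z := by
  have : massVec ∘ₗ plugVec (S := S) Q = massVec :=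
    Finsupp.lhom_ext fun P A => by
      rw [LinearMap.comp_apply, plugVec_single, massVec_single, massVec_single]
  exact LinearMap.congr_fun this Z

theorem conjVec_plugVec (K : Op S) (Q : Proc) (Z : OpVec S) :
    conjVec K (plugVec Q Z) = plugVec Q (conjVec K Z) := by
  have : conjVec K ∘ₗ plugVec (S := S) Q = plugVec Q ∘ₗ conjVec K :=
    Finsupp.lhom_ext fun P A => by
      simp only [LinearMap.comp_apply, plugVec_single, conjVec_single]
  exact LinearMap.congr_fun this Z

/-- The vectors spanned by the quantum states of processes in `G`. -/
noncomputable def procSpan (S : Finset Qubit) (G : Set Proc) : Submodule ℝ (OpVec S) :=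
  Submodule.span ℝ {X : OpVec S | ∃ (ρ : Density S) (P : Proc), P ∈ G ∧
    X = Finsupp.single P ρ.1}

theorem single_mem_procSpan {G : Set Proc} (ρ : Density S) {P : Proc} (hP : P ∈ G) :
    Finsupp.single P ρ.1 ∈ procSpan S G :=
  Submodule.subset_span ⟨ρ, P, hP, rfl⟩

theorem fvec_mem_procSpan {G : Set Proc} {D : FDist (Conf S)}
    (h : ∀ C, D.weights C ≠ 0 → C.proc ∈ G) : fvec D ∈ procSpan S G :=
  expect_mem fun C hC => single_mem_procSpan C.state (h C hC)

theorem vec_mem_procSpan {G : Set Proc} {D : CDist S}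
    (h : ∀ C : Conf S, D.weights (some C) ≠ 0 → C.proc ∈ G) : vec D ∈ procSpan S G :=
  expect_mem fun C hC => by
    cases C with
    | none => exact zero_mem _
    | some C => exact single_mem_procSpan C.state (h C hC)

/-- Scaled quantum states belong to the span. -/
theorem single_posSemidef_mem {G : Set Proc} (ρ : Density S) {A : Op S} (hA : A.PosSemidef)
    {P : Proc} (hP : A ≠ 0 → P ∈ G) : Finsupp.single P A ∈ procSpan S G := by
  by_cases h : A = 0
  · rw [h, Finsupp.single_zero]
    exact zero_mem _
  · rw [← normalize_smul ρ hA, ← Finsupp.smul_single]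
    exact Submodule.smul_mem _ _ (single_mem_procSpan _ (hP h))

/-- Linear statements about vectors reduce to single processes in normalised states, where the
operational rules apply. -/
theorem map_mem_of_procSpan {M : Type} [AddCommGroup M] [Module ℝ M] {G : Set Proc}
    {W : Submodule ℝ M} {L : OpVec S →ₗ[ℝ] M}
    (h : ∀ (ρ : Density S), ∀ P ∈ G, L (Finsupp.single P ρ.1) ∈ W) {Z : OpVec S}
    (hZ : Z ∈ procSpan S G) : L Z ∈ W := by
  have : procSpan S G ≤ W.comap L := Submodule.span_le.2 fun _ ⟨ρ, P, hP, e⟩ => by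
    rw [e]
    exact h ρ P hP
  exact this hZ

theorem eq_of_procSpan {M : Type} [AddCommGroup M] [Module ℝ M] {G : Set Proc}
    {L L' : OpVec S →ₗ[ℝ] M}
    (h : ∀ (ρ : Density S), ∀ P ∈ G, L (Finsupp.single P ρ.1) = L' (Finsupp.single P ρ.1))
    {Z : OpVec S} (hZ : Z ∈ procSpan S G) : L Z = L' Z := by
  have := map_mem_of_procSpan (W := ⊥) (L := L - L') (fun ρ P hP => by
    rw [Submodule.mem_bot, LinearMap.sub_apply, h ρ P hP, sub_self]) hZ
  rwa [Submodule.mem_bot, LinearMap.sub_apply, sub_eq_zero] at this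

theorem transMap_mem_procSpan {G G' : Set Proc} {μ : Act} {s : Sched}
    (hG : ∀ P ∈ G, LocallyDeterministic S P)
    (h : ∀ (ρ : Density S), ∀ P ∈ G, ∀ D, Step ρ P μ s D → ∀ C, D.weights C ≠ 0 → C.proc ∈ G')
    {Z : OpVec S} (hZ : Z ∈ procSpan S G) : transMap μ s Z ∈ procSpan S G' := by
  refine map_mem_of_procSpan (fun ρ P hP => ?_) hZ
  by_cases hs : ∃ D, Step ρ P μ s D
  · obtain ⟨D, hD⟩ := hs
    rw [transMap_of_step (hG P hP) hD]
    exact fvec_mem_procSpan (h ρ P hP D hD)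
  · rw [transMap_of_not_step hs]
    exact zero_mem _

/-! ### Transitions of parallel compositions -/

/-- The processes using the qubits in `U` that can be composed with `Q`. -/
def Composable (S U : Finset Qubit) (Q : Proc) : Set Proc :=
  {P | Owns U P ∧ DeterministicallyTagged S P ∧ DeterministicallyTagged S (.par P Q)}

/-- The first component can move. -/
def MoveLeft (Q : Proc) (μ : Act) (s : Sched) (ρ : Density S) (P : Proc) : Prop :=
  ∃ D, Step ρ P μ s D ∧ μ.Fresh Q

/-- The second component can move. -/
def MoveRight (Q : Proc) (μ : Act) (s : Sched) (ρ : Density S) (P : Proc) : Prop :=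
  ∃ D, Step ρ Q μ s D ∧ μ.Fresh P

/-- The first component can send `v` on `c` to the second one. -/
def SynchLeft (Q : Proc) (μ : Act) (s : Sched) (c : Chan) (v : Val) (ρ : Density S) (P : Proc) :
    Prop :=
  ∃ t u P' Q', μ = .tau ∧ s = .pair t u ∧ Step ρ P (.out c v) (.tag t) (point ⟨ρ, P'⟩) ∧
    Step ρ Q (.inp c v) (.tag u) (point ⟨ρ, Q'⟩)

/-- The second component can send a value to the first one. -/
def SynchRight (Q : Proc) (μ : Act) (s : Sched) (ρ : Density S) (P : Proc) : Prop :=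
  ∃ c v t u P' Q', μ = .tau ∧ s = .pair t u ∧ Step ρ Q (.out c v) (.tag t) (point ⟨ρ, Q'⟩) ∧
    Step ρ P (.inp c v) (.tag u) (point ⟨ρ, P'⟩)

/-! ### Mutual exclusion of the ways in which a parallel composition moves. -/

section Exclusive

variable {P Q : Proc} {μ : Act} {s : Sched} {ρ : Density S}

theorem MoveLeft.result (h : MoveLeft Q μ s ρ P) : ∃ (D : FDist (Conf S)) (P' : Proc) (σ : _),
    Step ρ (.par P Q) μ s D ∧ D.weights ⟨σ, .par P' Q⟩ ≠ 0 ∧ P'.size < P.size := by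
  obtain ⟨D, h, hf⟩ := h
  obtain ⟨C, hC⟩ := D.support_weights_nonempty
  rw [Finsupp.mem_support_iff] at hC
  exact ⟨_, C.proc, C.state, .parL h hf, map_weights_ne_zero.2 ⟨C, hC, rfl⟩, h.size_lt hC⟩

theorem MoveRight.result (h : MoveRight Q μ s ρ P) : ∃ D : FDist (Conf S),
    Step ρ (.par P Q) μ s D ∧ ∀ C, D.weights C ≠ 0 → ∃ Q', C.proc = .par P Q' ∧
      Q'.size < Q.size := by
  obtain ⟨D, h, hf⟩ := h
  refine ⟨_, .parR h hf, fun C hC => ?_⟩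
  obtain ⟨C', hC', rfl⟩ := map_weights_ne_zero.1 hC
  exact ⟨_, rfl, h.size_lt hC'⟩

theorem SynchLeft.result {c : Chan} {v : Val} (h : SynchLeft Q μ s c v ρ P) : ∃ P' Q',
    Step ρ (.par P Q) μ s (point ⟨ρ, .par P' Q'⟩) ∧ P'.size < P.size ∧ Q'.size < Q.size := by
  obtain ⟨t, u, P', Q', rfl, rfl, h1, h2⟩ := h
  exact ⟨P', Q', .synchL h1 h2, h1.size_lt (point_weights_ne_zero.2 rfl),
    h2.size_lt (point_weights_ne_zero.2 rfl)⟩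

theorem SynchRight.result (h : SynchRight Q μ s ρ P) : ∃ P' Q',
    Step ρ (.par P Q) μ s (point ⟨ρ, .par P' Q'⟩) ∧ P'.size < P.size ∧ Q'.size < Q.size := by
  obtain ⟨c, v, t, u, P', Q', rfl, rfl, h1, h2⟩ := h
  exact ⟨P', Q', .synchR h1 h2, h2.size_lt (point_weights_ne_zero.2 rfl),
    h1.size_lt (point_weights_ne_zero.2 rfl)⟩

/-- Determinism would equate the two outcomes, but one keeps `Q` and shrinks `P` while the other
keeps `P`. -/
theorem LocallyDeterministic.moveLeft_moveRight (hd : LocallyDeterministic S (.par P Q))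
    (h : MoveLeft Q μ s ρ P) (h' : MoveRight Q μ s ρ P) : False := by
  obtain ⟨D, P', σ, h1, h2, h3⟩ := h.result
  obtain ⟨D', h4, h5⟩ := h'.result
  rw [(hd ρ).1 _ _ _ _ h1 h4] at h2
  obtain ⟨Q', e, h6⟩ := h5 _ h2
  cases e
  omega

theorem LocallyDeterministic.moveLeft_point (hd : LocallyDeterministic S (.par P Q))
    (h : MoveLeft Q μ s ρ P) {P' Q' : Proc} (h' : Step ρ (.par P Q) μ s (point ⟨ρ, .par P' Q'⟩))
    (hQ : Q'.size < Q.size) : False := by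
  obtain ⟨D, P1, σ, h1, h2, h3⟩ := h.result
  rw [(hd ρ).1 _ _ _ _ h1 h'] at h2
  cases point_weights_ne_zero.1 h2
  omega

theorem LocallyDeterministic.moveRight_point (hd : LocallyDeterministic S (.par P Q))
    (h : MoveRight Q μ s ρ P) {P' Q' : Proc} (h' : Step ρ (.par P Q) μ s (point ⟨ρ, .par P' Q'⟩))
    (hP : P'.size < P.size) : False := by
  obtain ⟨D, h1, h2⟩ := h.result
  rw [(hd ρ).1 _ _ _ _ h1 h'] at h2
  obtain ⟨Q1, e, -⟩ := h2 _ (point_weights_ne_zero.2 rfl)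
  cases e
  omega

/-- In both directions the first tag of the pair selects an output, once of `P` and once of `Q`.
Both are outputs of the composition under a single tag, so they would coincide, although only one of
them changes `P`. -/
theorem LocallyDeterministic.synch_synch (hd : LocallyDeterministic S (.par P Q)) {c : Chan}
    {v : Val} (h : SynchLeft Q μ s c v ρ P) (h' : SynchRight Q μ s ρ P) : False := by
  obtain ⟨t, u, P', Q', rfl, rfl, h1, -⟩ := h
  obtain ⟨c', v', t', u', P'', Q'', -, e, h3, -⟩ := h'
  cases e
  have h5 := Step.parL (Q := Q) h1 trivial
  have h6 := Step.parR (P := P) h3 trivial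
  obtain ⟨rfl, rfl⟩ := (hd ρ).2 _ _ _ _ _ _ _ h5 h6
  have h7 := (hd ρ).1 _ _ _ _ h5 h6
  rw [Convexity.StdSimplex.map_single, Convexity.StdSimplex.map_single] at h7
  have h8 : (point (⟨ρ, .par P Q''⟩ : Conf S)).weights ⟨ρ, .par P' Q⟩ ≠ 0 := fun h0 =>
    point_weights_ne_zero.2 rfl
      ((congrArg (fun D => D.weights (⟨ρ, .par P' Q⟩ : Conf S)) h7).trans h0)
  cases point_weights_ne_zero.1 h8
  have := h1.size_lt (point_weights_ne_zero.2 rfl)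
  simp only [lt_irrefl] at this

theorem Step.par_cases {D : FDist (Conf S)} (h : Step ρ (.par P Q) μ s D) :
    MoveLeft Q μ s ρ P ∨ MoveRight Q μ s ρ P ∨ (∃ c v, SynchLeft Q μ s c v ρ P) ∨
      SynchRight Q μ s ρ P := by
  rcases h.premise with ⟨D1, h1, h2, -⟩ | ⟨D1, h1, h2, -⟩ |
        ⟨P1, Q1, c, v, t, u, h1, h2, e1, e2, -⟩ | ⟨P1, Q1, c, v, t, u, h1, h2, e1, e2, -⟩
  · exact .inl ⟨D1, h1, h2⟩
  · exact .inr (.inl ⟨D1, h1, h2⟩)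
  · exact .inr (.inr (.inl ⟨c, v, t, u, P1, Q1, e1, e2, h1, h2⟩))
  · exact .inr (.inr (.inr ⟨c, v, t, u, P1, Q1, e1, e2, h1, h2⟩))

end Exclusive

/-- The linear map `G` accounts for the transitions of the compositions with `Q` that are of the
given kind, and maps null vectors to vectors that are not detected by `φ`. -/
def IsPart (U : Finset Qubit) (Q : Proc) (μ : Act) (s : Sched) (φ : OpVec S →ₗ[ℝ] ℝ)
    (kind : Density S → Proc → Prop) (G : OpVec S →ₗ[ℝ] OpVec S) : Prop :=
  (∀ (ρ : Density S), ∀ P ∈ Composable S U Q,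
    (kind ρ P → G (Finsupp.single P ρ.1) = transMap μ s (Finsupp.single (.par P Q) ρ.1)) ∧
    (¬ kind ρ P → G (Finsupp.single P ρ.1) = 0)) ∧
  ∀ Z ∈ procSpan S (Composable S U Q), Null U Z → φ (G Z) = 0

/-- `φ` vanishes on the compositions of null vectors with processes. -/
def Congruent (V : Finset Qubit) (φ : OpVec S →ₗ[ℝ] ℝ) : Prop :=
  ∀ U Q Z, U ⊆ V → Owns (V \ U) Q → Z ∈ procSpan S (Composable S U Q) → Null U Z →
    φ (plugVec Q Z) = 0

/-! ### Decomposition of the transitions of a composition into linear parts. -/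

section Parts

variable {U V : Finset Qubit} {Q : Proc} {μ : Act} {s : Sched} {φ : OpVec S →ₗ[ℝ] ℝ}

theorem isPart_zero {kind : Density S → Proc → Prop}
    (h : ¬ ∃ ρ : Density S, ∃ P ∈ Composable S U Q, kind ρ P) : IsPart U Q μ s φ kind 0 :=
  ⟨fun ρ P hP => ⟨fun hk => absurd ⟨ρ, P, hP, hk⟩ h, fun _ => rfl⟩,
    fun _ _ _ => by rw [LinearMap.zero_apply, map_zero]⟩

/-- The part is a transition of `P` followed by composition with the unchanged `Q`. If some such
move exists, its action is admissible and fresh, which determines the ownership after it for all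
processes at once. -/
theorem exists_isPart_moveLeft (hUV : U ⊆ V) (hQ : Owns (V \ U) Q)
    (hφ : Congruent (μ.after V) φ) : ∃ G, IsPart U Q μ s φ (MoveLeft Q μ s) G := by
  by_cases hw : ∃ ρ : Density S, ∃ P ∈ Composable S U Q, MoveLeft Q μ s ρ P
  swap
  · exact ⟨0, isPart_zero hw⟩
  obtain ⟨ρ₀, P₀, hP₀, D₀, h₀, hf⟩ := hw
  obtain ⟨h1, h2⟩ := Act.after_left hUV (h₀.admissible hP₀.1) ((Act.fresh_iff hQ).1 hf)
  refine ⟨plugVec Q ∘ₗ transMap μ s, fun ρ P hP => ⟨?_, fun hk => ?_⟩, fun Z hZ hN => ?_⟩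
  · rintro ⟨D, h, -⟩
    rw [LinearMap.comp_apply, transMap_of_step hP.2.1.locally h,
      transMap_of_step hP.2.2.locally (.parL h hf), fvec_map D fun P => .par P Q, plugVec]
  · rw [LinearMap.comp_apply, transMap_of_not_step fun ⟨D, h⟩ => hk ⟨D, h, hf⟩, map_zero]
  · refine hφ (μ.after U) Q _ h1 (by rwa [h2]) ?_ (hN.act μ s)
    refine transMap_mem_procSpan (fun P hP => hP.2.1.locally) (fun ρ P hP D hD C hC => ?_) hZ
    exact ⟨hD.owns hP.1 hC, hP.2.1.step hD hC, hP.2.2.step (.parL hD hf)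
      (C := ⟨C.state, .par C.proc Q⟩) (map_weights_ne_zero.2 ⟨C, hC, rfl⟩)⟩

/-- A move of `Q` is a sum of conjugations by Kraus operators acting outside `U`, each followed by
composition with the corresponding residual of `Q`. These conjugations are permitted in tests of
type `U`. -/
theorem exists_isPart_moveRight (hUV : U ⊆ V) (hQ : Owns (V \ U) Q)
    (hφ : Congruent (μ.after V) φ) : ∃ G, IsPart U Q μ s φ (MoveRight Q μ s) G := by
  by_cases hw : ∃ ρ : Density S, ∃ P ∈ Composable S U Q, MoveRight Q μ s ρ P
  swap
  · exact ⟨0, isPart_zero hw⟩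
  obtain ⟨ρ₀, P₀, hP₀, D₀, h₀, hf⟩ := hw
  rw [Act.fresh_iff hP₀.1] at hf
  obtain ⟨h1, h2⟩ := Act.after_right hUV (h₀.admissible hQ) hf
  have hf' : ∀ P ∈ Composable S U Q, μ.Fresh P := fun P hP => (Act.fresh_iff hP.1).2 hf
  obtain ⟨r, K, R, hK, hR⟩ := h₀.uniform
  replace hK := hK _ U hQ.2 (by simp +contextual)
  refine ⟨∑ j, plugVec (R j) ∘ₗ conjVec (K j), fun ρ P hP => ⟨fun _ => ?_, fun hk => ?_⟩,
    fun Z hZ hN => ?_⟩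
  · obtain ⟨D, hD, hv, -⟩ := hR ρ
    rw [transMap_of_step hP.2.2.locally (.parR hD (hf' P hP)), fvec_map D fun Q => .par P Q, hv,
      map_sum, LinearMap.sum_apply]
    simp only [LinearMap.comp_apply, conjVec_single, plugVec_single, Finsupp.lmapDomain_apply,
      Finsupp.mapDomain_single]
  · obtain ⟨D, hD, -⟩ := hR ρ
    exact absurd ⟨D, hD, hf' P hP⟩ hk
  · rw [LinearMap.sum_apply, map_sum]
    refine Finset.sum_eq_zero fun j _ => ?_
    by_cases hj : ∃ ρ : Density S, conjOp (K j) ρ.1 ≠ 0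
    · refine hφ U (R j) _ h1 ?_ ?_ (hN.conj (hK j))
      · obtain ⟨ρ, hρ⟩ := hj
        obtain ⟨D, hD, -, hC⟩ := hR ρ
        obtain ⟨σ, hσ⟩ := hC j hρ
        rw [h2]
        exact hD.owns hQ hσ
      · refine map_mem_of_procSpan (fun ρ P hP => ?_) hZ
        rw [conjVec_single]
        refine single_posSemidef_mem ρ (conjOp_posSemidef _ ρ.2.1) fun hρ => ⟨hP.1, hP.2.1, ?_⟩
        obtain ⟨D, hD, -, hC⟩ := hR ρ
        obtain ⟨σ, hσ⟩ := hC j hρ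
        exact hP.2.2.step (.parR hD (hf' P hP)) (C := ⟨σ, .par P (R j)⟩)
          (map_weights_ne_zero.2 ⟨_, hσ, rfl⟩)
    -- An operator that annihilates every state gives no evidence that its residual is reachable,
    -- hence no typing for it; but its contribution is zero.
    · push Not at hj
      have : conjVec (K j) Z = (0 : OpVec S →ₗ[ℝ] OpVec S) Z :=
        eq_of_procSpan (fun ρ P _ => by rw [conjVec_single, hj ρ, Finsupp.single_zero]; rfl) hZ
      rw [LinearMap.comp_apply, this, LinearMap.zero_apply, map_zero, map_zero]

/-- The channel and value are fixed because the residual of `Q` depends on what it receives, whereas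
different processes `P` may send different values under one tag. -/
theorem exists_isPart_synchLeft (hUV : U ⊆ V) (hQ : Owns (V \ U) Q)
    (hφ : Congruent (μ.after V) φ) (c : Chan) (v : Val) :
    ∃ G, IsPart U Q μ s φ (SynchLeft Q μ s c v) G := by
  by_cases hw : ∃ ρ : Density S, ∃ P ∈ Composable S U Q, SynchLeft Q μ s c v ρ P
  swap
  · exact ⟨0, isPart_zero hw⟩
  obtain ⟨ρ₀, P₀, hP₀, t, u, P₀', Q', rfl, rfl, h₀, hin⟩ := hw
  obtain ⟨h1, h2⟩ := Act.after_synch_left hUV (h₀.admissible hP₀.1)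
  replace hin := hin.change_state trivial
  refine ⟨plugVec Q' ∘ₗ transMap (.out c v) (.tag t), fun ρ P hP => ⟨?_, fun hk => ?_⟩,
    fun Z hZ hN => ?_⟩
  · rintro ⟨t', u', P', Q'', -, e, h, -⟩
    cases e
    rw [LinearMap.comp_apply, transMap_of_step hP.2.1.locally h,
      transMap_of_step hP.2.2.locally (.synchL h (hin ρ)), fvec_point, fvec_point, Conf.vec,
      plugVec_single, Conf.vec]
  · rw [LinearMap.comp_apply, transMap_of_not_step, map_zero]
    rintro ⟨D, h⟩
    obtain ⟨t', P', -, rfl⟩ := h.exists_point trivial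
    exact hk ⟨t, u, P', Q', rfl, rfl, h, hin ρ⟩
  · refine hφ _ Q' _ h1 ?_ ?_ (hN.act _ _)
    · change Owns (V \ _) Q'
      rw [h2]
      exact (hin ρ₀).owns hQ (point_weights_ne_zero.2 rfl)
    refine transMap_mem_procSpan (fun P hP => hP.2.1.locally) (fun ρ P hP D hD C hC => ?_) hZ
    obtain ⟨t', P', -, rfl⟩ := hD.exists_point trivial
    cases point_weights_ne_zero.1 hC
    exact ⟨hD.owns hP.1 hC, hP.2.1.step hD hC, hP.2.2.step (.synchL hD (hin ρ))
      (C := ⟨ρ, .par P' Q'⟩) (point_weights_ne_zero.2 rfl)⟩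

/-- Here a single part suffices: the tag selects one output of `Q`, so the channel and the value are
the same for all `P`. -/
theorem exists_isPart_synchRight (hUV : U ⊆ V) (hQ : Owns (V \ U) Q)
    (hφ : Congruent (μ.after V) φ) : ∃ G, IsPart U Q μ s φ (SynchRight Q μ s) G := by
  by_cases hw : ∃ ρ : Density S, ∃ P ∈ Composable S U Q, SynchRight Q μ s ρ P
  swap
  · exact ⟨0, isPart_zero hw⟩
  obtain ⟨ρ₀, P₀, hP₀, c, v, t, u, P₀', Q', rfl, rfl, hout, h₀⟩ := hw
  obtain ⟨h1, h2⟩ := Act.after_synch_right hUV (hout.admissible hQ)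
  replace hout := hout.change_state trivial
  refine ⟨plugVec Q' ∘ₗ transMap (.inp c v) (.tag u), fun ρ P hP => ⟨?_, fun hk => ?_⟩,
    fun Z hZ hN => ?_⟩
  · rintro ⟨c', v', t', u', P', Q'', -, e, h', h⟩
    cases e
    obtain ⟨rfl, rfl⟩ := (hP.2.2.locally ρ).2 _ _ _ _ _ _ _
      (.parR (hout ρ) trivial) (.parR h' trivial)
    rw [LinearMap.comp_apply, transMap_of_step hP.2.1.locally h,
      transMap_of_step hP.2.2.locally (.synchR (hout ρ) h), fvec_point, fvec_point, Conf.vec,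
      plugVec_single, Conf.vec]
  · rw [LinearMap.comp_apply, transMap_of_not_step, map_zero]
    rintro ⟨D, h⟩
    obtain ⟨t', P', -, rfl⟩ := h.exists_point trivial
    exact hk ⟨c, v, t, u, P', Q', rfl, rfl, hout ρ, h⟩
  · refine hφ _ Q' _ h1 ?_ ?_ (hN.act _ _)
    · change Owns (V \ _) Q'
      rw [h2]
      exact (hout ρ₀).owns hQ (point_weights_ne_zero.2 rfl)
    refine transMap_mem_procSpan (fun P hP => hP.2.1.locally) (fun ρ P hP D hD C hC => ?_) hZ
    obtain ⟨t', P', -, rfl⟩ := hD.exists_point trivial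
    cases point_weights_ne_zero.1 hC
    exact ⟨hD.owns hP.1 hC, hP.2.1.step hD hC, hP.2.2.step (.synchR (hout ρ) hD)
      (C := ⟨ρ, .par P' Q'⟩) (point_weights_ne_zero.2 rfl)⟩

/-- The transitions of compositions are the sum of the four kinds of transitions. -/
theorem exists_transMap_plugVec {A B E : OpVec S →ₗ[ℝ] OpVec S}
    {C : Chan × Val → OpVec S →ₗ[ℝ] OpVec S}
    (hA : IsPart U Q μ s φ (MoveLeft Q μ s) A) (hB : IsPart U Q μ s φ (MoveRight Q μ s) B)
    (hC : ∀ l, IsPart U Q μ s φ (SynchLeft Q μ s l.1 l.2) (C l))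
    (hE : IsPart U Q μ s φ (SynchRight Q μ s) E) {Z : OpVec S}
    (hZ : Z ∈ procSpan S (Composable S U Q)) : ∃ F₀ : Finset (Chan × Val), ∀ F, F₀ ⊆ F →
      transMap μ s (plugVec Q Z) = A Z + B Z + ∑ l ∈ F, C l Z + E Z := by
  classical
  induction hZ using Submodule.span_induction with
  | zero => exact ⟨∅, fun F _ => by simp⟩
  | add X Y _ _ hX hY =>
    obtain ⟨F₁, h₁⟩ := hX
    obtain ⟨F₂, h₂⟩ := hY
    -- Infinitely many values could be exchanged, but each vector involves finitely many. Validity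
    -- for every larger finite set is what allows two vectors to share an index set.
    refine ⟨F₁ ∪ F₂, fun F hF => ?_⟩
    simp only [map_add, Finset.sum_add_distrib]
    rw [h₁ F (Finset.union_subset_left hF), h₂ F (Finset.union_subset_right hF)]
    abel
  | smul r X _ hX =>
    obtain ⟨F₀, h⟩ := hX
    refine ⟨F₀, fun F hF => ?_⟩
    simp only [map_smul, ← Finset.smul_sum]
    rw [h F hF]
    simp only [smul_add]
  | mem X hX =>
    obtain ⟨ρ, P, hP, rfl⟩ := hX
    have hd := hP.2.2.locally
    obtain ⟨a1, a2⟩ := hA.1 ρ P hP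
    obtain ⟨b1, b2⟩ := hB.1 ρ P hP
    obtain ⟨e1, e2⟩ := hE.1 ρ P hP
    rw [plugVec_single]
    by_cases hc : ∃ l : Chan × Val, SynchLeft Q μ s l.1 l.2 ρ P
    · obtain ⟨l, hl⟩ := hc
      refine ⟨{l}, fun F hF => ?_⟩
      obtain ⟨P', Q', h1, h2, h3⟩ := hl.result
      rw [a2 fun h => hd.moveLeft_point h h1 h3, b2 fun h => hd.moveRight_point h h1 h2,
        e2 fun h => hd.synch_synch hl h, Finset.sum_eq_single l, ((hC l).1 ρ P hP).1 hl]
      · simp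
      · intro l' _ hl'
        refine ((hC l').1 ρ P hP).2 fun h => hl' ?_
        obtain ⟨t, u, _, _, -, e, h4, -⟩ := hl
        obtain ⟨t', u', _, _, -, e', h5, -⟩ := h
        rw [e] at e'
        cases e'
        -- One tag of `P` selects one output, so at most one summand is nonzero.
        obtain ⟨e1, e2⟩ := (hP.2.1.locally ρ).2 _ _ _ _ _ _ _ h5 h4
        exact Prod.ext e1 e2
      · exact fun h => absurd (hF (Finset.mem_singleton_self l)) h
    · refine ⟨∅, fun F _ => ?_⟩
      rw [Finset.sum_eq_zero fun l _ => ((hC l).1 ρ P hP).2 fun h => hc ⟨l, h⟩, add_zero]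
      by_cases ha : MoveLeft Q μ s ρ P
      · rw [a1 ha, b2 fun h => hd.moveLeft_moveRight ha h, e2 fun h => ?_, add_zero, add_zero]
        obtain ⟨P', Q', h1, h2, h3⟩ := h.result
        exact hd.moveLeft_point ha h1 h3
      by_cases hb : MoveRight Q μ s ρ P
      · rw [a2 ha, b1 hb, e2 fun h => ?_, zero_add, add_zero]
        obtain ⟨P', Q', h1, h2, h3⟩ := h.result
        exact hd.moveRight_point hb h1 h2
      by_cases he : SynchRight Q μ s ρ P
      · rw [a2 ha, b2 hb, e1 he, zero_add, zero_add]
      · rw [a2 ha, b2 hb, e2 he, transMap_of_not_step, add_zero, add_zero]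
        rintro ⟨D, h⟩
        rcases h.par_cases with h | h | ⟨c, v, h⟩ | h
        · exact ha h
        · exact hb h
        · exact hc ⟨(c, v), h⟩
        · exact he h

end Parts

/-- Indistinguishability by tests is preserved by parallel composition. -/
theorem IsTest.congruent {V : Finset Qubit} {φ : OpVec S →ₗ[ℝ] ℝ} (hφ : IsTest V φ) :
    Congruent V φ := by
  induction hφ with
  | mass V =>
    intro U Q Z _ _ _ hN
    rw [massVec_plugVec]
    exact hN _ (.mass U)
  | conj hK _ ih =>
    intro U Q Z hUV hQ hZ hN
    rw [LinearMap.comp_apply, conjVec_plugVec]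
    -- An operator avoiding the qubits of the composition also avoids those of its first component,
    -- so the test may apply it before plugging.
    refine ih U Q _ hUV hQ ?_ (hN.conj (hK.mono hUV))
    refine map_mem_of_procSpan (fun ρ P hP => ?_) hZ
    rw [conjVec_single]
    exact single_posSemidef_mem ρ (conjOp_posSemidef _ ρ.2.1) fun _ => hP
  | @act V φ μ s _ ih =>
    intro U Q Z hUV hQ hZ hN
    -- Each kind of transition is undetected by the remaining test, by the induction hypothesis, and
    -- their sum is the transition of the composition.
    obtain ⟨A, hA⟩ := exists_isPart_moveLeft (s := s) hUV hQ ih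
    obtain ⟨B, hB⟩ := exists_isPart_moveRight (s := s) hUV hQ ih
    choose C hC using fun l : Chan × Val => exists_isPart_synchLeft (s := s) hUV hQ ih l.1 l.2
    obtain ⟨E, hE⟩ := exists_isPart_synchRight (s := s) hUV hQ ih
    obtain ⟨F, hF⟩ := exists_transMap_plugVec hA hB hC hE hZ
    rw [LinearMap.comp_apply, hF F subset_rfl, map_add, map_add, map_add, map_sum,
      hA.2 Z hZ hN, hB.2 Z hZ hN, hE.2 Z hZ hN,
      Finset.sum_eq_zero fun l _ => (hC l).2 Z hZ hN, add_zero, add_zero, add_zero]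

theorem Null.plugVec {U V : Finset Qubit} {Q : Proc} {Z : OpVec S} (h : Null U Z) (hUV : U ⊆ V)
    (hQ : Owns (V \ U) Q) (hZ : Z ∈ procSpan S (Composable S U Q)) : Null V (plugVec Q Z) :=
  fun _ hφ => hφ.congruent U Q Z hUV hQ hZ h

end Test

/-! ### Operators on the environment -/

theorem embed_embed {ι κ τ : Type} (q : ι ↪ κ) (r : κ ↪ τ) (K : Op ι) :
    embed r (embed q K) = embed (q.trans r) K := by
  ext a b
  simp only [embed, Matrix.of_apply]
  have h : (∀ k, k ∉ Set.range (q.trans r) → a k = b k) ↔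
      (∀ k, k ∉ Set.range r → a k = b k) ∧ ∀ k, k ∉ Set.range q → (a ∘ r) k = (b ∘ r) k := by
    constructor
    · intro h
      refine ⟨fun k hk => h k fun ⟨i, hi⟩ => hk ⟨q i, hi⟩, fun k hk => h (r k) ?_⟩
      rintro ⟨i, hi⟩
      exact hk ⟨i, r.injective hi⟩
    · rintro ⟨h1, h2⟩ k hk
      by_cases hr : k ∈ Set.range r
      · obtain ⟨j, rfl⟩ := hr
        exact h2 j fun ⟨i, hi⟩ => hk ⟨i, by rw [← hi]; rfl⟩
      · exact h1 k hr
  by_cases h1 : ∀ k, k ∉ Set.range r → a k = b k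
  · by_cases h2 : ∀ k, k ∉ Set.range q → (a ∘ r) k = (b ∘ r) k
    · rw [if_pos h1, if_pos h2, if_pos (h.2 ⟨h1, h2⟩)]
      rfl
    · rw [if_pos h1, if_neg h2, if_neg fun h' => h2 (h.1 h').2]
  · rw [if_neg h1, if_neg fun h' => h1 (h.1 h').1]

theorem embed_refl {ι : Type} (K : Op ι) : embed (Function.Embedding.refl ι) K = K := by
  ext a b
  simp only [embed, Matrix.of_apply]
  exact if_pos fun k hk => absurd ⟨k, rfl⟩ hk

theorem embed_sub {ι κ : Type} (q : ι ↪ κ) (K L : Op ι) : embed q (K - L) = embed q K - embed q L := by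
  ext a b
  simp only [embed, Matrix.of_apply, Matrix.sub_apply]
  split_ifs <;> simp

/-! ### Positivity of operators extended by the identity. -/

section Contraction

variable {ι κ : Type} [Fintype ι] [Fintype κ] [DecidableEq ι] [DecidableEq κ]

theorem exists_conjTranspose_mul_self {A : Op ι} (hA : A.PosSemidef) :
    ∃ B : Op ι, A = B.conjTranspose * B := by
  classical
  open scoped MatrixOrder in
  exact CStarAlgebra.nonneg_iff_eq_star_mul_self.1 hA.nonneg

/-- Extension by the identity is multiplicative and commutes with adjoints, so it preserves the
factorisation of a positive operator as `B†B`. -/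
theorem embed_posSemidef (q : ι ↪ κ) {A : Op ι} (hA : A.PosSemidef) : (embed q A).PosSemidef := by
  obtain ⟨B, rfl⟩ := exists_conjTranspose_mul_self hA
  rw [← embed_mul, ← embed_conjTranspose]
  exact Matrix.posSemidef_conjTranspose_mul_self _

theorem embed_contraction (q : ι ↪ κ) {L : Op ι} (hL : (1 - L.conjTranspose * L).PosSemidef) :
    (1 - (embed q L).conjTranspose * embed q L).PosSemidef := by
  rw [embed_conjTranspose, embed_mul, ← embed_one q, ← embed_sub]
  exact embed_posSemidef q hL

end Contraction

/-! ### Environment operators and the partial trace. -/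

section Environment

variable {S U : Finset Qubit}

/-- An operator on some environment qubits can be padded to all of `S \ U`, and an enumeration of `S
\ U` gives the converse. Tests can thus be compared with the superoperators of labelled
bisimulations. -/
theorem isLocal_iff {K : Op S} : IsLocal U K ↔ ∃ X : Op ↥(S \ U),
    (1 - X.conjTranspose * X).PosSemidef ∧ K = embed (envIncl S U) X := by
  constructor
  · rintro ⟨n, q, L, h1, h2, rfl⟩
    let r : Fin n ↪ ↥(S \ U) :=
      ⟨fun i => ⟨q i, Finset.mem_sdiff.2 ⟨(q i).2, h1 i⟩⟩, fun i j h =>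
        q.injective (Subtype.ext (congrArg (fun k : ↥(S \ U) => k.1) h))⟩
    exact ⟨embed r L, embed_contraction r h2, (embed_embed r (envIncl S U) L).symm⟩
  · rintro ⟨X, h, rfl⟩
    let e := Fintype.equivFin ↥(S \ U)
    refine ⟨_, e.symm.toEmbedding.trans (envIncl S U), embed e.toEmbedding X, fun i =>
      (Finset.mem_sdiff.1 (e.symm i).2).2, embed_contraction _ h, ?_⟩
    have : e.toEmbedding.trans e.symm.toEmbedding = Function.Embedding.refl _ := by
      ext i
      simp
    rw [← embed_embed, embed_embed e.toEmbedding, this, embed_refl]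

theorem joinBits_comp_envIncl (a : ↥(S \ U) → Fin 2) (c : U → Fin 2) :
    joinBits a c ∘ envIncl S U = a := by
  funext i
  simp only [Function.comp_apply, joinBits]
  exact dif_neg (Finset.mem_sdiff.1 i.2).2

/-- Bit strings over `S` as pairs of bit strings over `S \ U` and `U`. -/
def joinBitsEquiv (hU : U ⊆ S) : (↥(S \ U) → Fin 2) × (U → Fin 2) ≃ (S → Fin 2) where
  toFun x := joinBits x.1 x.2
  invFun a := (a ∘ envIncl S U, fun i => a ⟨i, hU i.2⟩)
  left_inv x := by
    refine Prod.ext (joinBits_comp_envIncl _ _) ?_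
    funext i
    exact dif_pos i.2
  right_inv a := by
    funext i
    simp only [joinBits]
    split_ifs
    · rfl
    · rfl

/-- The partial trace is dual to extension by the identity. -/
theorem trace_embed_mul (hU : U ⊆ S) (X : Op ↥(S \ U)) (ρ : Op S) :
    (embed (envIncl S U) X * ρ).trace = (X * partialTrace U ρ).trace := by
  simp only [Matrix.trace, Matrix.diag_apply, embed_mul_apply]
  rw [← (joinBitsEquiv hU).sum_comp, Fintype.sum_prod_type]
  refine Finset.sum_congr rfl fun a _ => ?_
  rw [Matrix.mul_apply]
  simp only [partialTrace, Matrix.of_apply, Finset.mul_sum]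
  rw [Finset.sum_comm]
  refine Finset.sum_congr rfl fun x _ => Finset.sum_congr rfl fun c _ => ?_
  change X (joinBits a c ∘ _) x * ρ (Function.extend _ x (joinBits a c)) (joinBits a c) = _
  rw [joinBits_comp_envIncl]
  congr 2
  funext i
  by_cases hi : (i : Qubit) ∈ U
  · rw [Function.extend_apply']
    · simp only [joinBits, dif_pos hi]
    · rintro ⟨j, hj⟩
      rw [← hj] at hi
      exact (Finset.mem_sdiff.1 j.2).2 hi
  · have : i = envIncl S U ⟨i, Finset.mem_sdiff.2 ⟨i.2, hi⟩⟩ := rfl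
    rw [this, (envIncl S U).injective.extend_apply]
    rw [← this]
    simp only [joinBits, dif_neg hi]

theorem trace_partialTrace (hU : U ⊆ S) (ρ : Op S) : (partialTrace U ρ).trace = ρ.trace := by
  have := trace_embed_mul hU 1 ρ
  rw [embed_one, one_mul, one_mul] at this
  exact this.symm

theorem trace_conjOp_embed (hU : U ⊆ S) (X : Op ↥(S \ U)) (ρ : Op S) :
    (conjOp (embed (envIncl S U) X) ρ).trace =
      (X.conjTranspose * X * partialTrace U ρ).trace := by
  rw [conjOp_apply, Matrix.trace_mul_cycle, embed_conjTranspose, embed_mul, trace_embed_mul hU]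

theorem partialTrace_sub (ρ σ : Op S) :
    partialTrace U (ρ - σ) = partialTrace U ρ - partialTrace U σ := by
  ext a b
  simp [partialTrace, Finset.sum_sub_distrib]

theorem partialTrace_isHermitian {ρ : Op S} (h : ρ.IsHermitian) :
    (partialTrace U ρ).IsHermitian := by
  ext a b
  simp only [partialTrace, Matrix.conjTranspose_apply, Matrix.of_apply, star_sum]
  exact Finset.sum_congr rfl fun c _ => h.apply _ _

/-- A Hermitian operator is determined by its expectation on effects. -/
theorem eq_zero_of_trace_effect {ι : Type} [Fintype ι] [DecidableEq ι] {A : Op ι}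
    (hA : A.IsHermitian)
    (h : ∀ X : Op ι, (1 - X.conjTranspose * X).PosSemidef →
      (X.conjTranspose * X * A).trace.re = 0) : A = 0 := by
  -- The quadratic form of `A` will be shown to vanish on each vector. Positivity is enough, since
  -- the effect `1` gives trace zero, which forces a positive operator to be zero.
  have hpos : A.PosSemidef := by
    refine .of_dotProduct_mulVec_nonneg hA fun v => ?_
    by_cases hv : v = 0
    · simp [hv]
    set r : ℂ := star v ⬝ᵥ v with hr
    have hr0 : r ≠ 0 := fun h0 => hv (dotProduct_star_self_eq_zero.1 h0)
    have hrs : star r = r := by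
      exact Matrix.star_dotProduct v v |>.symm
    -- The orthogonal projection onto the line of `v`: an effect whose trace against `A` is `r⁻¹`
    -- times `⟨v, A v⟩`.
    set X : Op ι := r⁻¹ • Matrix.vecMulVec v (star v) with hX
    have hXh : X.conjTranspose = X := by
      rw [hX, Matrix.conjTranspose_smul, Matrix.conjTranspose_vecMulVec, star_star, star_inv₀, hrs]
    have hXX : X * X = X := by
      rw [hX, Matrix.smul_mul, Matrix.mul_smul, Matrix.vecMulVec_mul_vecMulVec, ← hr,
        Matrix.vecMulVec_smul, smul_smul, smul_smul, mul_assoc, inv_mul_cancel₀ hr0, mul_one]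
    have h1 := h X (by
      have : 1 - X.conjTranspose * X = (1 - X).conjTranspose * (1 - X) := by
        rw [Matrix.conjTranspose_sub, Matrix.conjTranspose_one, hXh, hXX, mul_sub, sub_mul, sub_mul,
          hXX, one_mul, mul_one]
        simp
      rw [this]
      exact Matrix.posSemidef_conjTranspose_mul_self _)
    rw [hXh, hXX, hX, Matrix.smul_mul, Matrix.trace_smul, Matrix.vecMulVec_mul,
      Matrix.trace_vecMulVec, smul_eq_mul] at h1
    have h2 : v ⬝ᵥ Matrix.vecMul (star v) A = star v ⬝ᵥ A.mulVec v := by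
      rw [dotProduct_comm, Matrix.dotProduct_mulVec]
    rw [h2] at h1
    have h3 : (star v ⬝ᵥ A.mulVec v).im = 0 := hA.im_star_dotProduct_mulVec_self v
    have h4 : (r⁻¹).im = 0 := by
      have := congrArg Complex.im hrs
      simp only [RCLike.star_def, Complex.conj_im] at this
      rw [Complex.inv_im, show r.im = 0 by linarith]
      simp
    have h5 : (r⁻¹).re ≠ 0 := fun h0 => inv_ne_zero hr0 (Complex.ext h0 h4)
    rw [Complex.mul_re, h3, mul_zero, sub_zero] at h1
    have h6 : (star v ⬝ᵥ A.mulVec v) = 0 :=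
      Complex.ext ((mul_eq_zero.1 h1).resolve_left h5) h3
    exact h6.ge
  by_contra hne
  refine trace_re_ne_zero hpos hne ?_
  have := h 1 (by simpa using Matrix.PosSemidef.zero)
  simpa using this

theorem totalState_vec_isHermitian (D : CDist S) : (totalState (vec D)).IsHermitian := by
  have : totalState (vec D) ∈ selfAdjoint.submodule ℝ (Op S) := by
    rw [vec, map_expect]
    refine expect_mem fun C _ => ?_
    cases C with
    | none => rw [Option.elim_none, map_zero]; exact zero_mem _
    | some C =>
      rw [Option.elim_some, Conf.vec, totalState_single]
      exact C.state.2.1.isHermitian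
  exact this

theorem totalState_conjVec (K : Op S) (Z : OpVec S) :
    totalState (conjVec K Z) = conjOp K (totalState Z) := by
  have : totalState ∘ₗ conjVec K = conjOp K ∘ₗ totalState := Finsupp.lhom_ext fun P A => by
    simp only [LinearMap.comp_apply, conjVec_single, totalState_single]
  exact LinearMap.congr_fun this Z

theorem massVec_conjVec_embed (hU : U ⊆ S) (X : Op ↥(S \ U)) (Z : OpVec S) :
    massVec (conjVec (embed (envIncl S U) X) Z) =
      (X.conjTranspose * X * partialTrace U (totalState Z)).trace.re := by
  rw [massVec, LinearMap.comp_apply, totalState_conjVec, reTrace_apply, trace_conjOp_embed hU]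

/-- A contraction `X` on the environment followed by the mass measures the effect `X†X` on the
reduced state; all these effects together determine it. -/
theorem Null.partialTrace_eq {D E : CDist S} (hU : U ⊆ S) (h : Null U (vec D - vec E)) :
    partialTrace U (quantumState D) = partialTrace U (quantumState E) := by
  rw [← sub_eq_zero, quantumState_eq, quantumState_eq, ← partialTrace_sub, ← map_sub]
  refine eq_zero_of_trace_effect (partialTrace_isHermitian ?_) fun X hX => ?_
  · rw [map_sub]
    exact (totalState_vec_isHermitian D).sub (totalState_vec_isHermitian E)
  · rw [← massVec_conjVec_embed hU]
    exact h _ (.conj (isLocal_iff.2 ⟨X, hX, rfl⟩) (.mass U))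

/-! ### Superoperators on the environment -/

/-- The action of a superoperator, given by a Kraus decomposition, on the environment. -/
noncomputable def krausVec {r : ℕ} (K : Fin r → Op ↥(S \ U)) : OpVec S →ₗ[ℝ] OpVec S :=
  ∑ i, conjVec (embed (envIncl S U) (K i))

theorem envResult_krausMap {r : ℕ} (K : Fin r → Op ↥(S \ U)) (C : Conf S) :
    envResult U (krausMap K) C = ∑ i, conjOp (embed (envIncl S U) (K i)) C.state.1 :=
  applyAt_krausMap _ _ _

theorem krausVec_vec {r : ℕ} (K : Fin r → Op ↥(S \ U)) (C : Conf S) :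
    krausVec K C.vec = Finsupp.single C.proc (envResult U (krausMap K) C) := by
  rw [envResult_krausMap, Finsupp.single_finsetSum, krausVec, LinearMap.sum_apply]
  simp only [Conf.vec, conjVec_single]

theorem superopProb_eq {r : ℕ} (K : Fin r → Op ↥(S \ U)) (D : CDist S) :
    superopProb U (krausMap K) D = massVec (krausVec K (vec D)) := by
  rw [vec, map_expect, map_expect]
  refine Finsupp.sum_congr fun C _ => ?_
  cases C with
  | none => simp
  | some C =>
    simp only [Option.elim_some, krausVec_vec, massVec_single, smul_eq_mul]

/-- The weights of the conditioned distribution cancel the normalisation of the states, so up to one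
global scalar the operation is linear. -/
theorem vec_superopApply {r : ℕ} {K : Fin r → Op ↥(S \ U)} (hK : IsSuperop (krausMap K))
    {D : CDist S} (hD : superopProb U (krausMap K) D ≠ 0) :
    vec (superopApply U (krausMap K) hK D hD) =
      (mass D / superopProb U (krausMap K) D) • krausVec K (vec D) := by
  have h : ∀ f : Option (Conf S) → OpVec S, expect f (superopApply U (krausMap K) hK D hD) =
      D.weights.sum fun C _ => superopWeight U (krausMap K) D C •
        f (superopConf U (krausMap K) C) := by
    intro f
    rw [expect, superopApply, Finsupp.sum_sum_index (fun a => zero_smul ℝ (f a))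
      (fun _ _ _ => add_smul _ _ _)]
    refine Finsupp.sum_congr fun C _ => ?_
    exact Finsupp.sum_single_index (zero_smul ℝ _)
  rw [vec, h, vec, map_expect, expect, Finsupp.smul_sum]
  refine Finsupp.sum_congr fun C _ => ?_
  cases C with
  | none => simp [superopConf]
  | some C =>
    simp only [superopConf, Option.map_some, Option.elim_some, superopWeight, krausVec_vec]
    rw [Conf.vec, ← normalize_smul C.state (envResult_posSemidef hK C), ← Finsupp.smul_single,
      smul_smul, smul_smul]
    simp only [normalize_smul C.state (envResult_posSemidef hK C)]
    congr 1
    ring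

theorem superopApply_support {F : Op ↥(S \ U) → Op ↥(S \ U)} {hF : IsSuperop F} {D : CDist S}
    {hD : superopProb U F D ≠ 0} {C : Conf S}
    (hC : (superopApply U F hF D hD).weights (some C) ≠ 0) :
    ∃ C' : Conf S, D.weights (some C') ≠ 0 ∧ C.proc = C'.proc := by
  classical
  by_contra! h
  apply hC
  rw [superopApply, Finsupp.sum_apply]
  refine Finset.sum_eq_zero fun C' hC' => ?_
  cases C' with
  | none => simp [superopConf]
  | some C' =>
    refine Finsupp.single_eq_of_ne fun e => ?_
    replace e := e.symm
    simp only [superopConf, Option.map_some, Option.some.injEq] at e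
    exact h C' (Finsupp.mem_support_iff.1 hC') (by rw [← e])

/-- Each Kraus operator is itself a contraction, since dropping the others only increases `1 - ∑
K†K`; every summand is then an operation allowed in tests. -/
theorem Null.kraus {Z : OpVec S} (h : Null U Z) {r : ℕ} {K : Fin r → Op ↥(S \ U)}
    (hK : (1 - ∑ i, (K i).conjTranspose * K i).PosSemidef) : Null U (krausVec K Z) := by
  intro φ hφ
  rw [krausVec, LinearMap.sum_apply, map_sum]
  refine Finset.sum_eq_zero fun j _ => h.conj (isLocal_iff.2 ⟨K j, ?_, rfl⟩) φ hφ
  have : 1 - (K j).conjTranspose * K j = (1 - ∑ i, (K i).conjTranspose * K i) +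
      ∑ i ∈ Finset.univ.erase j, (K i).conjTranspose * K i := by
    rw [← Finset.add_sum_erase _ _ (Finset.mem_univ j)]
    abel
  rw [this]
  exact hK.add (Matrix.posSemidef_sum _ fun i _ => Matrix.posSemidef_conjTranspose_mul_self _)

end Environment

/-! ### Test equivalence -/

section TestEquiv

variable {S : Finset Qubit}

/-- Deterministically tagged distributions of a common type that are identified by all tests. -/
def TestEquiv (D E : CDist S) : Prop :=
  Deterministic D ∧ Deterministic E ∧
    ∃ U, U ⊆ S ∧ HasType U D ∧ HasType U E ∧ Null U (vec D - vec E)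

/-- `HasType` enforces `U ⊆ S` only when there is a live configuration. Otherwise both vectors are
zero and the empty set serves as type. -/
theorem testEquiv_of_null {D E : CDist S} (hD : Deterministic D) (hE : Deterministic E)
    {U : Finset Qubit} (tD : HasType U D) (tE : HasType U E) (h : Null U (vec D - vec E)) :
    TestEquiv D E := by
  refine ⟨hD, hE, ?_⟩
  by_cases hU : U ⊆ S
  · exact ⟨U, hU, tD, tE, h⟩
  · have h1 : ∀ C : Conf S, D.weights (some C) = 0 := fun C => by
      by_contra hC
      exact hU (tD C hC).1
    have h2 : ∀ C : Conf S, E.weights (some C) = 0 := fun C => by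
      by_contra hC
      exact hU (tE C hC).1
    refine ⟨∅, Finset.empty_subset _, fun C hC => absurd (h1 C) hC, fun C hC => absurd (h2 C) hC,
      fun φ _ => ?_⟩
    rw [vec_eq_zero h1, vec_eq_zero h2, sub_zero, map_zero]

theorem Trans.null {D E D' E' : CDist S} {μ : Act} {δ : FDist Sched} {U : Finset Qubit}
    (hD' : Trans D μ δ D') (hE' : Trans E μ δ E') (hD : Deterministic D) (hE : Deterministic E)
    (h : Null U (vec D - vec E)) : Null (μ.after U) (vec D' - vec E') := by
  rw [hD'.vec_eq hD, hE'.vec_eq hE, ← map_sub]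
  have h1 := map_expect (LinearMap.applyₗ (vec D - vec E)) (transMap (S := S) μ) δ
  simp only [LinearMap.applyₗ_apply_apply] at h1
  rw [h1]
  exact .expect δ fun s => h.act μ s

/-- Any answer will do: the successors are images of the two vectors under the same linear map, so
their difference remains null. -/
theorem TestEquiv.trans_left {D E D' : CDist S} {μ : Act} {δ : FDist Sched} {U : Finset Qubit}
    (hD : Deterministic D) (hE : Deterministic E) (tD : HasType U D) (tE : HasType U E)
    (h : Null U (vec D - vec E)) (hD' : Trans D μ δ D') : ∃ E', Trans E μ δ E' ∧ TestEquiv D' E' := by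
  obtain ⟨E', hE'⟩ := Trans.total E μ δ
  exact ⟨E', hE', testEquiv_of_null (hD'.deterministic hD) (hE'.deterministic hE)
    (hD'.hasType tD) (hE'.hasType tE) (hD'.null hE' hD hE h)⟩

theorem TestEquiv.trans_right {D E E' : CDist S} {μ : Act} {δ : FDist Sched} {U : Finset Qubit}
    (hD : Deterministic D) (hE : Deterministic E) (tD : HasType U D) (tE : HasType U E)
    (h : Null U (vec D - vec E)) (hE' : Trans E μ δ E') : ∃ D', Trans D μ δ D' ∧ TestEquiv D' E' := by
  obtain ⟨D', hD'⟩ := Trans.total D μ δ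
  exact ⟨D', hD', testEquiv_of_null (hD'.deterministic hD) (hE'.deterministic hE)
    (hD'.hasType tD) (hE'.hasType tE) (hD'.null hE' hD hE h)⟩

theorem Null.mass_eq {D E : CDist S} {U : Finset Qubit} (h : Null U (vec D - vec E)) :
    mass D = mass E := by
  rw [LqCCS.mass_eq, LqCCS.mass_eq, ← sub_eq_zero, ← map_sub]
  exact h _ (.mass U)

theorem superopApply_deterministic {U : Finset Qubit} {F : Op ↥(S \ U) → Op ↥(S \ U)}
    {hF : IsSuperop F} {D : CDist S} {hp : superopProb U F D ≠ 0} (hD : Deterministic D) :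
    Deterministic (superopApply U F hF D hp) := by
  intro C hC
  obtain ⟨C', hC', e⟩ := superopApply_support hC
  rw [e]
  exact hD C' hC'

theorem superopApply_hasType {U V : Finset Qubit} {F : Op ↥(S \ U) → Op ↥(S \ U)}
    {hF : IsSuperop F} {D : CDist S} {hp : superopProb U F D ≠ 0} (hD : HasType V D) :
    HasType V (superopApply U F hF D hp) := by
  intro C hC
  obtain ⟨C', hC', e⟩ := superopApply_support hC
  rw [e]
  exact hD C' hC'

/-- Test equivalence is a labelled bisimulation. -/
theorem isLabelledBisimulation_testEquiv : IsLabelledBisimulation (TestEquiv (S := S)) := by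
  rintro D E ⟨hD, hE, U, hU, tD, tE, h⟩
  refine ⟨U, tD, tE, h.partialTrace_eq hU, ?_, fun μ δ => ⟨fun D' hD' =>
    TestEquiv.trans_left hD hE tD tE h hD', fun E' hE' => TestEquiv.trans_right hD hE tD tE h hE'⟩⟩
  intro F hF hpD hpE
  obtain ⟨r, K, hK, rfl⟩ := id hF
  refine testEquiv_of_null (superopApply_deterministic hD) (superopApply_deterministic hE)
    (superopApply_hasType tD) (superopApply_hasType tE) ?_
  have hN : Null U (krausVec K (vec D) - krausVec K (vec E)) := by
    rw [← map_sub]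
    exact h.kraus hK
  -- Mass and success probability are themselves obtained from tests, so both sides are rescaled by
  -- the same factor.
  have hp : superopProb U (krausMap K) D = superopProb U (krausMap K) E := by
    rw [superopProb_eq, superopProb_eq, ← sub_eq_zero, ← map_sub]
    exact hN _ (.mass U)
  rw [vec_superopApply, vec_superopApply, hp, h.mass_eq, ← smul_sub]
  intro φ hφ
  rw [map_smul, hN φ hφ, smul_zero]

theorem plug_weights_ne_zero {Q : Proc} {D : CDist S} {C : Conf S} :
    (plug Q D).weights (some C) ≠ 0 ↔
      ∃ C', D.weights (some C') ≠ 0 ∧ C = ⟨C'.state, .par C'.proc Q⟩ := by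
  rw [plug, map_weights_ne_zero]
  constructor
  · rintro ⟨_ | C', h1, h2⟩
    · exact nomatch h2
    · exact ⟨C', h1, (Option.some.inj h2).symm⟩
  · rintro ⟨C', h1, rfl⟩
    exact ⟨some C', h1, rfl⟩

theorem vec_mem_composable {U : Finset Qubit} {Q : Proc} {D : CDist S} (hD : Deterministic D)
    (tD : HasType U D) (hp : Deterministic (plug Q D)) :
    vec D ∈ procSpan S (Composable S U Q) :=
  vec_mem_procSpan fun C hC => ⟨(tD C hC).2, hD C hC,
    hp ⟨C.state, .par C.proc Q⟩ (plug_weights_ne_zero.2 ⟨C, hC, rfl⟩)⟩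

theorem HasType.plug {U V : Finset Qubit} {Q : Proc} {D : CDist S} (hD : HasType U D)
    (hUV : U ⊆ V) (hV : V ⊆ S) (hQ : Owns (V \ U) Q) : HasType V (plug Q D) := by
  intro C hC
  obtain ⟨C', hC', rfl⟩ := plug_weights_ne_zero.1 hC
  exact ⟨hV, (hD C' hC').2.par hQ hUV⟩

/-- Test equivalence is a saturated bisimulation. -/
theorem isSaturatedBisimulation_testEquiv : IsSaturatedBisimulation (TestEquiv (S := S)) := by
  rintro D E ⟨hD, hE, U, hU, tD, tE, h⟩
  refine ⟨U, tD, tE, h.mass_eq, ?_⟩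
  rintro Q ⟨V, hUV, hVS, hQ⟩ pD pE δ
  -- The context enlarges the type from `U` to `V`; closure of null vectors under composition
  -- reduces the rest to the labelled case with action `τ`.
  have hN : Null V (vec (plug Q D) - vec (plug Q E)) := by
    rw [vec_plug, vec_plug, ← map_sub]
    exact h.plugVec hUV hQ (sub_mem (vec_mem_composable hD tD pD) (vec_mem_composable hE tE pE))
  exact ⟨fun D' hD' => TestEquiv.trans_left pD pE (tD.plug hUV hVS hQ) (tE.plug hUV hVS hQ) hN hD',
    fun E' hE' => TestEquiv.trans_right pD pE (tD.plug hUV hVS hQ) (tE.plug hUV hVS hQ) hN hE'⟩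

/-! ### Labelled bisimilar distributions are identified by tests -/

/-- All contributions to the mass are nonnegative, so zero total probability makes every branch
vanish. This covers the superoperators whose normalised application is undefined. -/
theorem conjVec_vec_eq_zero {K : Op S} {D : CDist S} (h : massVec (conjVec K (vec D)) = 0) :
    conjVec K (vec D) = 0 := by
  have h1 : ∀ C : Option (Conf S), 0 ≤ massVec (conjVec K (C.elim 0 Conf.vec)) := by
    intro C
    cases C with
    | none => simp
    | some C =>
      rw [Option.elim_some, Conf.vec, conjVec_single, massVec_single]
      exact (Complex.le_def.1 (conjOp_posSemidef K C.state.2.1).trace_nonneg).1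
  rw [vec, map_expect, map_expect, expect, Finsupp.sum, Finset.sum_eq_zero_iff_of_nonneg
    fun C _ => smul_nonneg (D.nonneg C) (h1 C)] at h
  rw [vec, map_expect, expect, Finsupp.sum]
  refine Finset.sum_eq_zero fun C hC => ?_
  have h2 := (smul_eq_zero.1 (h C hC)).resolve_left (Finsupp.mem_support_iff.1 hC)
  cases C with
  | none => simp
  | some C =>
    rw [Option.elim_some, Conf.vec, conjVec_single, massVec_single] at h2
    rw [Option.elim_some, Conf.vec, conjVec_single]
    by_cases h3 : conjOp K C.state.1 = 0
    · rw [h3, Finsupp.single_zero, smul_zero]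
    · exact absurd h2 (trace_re_ne_zero (conjOp_posSemidef K C.state.2.1) h3)

/-- Induction on the test: each of its constructors is matched by a clause of labelled bisimulation.
For the mass, the trace of the reduced state suffices; distributions concentrated on `⊥`, whose type
is not determined, have vector zero. -/
theorem IsLabelledBisimulation.test_eq {R : CDist S → CDist S → Prop}
    (hR : IsLabelledBisimulation R) {U : Finset Qubit} {φ : OpVec S →ₗ[ℝ] ℝ} (hφ : IsTest U φ)
    {D E : CDist S} (h : R D E) (hD : Deterministic D) (hE : Deterministic E)
    (tD : HasType U D) (tE : HasType U E) : φ (vec D) = φ (vec E) := by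
  induction hφ generalizing D E with
  | act μ s _ ih =>
    obtain ⟨_, -, -, -, -, h5⟩ := hR D E h
    obtain ⟨D', hD'⟩ := Trans.total D μ (point s)
    obtain ⟨E', hE', h'⟩ := (h5 μ (point s)).1 D' hD'
    have := ih h' (hD'.deterministic hD) (hE'.deterministic hE) (hD'.hasType tD) (hE'.hasType tE)
    rwa [hD'.vec_eq_point hD, hE'.vec_eq_point hE] at this
  | mass U =>
    obtain ⟨V, sD, sE, h1, -⟩ := hR D E h
    by_cases hV : V ⊆ S
    · rw [massVec, LinearMap.comp_apply, LinearMap.comp_apply, ← quantumState_eq,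
        ← quantumState_eq, reTrace_apply, reTrace_apply, ← trace_partialTrace hV, h1,
        trace_partialTrace hV]
    · rw [vec_eq_zero fun C => ?_, vec_eq_zero fun C => ?_]
      · by_contra hC
        exact hV (sE C hC).1
      · by_contra hC
        exact hV (sD C hC).1
  | @conj U φ K hK _ ih =>
    obtain ⟨V, sD, sE, h1, h2, -⟩ := hR D E h
    by_cases hne : ∃ C : Conf S, D.weights (some C) ≠ 0 ∨ E.weights (some C) ≠ 0
    swap
    · push Not at hne
      rw [vec_eq_zero fun C => (hne C).1, vec_eq_zero fun C => (hne C).2]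
    obtain ⟨hU, rfl⟩ : U ⊆ S ∧ V = U := by
      obtain ⟨C, hC | hC⟩ := hne
      · exact ⟨(tD C hC).1, (sD C hC).2.unique (tD C hC).2⟩
      · exact ⟨(tE C hC).1, (sE C hC).2.unique (tE C hC).2⟩
    have hm : mass D = mass E := by
      rw [mass_eq, mass_eq, massVec, LinearMap.comp_apply, LinearMap.comp_apply,
        ← quantumState_eq, ← quantumState_eq, reTrace_apply, reTrace_apply,
        ← trace_partialTrace hU, h1, trace_partialTrace hU]
    have hm0 : mass E ≠ 0 := by
      obtain ⟨C, hC | hC⟩ := hne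
      · rw [← hm]; exact mass_ne_zero hC
      · exact mass_ne_zero hC
    obtain ⟨X, hX, rfl⟩ := isLocal_iff.1 hK
    have hp : massVec (conjVec (embed (envIncl S V) X) (vec D)) =
        massVec (conjVec (embed (envIncl S V) X) (vec E)) := by
      rw [massVec_conjVec_embed hU, massVec_conjVec_embed hU, ← quantumState_eq,
        ← quantumState_eq, h1]
    rw [LinearMap.comp_apply, LinearMap.comp_apply]
    by_cases h0 : massVec (conjVec (embed (envIncl S V) X) (vec E)) = 0
    · rw [conjVec_vec_eq_zero h0, conjVec_vec_eq_zero (hp.trans h0)]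
    have hkr : krausVec (fun _ : Fin 1 => X) = conjVec (embed (envIncl S V) X) := by
      simp [krausVec]
    have hF : IsSuperop (krausMap fun _ : Fin 1 => X) :=
      ⟨1, fun _ => X, by simpa using hX, rfl⟩
    have pE : superopProb V (krausMap fun _ : Fin 1 => X) E ≠ 0 := by
      rwa [superopProb_eq, hkr]
    have pD : superopProb V (krausMap fun _ : Fin 1 => X) D ≠ 0 := by
      rwa [superopProb_eq, hkr, hp]
    -- The bisimulation compares normalised results. The two normalising factors are equal and
    -- nonzero, so they can be cancelled at the end.
    have key := ih (h2 _ hF pD pE) (superopApply_deterministic hD) (superopApply_deterministic hE)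
      (superopApply_hasType tD) (superopApply_hasType tE)
    rw [vec_superopApply hF pD, vec_superopApply hF pE, superopProb_eq, superopProb_eq, hkr, hp,
      hm, map_smul, map_smul] at key
    exact smul_right_injective ℝ (div_ne_zero hm0 h0) key

theorem LabelledBisimilar.testEquiv {D E : CDist S} (h : LabelledBisimilar D E)
    (hD : Deterministic D) (hE : Deterministic E) : TestEquiv D E := by
  obtain ⟨R, hR, h⟩ := h
  obtain ⟨U, tD, tE, -⟩ := hR D E h
  refine testEquiv_of_null hD hE tD tE fun φ hφ => ?_
  rw [map_sub, hR.test_eq hφ h hD hE tD tE, sub_self]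

end TestEquiv

/-! ### Sequences of internal transitions -/

section Word

variable {S U : Finset Qubit} {P Q : Proc} {s : Sched} {ρ : Density S}

/-- The internal transitions selected by a list of schedulers. -/
noncomputable def runWord : List Sched → OpVec S →ₗ[ℝ] OpVec S
  | [] => .id
  | s :: w => runWord w ∘ₗ transMap .tau s

/-- Transitions in a context that does not take part in them. -/
theorem transMap_plugVec {G : Set Proc}
    (hG : ∀ P ∈ G, LocallyDeterministic S P ∧ LocallyDeterministic S (.par P Q))
    (hτ : ∀ (ρ : Density S) D, ¬ Step ρ Q .tau s D)
    (hv : ∀ (ρ : Density S) (μ : Act) t D, μ.Visible → ¬ Step ρ Q μ t D) {Z : OpVec S}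
    (hZ : Z ∈ procSpan S G) : transMap .tau s (plugVec Q Z) = plugVec Q (transMap .tau s Z) := by
  refine eq_of_procSpan (L := transMap .tau s ∘ₗ plugVec Q) (L' := plugVec Q ∘ₗ transMap .tau s)
    (fun ρ P hP => ?_) hZ
  obtain ⟨h1, h2⟩ := hG P hP
  rw [LinearMap.comp_apply, LinearMap.comp_apply, plugVec_single]
  by_cases h : ∃ D, Step ρ P .tau s D
  · obtain ⟨D, h⟩ := h
    rw [transMap_of_step h1 h, transMap_of_step h2 (.parL h trivial),
      fvec_map D fun P => .par P Q, plugVec]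
  · rw [transMap_of_not_step h, map_zero, transMap_of_not_step]
    rintro ⟨D, hD⟩
    rcases hD.par_cases with ⟨D', h', -⟩ | ⟨D', h', -⟩ | ⟨c, v, t, u, P', Q', -, -, -, h'⟩ |
      ⟨c, v, t, u, P', Q', -, -, h', -⟩
    · exact h ⟨D', h'⟩
    · exact hτ _ _ h'
    · exact hv _ (.inp c v) _ _ trivial h'
    · exact hv _ (.out c v) _ _ trivial h'

theorem DeterministicallyTagged.par_nil (hP : DeterministicallyTagged S P) (es : List Expr) :
    DeterministicallyTagged S (.par P (.nil es)) :=
  hP.par (.nil S es) (Finset.disjoint_empty_right _)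

/-- An inert component neither moves nor synchronizes, so plugging it commutes with every internal
transition. -/
theorem massVec_runWord_plugVec_nil (es : List Expr) (w : List Sched) {Z : OpVec S}
    (hZ : Z ∈ procSpan S {P | DeterministicallyTagged S P}) :
    massVec (runWord w (plugVec (.nil es) Z)) = massVec (runWord w Z) := by
  induction w generalizing Z with
  | nil => exact massVec_plugVec _ _
  | cons s w ih =>
    rw [runWord, LinearMap.comp_apply, LinearMap.comp_apply, transMap_plugVec
      (fun P hP => ⟨DeterministicallyTagged.locally hP, (DeterministicallyTagged.par_nil hP es).locally⟩)
      (fun _ _ h => Step.premise h) (fun _ _ _ _ _ h => Step.premise h) hZ]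
    exact ih (transMap_mem_procSpan (fun P hP => DeterministicallyTagged.locally hP)
      (fun ρ P hP D h C hC => DeterministicallyTagged.step hP h hC) hZ)

theorem Deterministic.vec_mem {D : CDist S} (hD : Deterministic D) :
    vec D ∈ procSpan S {P | DeterministicallyTagged S P} :=
  vec_mem_procSpan hD

theorem Deterministic.plug_nil {D : CDist S} (hD : Deterministic D) (es : List Expr) :
    Deterministic (plug (.nil es) D) := by
  intro C hC
  obtain ⟨C', hC', rfl⟩ := plug_weights_ne_zero.1 hC
  exact (hD C' hC').par_nil es

theorem IsSaturatedBisimulation.runWord_eq {R : CDist S → CDist S → Prop}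
    (hR : IsSaturatedBisimulation R) (w : List Sched) {D E : CDist S} (h : R D E)
    (hD : Deterministic D) (hE : Deterministic E) :
    massVec (runWord w (vec D)) = massVec (runWord w (vec E)) := by
  induction w generalizing D E with
  | nil =>
    obtain ⟨U, -, -, hm, -⟩ := hR D E h
    rwa [mass_eq, mass_eq] at hm
  | cons s w ih =>
    obtain ⟨U, tD, tE, -, hc⟩ := hR D E h
    by_cases hne : ∃ C : Conf S, D.weights (some C) ≠ 0 ∨ E.weights (some C) ≠ 0
    swap
    · push Not at hne
      rw [vec_eq_zero fun C => (hne C).1, vec_eq_zero fun C => (hne C).2]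
    have hU : U ⊆ S := by
      obtain ⟨C, hC | hC⟩ := hne
      · exact (tD C hC).1
      · exact (tE C hC).1
    -- Saturated bisimulations only offer moves inside a context; the inert process without qubits
    -- is the neutral one, and it can be erased afterwards.
    have hQ : IsContext S U (.nil []) :=
      ⟨U, subset_rfl, hU, rfl, by rw [Finset.sdiff_self]; exact .nil [] .nil rfl⟩
    have pD := hD.plug_nil []
    have pE := hE.plug_nil []
    obtain ⟨D', hD'⟩ := Trans.total (plug (.nil []) D) .tau (point s)
    obtain ⟨E', hE', h'⟩ := (hc _ hQ pD pE (point s)).1 D' hD'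
    have key := ih h' (hD'.deterministic pD) (hE'.deterministic pE)
    rw [hD'.vec_eq_point pD, hE'.vec_eq_point pE, vec_plug, vec_plug] at key
    rw [← massVec_runWord_plugVec_nil [] _ hD.vec_mem, ← massVec_runWord_plugVec_nil [] _ hE.vec_mem]
    exact key

/-- Sequences of internal transitions in a context do not distinguish bisimilar
distributions. -/
theorem IsSaturatedBisimulation.runWord_plug_eq {R : CDist S → CDist S → Prop}
    (hR : IsSaturatedBisimulation R) (w : List Sched) {D E : CDist S} (h : R D E)
    (hU : U ⊆ S) (tD : HasType U D) (tE : HasType U E) (hQ : Owns (S \ U) Q)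
    (pD : Deterministic (plug Q D)) (pE : Deterministic (plug Q E)) :
    massVec (runWord w (plugVec Q (vec D))) = massVec (runWord w (plugVec Q (vec E))) := by
  obtain ⟨V, sD, sE, hm, hc⟩ := hR D E h
  by_cases hne : ∃ C : Conf S, D.weights (some C) ≠ 0 ∨ E.weights (some C) ≠ 0
  swap
  · push Not at hne
    rw [vec_eq_zero fun C => (hne C).1, vec_eq_zero fun C => (hne C).2]
  obtain rfl : V = U := by
    obtain ⟨C, hC | hC⟩ := hne
    · exact (sD C hC).2.unique (tD C hC).2
    · exact (sE C hC).2.unique (tE C hC).2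
  cases w with
  | nil =>
    change massVec (plugVec Q (vec D)) = massVec (plugVec Q (vec E))
    rwa [massVec_plugVec, massVec_plugVec, ← mass_eq, ← mass_eq]
  | cons s w =>
    obtain ⟨D', hD'⟩ := Trans.total (plug Q D) .tau (point s)
    -- The context is plugged once, at the first move; it persists in the successors, which then run
    -- on their own.
    obtain ⟨E', hE', h'⟩ := (hc Q ⟨S, hU, subset_rfl, hQ⟩ pD pE (point s)).1 D' hD'
    have key := hR.runWord_eq w h' (hD'.deterministic pD) (hE'.deterministic pE)
    rwa [hD'.vec_eq_point pD, hE'.vec_eq_point pE, vec_plug, vec_plug] at key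

/-! ### Internal transitions with specific contexts -/

theorem transMap_parR (hd : LocallyDeterministic S (.par P Q)) {D : FDist (Conf S)}
    (h : Step ρ Q .tau s D) : transMap .tau s (Finsupp.single (.par P Q) ρ.1) =
      fvec (D.map fun C => ⟨C.state, .par P C.proc⟩) :=
  transMap_of_step hd (.parR h trivial)

/-- A parallel composition cannot move with a tag that occurs in neither component. -/
theorem transMap_tag_stuck {t : Tag} (hP : t ∉ P.tags) (hQ : ∀ D, ¬ Step ρ Q .tau (.tag t) D) :
    transMap .tau (.tag t) (Finsupp.single (.par P Q) ρ.1) = 0 := by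
  refine transMap_of_not_step ?_
  rintro ⟨D, h⟩
  rcases h.par_cases with ⟨D', h', -⟩ | ⟨D', h', -⟩ | ⟨c, v, t, u, P', Q', -, e, -⟩ |
    ⟨c, v, t, u, P', Q', -, e, -⟩
  · exact hP (h'.sched_tags (Finset.mem_singleton_self t))
  · exact hQ _ h'
  · cases e
  · cases e

theorem runWord_tau {a : Tag} (hd : LocallyDeterministic S (.par P (.tau a Q))) (w : List Sched) :
    runWord (.tag a :: w) (Finsupp.single (.par P (.tau a Q)) ρ.1) =
      runWord w (Finsupp.single (.par P Q) ρ.1) := by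
  rw [runWord, LinearMap.comp_apply, transMap_parR hd .tau, Convexity.StdSimplex.map_single,
    fvec_point, Conf.vec]

/-- A guarded process. -/
def guarded (a : Tag) (e : Expr) (v : Val) (Q N : Proc) : Proc :=
  .ite (.eq e (.val v)) (.tau a Q) N

theorem guarded_deterministic {a : Tag} {v w : Val} {N : Proc}
    (hQ : w = v → DeterministicallyTagged S Q) (hN : DeterministicallyTagged S N) :
    DeterministicallyTagged S (guarded a (.val w) v Q N) := by
  refine .ite (fun h => .tau (hQ ?_)) fun _ => hN
  have h' := h.unique (.eq (.val w) (.val v))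
  simpa using h'

theorem runWord_guarded_eq {a : Tag} {v : Val} {N : Proc}
    (hd : LocallyDeterministic S (.par P (guarded a (.val v) v Q N))) (w : List Sched) :
    runWord (.tag a :: w) (Finsupp.single (.par P (guarded a (.val v) v Q N)) ρ.1) =
      runWord w (Finsupp.single (.par P Q) ρ.1) := by
  have he : (Expr.eq (.val v) (.val v)).Eval (.bool true) := by
    simpa using Expr.Eval.eq (.val v) (.val v)
  rw [runWord, LinearMap.comp_apply, transMap_parR hd (.iteT .tau he),
    Convexity.StdSimplex.map_single, fvec_point, Conf.vec]

theorem runWord_guarded_ne {a : Tag} {v v' : Val} {es : List Expr} (hv : v' ≠ v) (ha : a ∉ P.tags)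
    (w : List Sched) : runWord (.tag a :: w)
      (Finsupp.single (.par P (guarded a (.val v') v Q (.nil es))) ρ.1) = 0 := by
  rw [runWord, LinearMap.comp_apply, transMap_tag_stuck ha, map_zero]
  intro D h
  rcases h.premise with ⟨he, -⟩ | ⟨-, h⟩
  · have h' := he.unique (.eq (.val v') (.val v))
    simp [hv] at h'
  · exact h.premise

/-- The tag `a` is fresh for `P`, so under `(a, t)` only the synchronization of this output with an
input of `P` tagged `t` remains. -/
theorem runWord_send {a t : Tag} {c : Chan} {v : Val} (hP : LocallyDeterministic S P)
    (hd : LocallyDeterministic S (.par P (.send a c (.val v) Q))) (ha : a ∉ P.tags)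
    (w : List Sched) :
    runWord (.pair a t :: w) (Finsupp.single (.par P (.send a c (.val v) Q)) ρ.1) =
      runWord w (plugVec Q (transMap (.inp c v) (.tag t) (Finsupp.single P ρ.1))) := by
  rw [runWord, LinearMap.comp_apply]
  congr 1
  by_cases h : ∃ D, Step ρ P (.inp c v) (.tag t) D
  · obtain ⟨D, h⟩ := h
    obtain ⟨t', P', -, rfl⟩ := h.exists_point trivial
    rw [transMap_of_step hP h, transMap_of_step hd (.synchR (.send (.val v)) h), fvec_point,
      fvec_point, Conf.vec, Conf.vec, plugVec_single]
  · rw [transMap_of_not_step h, map_zero, transMap_of_not_step]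
    rintro ⟨D, hD⟩
    rcases hD.par_cases with ⟨D', h', -⟩ | ⟨D', h', -⟩ | ⟨c', v', t, u, P', Q', -, e, -, h'⟩ |
      ⟨c', v', t', u, P', Q', -, e, h', h''⟩
    · exact ha (h'.sched_tags (by simp [Sched.tags]))
    · obtain ⟨_, -, e, -⟩ := h'.premise
      cases e
    · obtain ⟨_, -, e, -⟩ := h'.premise
      cases e
    · obtain ⟨v'', h1, e', -⟩ := h'.premise
      cases h1
      cases e'
      cases e
      exact h ⟨_, h''⟩

/-- Synchronization alone would accept any value sent by `P`. The guard lets the second scheduler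
pass only for `v`, so exactly the output of `v` is observed. -/
theorem runWord_recv {a t : Tag} {c : Chan} {v : Val} {x : Var} {Q₀ : Proc} {es : List Expr}
    (hU : U ⊆ S) (hP : Owns U P) (dP : DeterministicallyTagged S P)
    (hQ : Owns (S \ U) (.recv a c x (guarded a (.var x) v Q₀ (.nil es))))
    (hd : DeterministicallyTagged S (.par P (.recv a c x (guarded a (.var x) v Q₀ (.nil es)))))
    (hQ₀ : Q₀.subst x v = Q) (ha : a ∉ P.tags) (w : List Sched) :
    runWord (.pair t a :: .tag a :: w)
        (Finsupp.single (.par P (.recv a c x (guarded a (.var x) v Q₀ (.nil es)))) ρ.1) =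
      runWord w (plugVec Q (transMap (.out c v) (.tag t) (Finsupp.single P ρ.1))) := by
  have hsub : ∀ v', (guarded a (.var x) v Q₀ (.nil es)).subst x v' =
      guarded a (.val v') v (Q₀.subst x v') (.nil (es.map (Expr.subst x v'))) := fun v' => by
    simp [guarded, Proc.subst, Expr.subst]
  have hrecv : ∀ (v' : Val) P', Step ρ P (.out c v') (.tag t) (point ⟨ρ, P'⟩) →
      Step ρ (.par P (.recv a c x (guarded a (.var x) v Q₀ (.nil es)))) .tau (.pair t a)
        (point ⟨ρ, .par P' ((guarded a (.var x) v Q₀ (.nil es)).subst x v')⟩) := by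
    intro v' P' h
    obtain ⟨h1, h2⟩ := h.admissible hP
    refine .synchL h (.recv h1 (fun q hq => hU (mem_image_qubit.1 (h2 q hq))) ?_)
    rw [Act.fresh_iff hQ]
    rintro _ q ⟨⟩ hq
    exact (Finset.mem_sdiff.1 hq).2 (mem_image_qubit.1 (h2 q rfl))
  rw [runWord, LinearMap.comp_apply]
  by_cases h : ∃ v' D, Step ρ P (.out c v') (.tag t) D
  · obtain ⟨v', D, h⟩ := h
    obtain ⟨t', P', -, rfl⟩ := h.exists_point trivial
    have hs := hrecv v' P' h
    rw [transMap_of_step hd.locally hs, fvec_point, Conf.vec]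
    have hd' := (hd.step hs (C := ⟨ρ, _⟩) (point_weights_ne_zero.2 rfl)).locally
    simp only [hsub] at hd' ⊢
    by_cases hv : v' = v
    · subst hv
      rw [runWord_guarded_eq hd', transMap_of_step dP.locally h, fvec_point, Conf.vec,
        plugVec_single, hQ₀]
    -- On the wrong value the run deadlocks and loses its mass. The output of `v` is also impossible
    -- for `P`, because a tag selects at most one output, so both sides vanish.
    · rw [runWord_guarded_ne hv fun h' => ha (h.tags_subset (C := ⟨ρ, P'⟩)
        (point_weights_ne_zero.2 rfl) h'), transMap_of_not_step, map_zero, map_zero]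
      rintro ⟨D, h'⟩
      exact hv ((dP.locally ρ).2 _ _ _ _ _ _ _ h h').2
  · rw [transMap_of_not_step (P := P) fun ⟨D, h'⟩ => h ⟨v, D, h'⟩, transMap_of_not_step]
    · simp only [map_zero]
    rintro ⟨D, hD⟩
    rcases hD.par_cases with ⟨D', h', -⟩ | ⟨D', h', -⟩ | ⟨c', v', t', u, P', Q', -, e, h', h''⟩ |
      ⟨c', v', t', u, P', Q', -, e, h', h''⟩
    · exact ha (h'.sched_tags (by simp [Sched.tags]))
    · obtain ⟨_, -, -, -, e, -⟩ := h'.premise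
      cases e
    · obtain ⟨v'', -, -, -, e', -⟩ := h''.premise
      cases e'
      cases e
      exact h ⟨_, _, h'⟩
    · obtain ⟨v'', -, -, -, e', -⟩ := h'.premise
      cases e'

/-- Measuring and then checking the outcome keeps only branch `0`; the other one deadlocks, and what
is left is an unnormalised conjugation. -/
theorem runWord_meas {a : Tag} {n : ℕ} {M : Measurement n 2} {q : Fin n ↪ S} {y : Var}
    {es : List Expr} (hQ : y ∉ Q.fv)
    (hd : DeterministicallyTagged S (.par P (.meas a M (fun i => .val (.qubit (q i))) y
      (guarded a (.var y) (.nat 0) Q (.nil es))))) (ha : a ∉ P.tags) (w : List Sched) :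
    runWord (.tag a :: .tag a :: w)
        (Finsupp.single (.par P (.meas a M (fun i => .val (.qubit (q i))) y
          (guarded a (.var y) (.nat 0) Q (.nil es)))) ρ.1) =
      runWord w (plugVec Q (conjVec (embed q (M.op 0)) (Finsupp.single P ρ.1))) := by
  have hsub : ∀ v', (guarded a (.var y) (.nat 0) Q (.nil es)).subst y v' =
      guarded a (.val v') (.nat 0) Q (.nil (es.map (Expr.subst y v'))) := fun v' => by
    simp [guarded, Proc.subst, Expr.subst, Proc.subst_of_notMem v' hQ]
  have key : ∀ (m : Fin 2), conjOp (embed q (M.op m)) ρ.1 ≠ 0 →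
      LocallyDeterministic S (.par P
        (guarded a (.val (.nat m)) (.nat 0) Q (.nil (es.map (Expr.subst y (.nat m)))))) := by
    intro m hm
    rw [← hsub]
    refine (hd.step (.parR (.meas (ρ := ρ) q) trivial)
      (C := ⟨normalize ρ (M.branch q ρ m), _⟩) ?_).locally
    refine map_weights_ne_zero.2 ⟨⟨normalize ρ (M.branch q ρ m), _⟩,
      map_weights_ne_zero.2 ⟨m, ?_, rfl⟩, rfl⟩
    exact trace_re_ne_zero (conjOp_posSemidef _ ρ.2.1) hm
  -- Identities known for density operators extend to the unnormalised branch by linearity. A zero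
  -- branch must be separated: its guard is not reached, so nothing is known about its determinism.
  have hL : ∀ (m : Fin 2) (L L' : OpVec S →ₗ[ℝ] OpVec S) (P₁ : Proc),
      (conjOp (embed q (M.op m)) ρ.1 ≠ 0 → ∀ σ : Density S,
        L (Finsupp.single P₁ σ.1) = L' (Finsupp.single P₁ σ.1)) →
      L (Finsupp.single P₁ (conjOp (embed q (M.op m)) ρ.1)) =
        L' (Finsupp.single P₁ (conjOp (embed q (M.op m)) ρ.1)) := by
    intro m L L' P₁ h
    by_cases h0 : conjOp (embed q (M.op m)) ρ.1 = 0
    · rw [h0, Finsupp.single_zero, map_zero, map_zero]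
    · exact eq_of_procSpan (G := {P₁}) (fun σ R hR => by rw [hR]; exact h h0 σ)
        (single_posSemidef_mem ρ (conjOp_posSemidef _ ρ.2.1) fun _ => rfl)
  rw [runWord, LinearMap.comp_apply, transMap_parR hd.locally (.meas q)]
  have hmap : ((M.outcome q ρ).map fun m => (⟨normalize ρ (M.branch q ρ m),
      (guarded a (.var y) (.nat 0) Q (.nil es)).subst y (.nat m)⟩ : Conf S)).map
      (fun C => (⟨C.state, .par P C.proc⟩ : Conf S)) = (M.outcome q ρ).map fun m =>
        ⟨normalize ρ (M.branch q ρ m), .par P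
          (guarded a (.val (.nat m)) (.nat 0) Q (.nil (es.map (Expr.subst y (.nat m)))))⟩ := by
    rw [Convexity.StdSimplex.map_map]
    simp only [hsub]
  rw [hmap, fvec_meas M q ρ fun m => .par P
    (guarded a (.val (.nat m)) (.nat 0) Q (.nil (es.map (Expr.subst y (.nat m))))),
    Fin.sum_univ_two, map_add, conjVec_single]
  have h0 := hL 0 (runWord (.tag a :: w) ∘ₗ plugVec (guarded a (.val (.nat 0)) (.nat 0) Q
    (.nil (es.map (Expr.subst y (.nat 0)))))) (runWord w ∘ₗ plugVec Q) P fun h σ => by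
      simp only [LinearMap.comp_apply, plugVec_single]
      exact runWord_guarded_eq (key 0 h) w
  have h1 := hL 1 (runWord (.tag a :: w) ∘ₗ plugVec (guarded a (.val (.nat 1)) (.nat 0) Q
    (.nil (es.map (Expr.subst y (.nat 1)))))) 0 P fun h σ => by
      simp only [LinearMap.comp_apply, plugVec_single, LinearMap.zero_apply]
      exact runWord_guarded_ne (by simp) ha w
  simp only [LinearMap.comp_apply, plugVec_single, LinearMap.zero_apply] at h0 h1
  rw [plugVec_single, ← h0]
  exact (congrArg _ h1).trans (add_zero _)

/-- The prefix `a:τ` keeps the context idle while `P` performs `s`. Without it, `s` might select an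
action of `Q` or a synchronization with `Q`. -/
theorem runWord_internal {a : Tag} (hP : DeterministicallyTagged S P)
    (hQ : DeterministicallyTagged S Q) (hd : Disjoint P.tags (Proc.tau a Q).tags)
    (ha : a ∉ s.tags) (w : List Sched) :
    runWord (s :: .tag a :: w) (Finsupp.single (.par P (.tau a Q)) ρ.1) =
      runWord w (plugVec Q (transMap .tau s (Finsupp.single P ρ.1))) := by
  have hG : ∀ P' ∈ {P' | DeterministicallyTagged S P' ∧ P'.tags ⊆ P.tags},
      DeterministicallyTagged S (.par P' (.tau a Q)) := fun P' hP' =>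
    hP'.1.par hQ.tau (hd.mono_left hP'.2)
  have hm : Finsupp.single P ρ.1 ∈
      procSpan S {P' | DeterministicallyTagged S P' ∧ P'.tags ⊆ P.tags} :=
    single_mem_procSpan ρ ⟨hP, subset_rfl⟩
  rw [runWord, LinearMap.comp_apply, ← plugVec_single, transMap_plugVec
    (fun P' hP' => ⟨hP'.1.locally, (hG P' hP').locally⟩) (fun _ _ h => ?_)
    (fun _ μ _ _ hμ h => ?_) hm]
  · refine eq_of_procSpan (L := runWord (.tag a :: w) ∘ₗ plugVec (.tau a Q))
      (L' := runWord w ∘ₗ plugVec Q) (fun σ P' hP' => ?_)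
      (transMap_mem_procSpan (G' := {P' | DeterministicallyTagged S P' ∧ P'.tags ⊆ P.tags})
        (fun P' hP' => hP'.1.locally) (fun ρ P' hP' D hD C hC => ⟨hP'.1.step hD hC, (hD.tags_subset hC).trans hP'.2⟩) hm)
    simp only [LinearMap.comp_apply, plugVec_single]
    exact runWord_tau (hG P' hP').locally w
  · obtain ⟨-, rfl, -⟩ := h.premise
    exact ha (Finset.mem_singleton_self a)
  · obtain ⟨rfl, -⟩ := h.premise
    exact hμ

end Word

/-! ### Realization of tests by contexts -/

/-- The process that discards the qubits in `Γ`. -/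
noncomputable def discard (Γ : Finset Name) : Proc := .nil (Γ.toList.map Name.toExpr)

theorem typed_discard (Γ : Finset Name) : Typed Γ (discard Γ) :=
  .nil Γ.toList Γ.nodup_toList Γ.toList_toFinset

theorem fv_discard {Γ : Finset Name} {x : Var} (h : x ∈ (discard Γ).fv) :
    ∃ i, Name.var i ∈ Γ ∧ x = qvar i := by
  obtain ⟨e, he, hx⟩ := mem_fv_nil.1 h
  obtain ⟨a, ha, rfl⟩ := List.mem_map.1 he
  cases a with
  | qubit q => exact absurd hx (Finset.notMem_empty x)
  | var i => exact ⟨i, Finset.mem_toList.1 ha, Finset.mem_singleton.1 hx⟩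

theorem fv_discard_qubits (U : Finset Qubit) : (discard (U.image Name.qubit)).fv = ∅ := by
  rw [Finset.eq_empty_iff_forall_notMem]
  intro x hx
  obtain ⟨i, h, -⟩ := fv_discard hx
  simp at h

theorem owns_discard (U : Finset Qubit) : Owns U (discard (U.image Name.qubit)) :=
  ⟨fv_discard_qubits U, typed_discard _⟩

section Realizable

variable {S U : Finset Qubit} {φ : OpVec S →ₗ[ℝ] ℝ}

/-- The processes using the qubits in `U` and tags in `A`. -/
def Tagged (S U : Finset Qubit) (A : Finset Tag) : Set Proc :=
  {P | Owns U P ∧ DeterministicallyTagged S P ∧ P.tags ⊆ A}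

/-- The test `φ` is computed by the mass after some internal transitions in a context. -/
def Realizable (U : Finset Qubit) (φ : OpVec S →ₗ[ℝ] ℝ) : Prop :=
  ∀ A : Finset Tag, ∃ (Q : Proc) (w : List Sched), Owns (S \ U) Q ∧ DeterministicallyTagged S Q ∧
    Disjoint A Q.tags ∧ ∀ Z ∈ procSpan S (Tagged S U A),
      massVec (runWord w (plugVec Q Z)) = φ Z

/-- The run and the test are both linear, so one process in one state suffices. Disjointness of tags
guarantees that the composition is deterministically tagged. -/
theorem realizable_of_single (h : ∀ A : Finset Tag, ∃ (Q : Proc) (w : List Sched),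
    Owns (S \ U) Q ∧ DeterministicallyTagged S Q ∧ Disjoint A Q.tags ∧
      ∀ (ρ : Density S) (P : Proc), Owns U P → DeterministicallyTagged S P → P.tags ⊆ A →
        DeterministicallyTagged S (.par P Q) →
        massVec (runWord w (Finsupp.single (.par P Q) ρ.1)) = φ (Finsupp.single P ρ.1)) :
    Realizable U φ := by
  intro A
  obtain ⟨Q, w, h1, h2, h3, h4⟩ := h A
  refine ⟨Q, w, h1, h2, h3, fun Z hZ => ?_⟩
  refine eq_of_procSpan (L := massVec ∘ₗ runWord w ∘ₗ plugVec Q) (L' := φ) (fun ρ P hP => ?_) hZ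
  rw [LinearMap.comp_apply, LinearMap.comp_apply, plugVec_single]
  exact h4 ρ P hP.1 hP.2.1 hP.2.2 (hP.2.1.par h2 (h3.mono_left hP.2.2))

theorem realizable_mass (U : Finset Qubit) : Realizable (S := S) U massVec := fun _ =>
  ⟨discard _, [], owns_discard _, .nil S _, Finset.disjoint_empty_right _,
    fun _ _ => massVec_plugVec _ _⟩

/-- The scheduler `halt` enables no transition, so after it the mass is zero. -/
theorem realizable_zero
    (h : ∀ (ρ : Density S) (P : Proc), Owns U P → φ (Finsupp.single P ρ.1) = 0) :
    Realizable U φ := by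
  refine realizable_of_single fun A => ⟨discard _, [.halt], owns_discard _, .nil S _,
    Finset.disjoint_empty_right _, fun ρ P hP _ _ _ => ?_⟩
  rw [h ρ P hP, runWord, LinearMap.comp_apply,
    transMap_of_not_step fun ⟨D, hD⟩ => Step.not_halt hD, map_zero, map_zero]

theorem conjVec_mem_procSpan {G : Set Proc} {ρ : Density S} {P : Proc} (hP : P ∈ G) (K : Op S) :
    conjVec K (Finsupp.single P ρ.1) ∈ procSpan S G := by
  rw [conjVec_single]
  exact single_posSemidef_mem ρ (conjOp_posSemidef _ ρ.2.1) fun _ => hP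

theorem successor_mem {A : Finset Tag} {μ : Act} {s : Sched} {ρ : Density S} {P : Proc}
    (hU : Owns U P) (hd : DeterministicallyTagged S P) (hA : P.tags ⊆ A) :
    transMap μ s (Finsupp.single P ρ.1) ∈
      procSpan S (Tagged S (μ.after U) A) :=
  transMap_mem_procSpan (G := Tagged S U A) (G' := Tagged S (μ.after U) A) (fun _ hP => hP.2.1.locally) (fun _ _ hP _ h _ hC =>
      ⟨h.owns hP.1 hC, hP.2.1.step h hC, (h.tags_subset hC).trans hP.2.2⟩)
    (single_mem_procSpan ρ ⟨hU, hd, hA⟩)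

/-- The delaying tag avoids `s` as well as the tags in `A`, so that `s` cannot select the delay. -/
theorem Realizable.tau (h : Realizable U φ) (s : Sched) :
    Realizable U (φ ∘ₗ transMap .tau s) := by
  refine realizable_of_single fun A => ?_
  obtain ⟨Q, w, h1, h2, h3, h4⟩ := h A
  obtain ⟨a, ha⟩ := Infinite.exists_notMem_finset (A ∪ s.tags)
  rw [Finset.mem_union, not_or] at ha
  refine ⟨.tau a Q, s :: .tag a :: w, ⟨h1.1, .tau h1.2⟩, h2.tau,
    Finset.disjoint_insert_right.2 ⟨ha.1, h3⟩, fun ρ P hP dP hA _ => ?_⟩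
  rw [runWord_internal dP h2 ((Finset.disjoint_insert_right.2 ⟨ha.1, h3⟩).mono_left hA) ha.2,
    LinearMap.comp_apply]
  exact h4 _ (successor_mem (μ := .tau) hP dP hA)

theorem Realizable.conj (h : Realizable U φ) {K : Op S} (hK : IsLocal U K) :
    Realizable U (φ ∘ₗ conjVec K) := by
  refine realizable_of_single fun A => ?_
  obtain ⟨n, q, L, hq, hL, rfl⟩ := hK
  -- A contraction is completed to a two-outcome measurement by a square root of `1 - L†L`.
  obtain ⟨N, hN⟩ := exists_conjTranspose_mul_self hL
  obtain ⟨Q, w, h1, h2, h3, h4⟩ := h A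
  obtain ⟨a, ha⟩ := Infinite.exists_notMem_finset A
  have hy : ∀ P : Proc, P.fv = ∅ → (⟨.nat, 0⟩ : Var) ∉ P.fv := fun P hP => by simp [hP]
  have hM : ∑ m, (![L, N] m).conjTranspose * ![L, N] m = 1 := by
    rw [Fin.sum_univ_two]
    change L.conjTranspose * L + N.conjTranspose * N = 1
    rw [← hN, add_sub_cancel]
  have hdQ : Disjoint A (Proc.meas a (⟨![L, N], hM⟩ : Measurement n 2)
      (fun i => .val (.qubit (q i))) ⟨.nat, 0⟩
      (guarded a (.var ⟨.nat, 0⟩) (.nat 0) Q (discard ((S \ U).image .qubit)))).tags := by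
    rw [Finset.disjoint_left] at h3 ⊢
    intro b hb
    have := h3 hb
    simp only [guarded, discard, Proc.tags]
    grind
  refine ⟨_, .tag a :: .tag a :: w, ⟨?_, ?_⟩, .meas fun m => ?_, hdQ,
    fun ρ P hP dP hA hd => ?_⟩
  · simp [Proc.fv, Expr.fv, guarded, h1.1, fv_discard_qubits]
    exact Finset.eq_empty_iff_forall_notMem.2 fun x hx => by simp at hx
  · refine .meas (fun i => Name.qubit (q i)) (fun i j hij => ?_) (fun i => ?_) rfl
      (.ite (.eq (.var _) (.val (.nat 0))) (.tau h1.2) (typed_discard _))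
    · exact q.injective (Subtype.ext (Name.qubit.inj hij))
    · rw [mem_image_qubit]
      exact Finset.mem_sdiff.2 ⟨(q i).2, hq i⟩
  · simp only [guarded, Proc.subst, Expr.subst, if_true, discard]
    rw [Proc.subst_of_notMem _ (hy Q h1.1)]
    exact guarded_deterministic (fun _ => h2) (.nil S _)
  · rw [discard, runWord_meas (hy Q h1.1) hd (fun h => ha (hA h)), LinearMap.comp_apply]
    exact h4 _ (conjVec_mem_procSpan (G := Tagged S U A) ⟨hP, dP, hA⟩ _)

theorem not_step_of_not_admissible {μ : Act} {s : Sched}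
    (h : ¬ (μ.Admissible S (U.image Name.qubit) ∧ (μ.Visible → ∃ t, s = .tag t))) (ρ : Density S)
    {P : Proc} (hP : Owns U P) : transMap μ s (Finsupp.single P ρ.1) = 0 :=
  transMap_of_not_step fun ⟨_, hD⟩ => h ⟨hD.admissible hP, fun hμ =>
    let ⟨t, _, e, _⟩ := hD.exists_point hμ
    ⟨t, e⟩⟩

/-- The context supplies the value. A qubit to be received lies in the environment, so the context
owns it and gives it away by sending. -/
theorem Realizable.inp {c : Chan} {v : Val} (h : Realizable ((Act.inp c v).after U) φ)
    (hc : (Act.inp c v).Admissible S (U.image Name.qubit)) (t : Tag) :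
    Realizable U (φ ∘ₗ transMap (.inp c v) (.tag t)) := by
  refine realizable_of_single fun A => ?_
  obtain ⟨Q, w, h1, h2, h3, h4⟩ := h A
  obtain ⟨a, ha⟩ := Infinite.exists_notMem_finset A
  refine ⟨.send a c (.val v) Q, .pair a t :: w, ⟨?_, ?_⟩, h2.send,
    Finset.disjoint_insert_right.2 ⟨ha, h3⟩, fun ρ P hP dP hA hd => ?_⟩
  · simp [Proc.fv, Expr.fv, h1.1]
  · rcases v with n | b | q
    · exact .csend (by rw [← hc.1]; nofun) (by rw [← hc.1]; exact .val _) h1.2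
    · exact .csend (by rw [← hc.1]; nofun) (by rw [← hc.1]; exact .val _) h1.2
    · refine Typed.qsend (a := .qubit q) hc.1.symm ?_ ?_
      · rw [mem_image_qubit]
        exact Finset.mem_sdiff.2 ⟨(hc.2 q rfl).1, fun hq => (hc.2 q rfl).2 (mem_image_qubit.2 hq)⟩
      · rw [← Finset.image_erase fun _ _ h => Name.qubit.inj h, ← Finset.sdiff_insert]
        exact h1.2
  · rw [runWord_send dP.locally hd.locally fun h => ha (hA h), LinearMap.comp_apply]
    exact h4 _ (successor_mem hP dP hA)

/-- The common part of the classical and the quantum case: `Q` continues the test once `v` has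
arrived, and `Q₀` is its form before the reception. -/
theorem Realizable.recv {c : Chan} {v : Val} (hU : U ⊆ S)
    (h : ∀ A : Finset Tag, ∃ (Q : Proc) (w : List Sched) (Q₀ : Proc) (Γ : Finset Name) (x : Var),
      DeterministicallyTagged S Q ∧ Disjoint A Q.tags ∧ Q₀.subst x v = Q ∧
      (∀ a, Owns (S \ U) (.recv a c x (guarded a (.var x) v Q₀ (discard Γ)))) ∧
      ∀ Z ∈ procSpan S (Tagged S ((Act.out c v).after U) A), massVec (runWord w (plugVec Q Z)) = φ Z) (t : Tag) :
    Realizable U (φ ∘ₗ transMap (.out c v) (.tag t)) := by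
  refine realizable_of_single fun A => ?_
  obtain ⟨Q, w, Q₀, Γ, x, h2, h3, h5, h1, h4⟩ := h A
  obtain ⟨a, ha⟩ := Infinite.exists_notMem_finset A
  refine ⟨_, .pair t a :: .tag a :: w, h1 a, .recv fun v' _ => ?_, ?_, fun ρ P hP dP hA hd => ?_⟩
  · simp only [guarded, Proc.subst, Expr.subst, if_true, discard]
    refine guarded_deterministic (fun e => ?_) (.nil S _)
    rw [e, h5]
    exact h2
  · rw [← h5, Proc.tags_subst, Finset.disjoint_left] at h3
    rw [Finset.disjoint_left]
    intro b hb
    have := h3 hb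
    simp only [guarded, discard, Proc.tags]
    grind
  · rw [discard, runWord_recv hU hP dP (h1 a) hd h5 fun h => ha (hA h), LinearMap.comp_apply]
    exact h4 _ (successor_mem hP dP hA)

/-- For a classical value the continuation is closed and needs no change. For a qubit `q`, the
continuation owns `q`, but before the reception `q` belongs to the process, so its name must be
replaced by the bound variable. -/
theorem Realizable.out {c : Chan} {v : Val} (hU : U ⊆ S)
    (h : Realizable ((Act.out c v).after U) φ)
    (hc : (Act.out c v).Admissible S (U.image Name.qubit)) (t : Tag) :
    Realizable U (φ ∘ₗ transMap (.out c v) (.tag t)) := by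
  refine Realizable.recv hU (fun A => ?_) t
  obtain ⟨Q, w, h1, h2, h3, h4⟩ := h A
  by_cases hv : c.ty = .qubit
  · obtain ⟨q, rfl⟩ : ∃ q, v = .qubit q := by
      rcases v with _ | _ | q
      · exact nomatch hc.1.trans hv
      · exact nomatch hc.1.trans hv
      · exact ⟨q, rfl⟩
    have hq : q ∈ U := mem_image_qubit.1 (hc.2 q rfl)
    -- The variable avoids all the free and bound ones of `Q`, so that receiving `q` restores `Q`
    -- exactly.
    obtain ⟨x, hx⟩ := Infinite.exists_notMem_finset (Q.vars.preimage qvar qvar_injective.injOn)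
    rw [Finset.mem_preimage] at hx
    refine ⟨Q, w, Q.abstract q (qvar x), insert (.var x) ((S \ U).image .qubit), qvar x, h2, h3,
      Proc.subst_abstract hx, fun a => ⟨?_, ?_⟩, h4⟩
    · rw [Finset.eq_empty_iff_forall_notMem]
      intro y hy
      obtain ⟨hy, hy'⟩ := Finset.mem_erase.1 hy
      simp only [guarded, Proc.fv, Expr.fv, Finset.mem_union, Finset.mem_singleton,
        Finset.notMem_empty, or_false] at hy'
      rcases hy' with (hy' | hy') | hy'
      · exact hy hy'
      · have := Proc.fv_abstract q (qvar x) Q hy'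
        rw [h1.1, Finset.mem_insert] at this
        exact hy (this.resolve_right (Finset.notMem_empty y))
      · obtain ⟨i, hi, rfl⟩ := fv_discard hy'
        simp only [Finset.mem_insert, Name.var.injEq, Finset.mem_image, reduceCtorEq, and_false,
          exists_false, or_false] at hi
        exact hy (by rw [hi])
    · refine .qrecv hv (by simp) (.ite (.eq (.var (qvar x)) (.val (.qubit q))) (.tau ?_)
        (typed_discard _))
      refine Typed.abstract ?_ ?_ hx (by simp)
      · rw [← Finset.image_insert]
        have : insert q (S \ U) = S \ U.erase q := by
          have := hU hq
          grind
        rw [this]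
        exact h1.2
      · rw [mem_image_qubit]
        exact fun h' => (Finset.mem_sdiff.1 h').2 hq
  · have hQ : ∀ x, Q.subst x v = Q := fun x => Proc.subst_of_notMem _ (by simp [h1.1])
    have hU' : (Act.out c v).after U = U := by
      rcases v with _ | _ | q
      · rfl
      · rfl
      · exact absurd hc.1.symm hv
    rw [hU'] at h1
    refine ⟨Q, w, Q, (S \ U).image .qubit, ⟨c.ty, 0⟩, h2, h3, hQ _, fun a => ⟨?_, ?_⟩, h4⟩
    · simp [guarded, Proc.fv, Expr.fv, h1.1, fv_discard_qubits]
    · refine .crecv hv rfl (.ite (.eq (.var _) ?_) (.tau h1.2) (typed_discard _))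
      rw [← hc.1]
      exact .val v

theorem IsTest.realizable (hφ : IsTest U φ) (hU : U ⊆ S) : Realizable U φ := by
  induction hφ with
  | mass U => exact realizable_mass U
  | conj hK _ ih => exact (ih hU).conj hK
  | @act U φ μ s _ ih =>
    by_cases hμ : μ.Admissible S (U.image Name.qubit) ∧ (μ.Visible → ∃ t, s = .tag t)
    swap
    -- An action excluded by typing, or a visible action with a scheduler that is not a single tag,
    -- is never performed, so the test is identically zero.
    · refine realizable_zero fun ρ P hP => ?_
      rw [LinearMap.comp_apply, not_step_of_not_admissible hμ ρ hP, map_zero]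
    obtain ⟨hc, hs⟩ := hμ
    rcases μ with _ | ⟨c, v⟩ | ⟨c, v⟩
    · exact (ih hU).tau s
    · obtain ⟨t, rfl⟩ := hs trivial
      refine Realizable.out hU (ih ?_) hc t
      rcases v with _ | _ | q
      · exact hU
      · exact hU
      · exact (Finset.erase_subset _ _).trans hU
    · obtain ⟨t, rfl⟩ := hs trivial
      refine Realizable.inp (ih ?_) hc t
      rcases v with _ | _ | q
      · exact hU
      · exact hU
      · exact Finset.insert_subset (hc.2 q rfl).1 hU

/-- The tags of the processes of a distribution. -/
noncomputable def supportTags (D : CDist S) : Finset Tag :=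
  D.weights.support.biUnion fun C => C.elim ∅ fun C => C.proc.tags

theorem tags_subset_supportTags {D : CDist S} {C : Conf S} (hC : D.weights (some C) ≠ 0) :
    C.proc.tags ⊆ supportTags D :=
  Finset.subset_biUnion_of_mem (fun C : Option (Conf S) => C.elim ∅ fun C => C.proc.tags)
    (Finsupp.mem_support_iff.2 hC)

theorem Deterministic.plug_of_disjoint {D : CDist S} {Q : Proc} (hD : Deterministic D)
    (hQ : DeterministicallyTagged S Q) (h : Disjoint (supportTags D) Q.tags) :
    Deterministic (plug Q D) := by
  intro C hC
  obtain ⟨C', hC', rfl⟩ := plug_weights_ne_zero.1 hC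
  exact (hD C' hC').par hQ (h.mono_left (tags_subset_supportTags hC'))

/-- The realising context depends on the test and on a finite set of tags to avoid, not on the
distribution, so one context and one word serve both sides. -/
theorem SaturatedBisimilar.testEquiv {D E : CDist S} (h : SaturatedBisimilar D E)
    (hD : Deterministic D) (hE : Deterministic E) : TestEquiv D E := by
  obtain ⟨R, hR, h⟩ := h
  obtain ⟨U, tD, tE, -⟩ := hR D E h
  refine testEquiv_of_null hD hE tD tE fun φ hφ => ?_
  rw [map_sub, sub_eq_zero]
  by_cases hU : U ⊆ S
  swap
  · rw [vec_eq_zero fun C => by_contra fun hC => hU (tD C hC).1,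
      vec_eq_zero fun C => by_contra fun hC => hU (tE C hC).1]
  -- Avoiding the tags of both distributions keeps both compositions deterministically tagged, as
  -- the saturated clause demands of its contexts.
  obtain ⟨Q, w, h1, h2, h3, h4⟩ := hφ.realizable hU (supportTags D ∪ supportTags E)
  rw [Finset.disjoint_union_left] at h3
  rw [← h4 _ (vec_mem_procSpan fun C hC => ⟨(tD C hC).2, hD C hC,
      (tags_subset_supportTags hC).trans Finset.subset_union_left⟩),
    ← h4 _ (vec_mem_procSpan fun C hC => ⟨(tE C hC).2, hE C hC,
      (tags_subset_supportTags hC).trans Finset.subset_union_right⟩)]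
  exact hR.runWord_plug_eq w h hU tD tE h1 (hD.plug_of_disjoint h2 h3.1)
    (hE.plug_of_disjoint h2 h3.2)

end Realizable

end LqCCS

theorem mainTheorem1 (S : Finset LqCCS.Qubit) (D E : LqCCS.CDist S)
    (hD : LqCCS.Deterministic D) (hE : LqCCS.Deterministic E) :
    LqCCS.LabelledBisimilar D E ↔ LqCCS.SaturatedBisimilar D E :=
  ⟨fun h => ⟨_, LqCCS.isSaturatedBisimulation_testEquiv, h.testEquiv hD hE⟩,
    fun h => ⟨_, LqCCS.isLabelledBisimulation_testEquiv, h.testEquiv hD hE⟩⟩
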